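/- **Conventions.** $[X]$ denotes the closed linear span; for sets of operators, $XY$ is the set of products and $X^*$ the set of adjoints. *Bases and modules.* A $C^*$-base is a triple $\mathfrak b=(\mathfrak K,\mathfrak B,\mathfrak B^\dagger)$ of a Hilbert space $\mathfrak K$ and two commuting nondegenerate $C^*$-algebras $\mathfrak B,\mathfrak B^\dagger\subseteq\mathcal L(\mathfrak K)$; put $\mathfrak b^\dagger=(\mathfrak K,\mathfrak B^\dagger,\mathfrak B)$. A $C^*$-$\mathfrak b$-module $H_\alpha$ is a Hilbert space $H$ with a closed subspace $\alpha\subseteq\mathcal L(\mathfrak K,H)$ such that $[\alpha\mathfrak K]=H$, $[\alpha\mathfrak B]=\alpha$, $[\alpha^*\alpha]=\mathfrak B$. It carries the representation $\rho_\alpha$ of $\mathfrak B^\dagger$ on $H$, $\rho_\alpha(b^\dagger)\xi\zeta=\xi b^\dagger\zeta$. Put $M(\alpha)=\{T\in\mathcal L(\mathfrak K,H): T\mathfrak B\subseteq\alpha,\ T^*\alpha\subseteq\mathfrak B\}$. A $C^*$-$(\mathfrak b_1,\dots,\mathfrak b_n)$-module $(H,\alpha_1,\dots,\alpha_n)$ consists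 of $C^*$-$\mathfrak b_i$-modules $H_{\alpha_i}$ with $[\rho_{\alpha_i}(\mathfrak B_i^\dagger)\alpha_j]=\alpha_j$ for $i\ne j$. Let $\mathcal L_s(H_\alpha,K_\gamma)$ be the set of all $T\in\mathcal L(H,K)$ with $T\alpha\subseteq\gamma$ and let $\mathcal L(H_\alpha,K_\gamma)$ be the set of those that also satisfy $T^*\gamma\subseteq\alpha$; for modules with several structures take intersections. *Relative tensor product.* For a $C^*$-$\mathfrak b$-module $H_\alpha$ and a $C^*$-$\mathfrak b^\dagger$-module $K_\gamma$, $H\,{}_\alpha\!\otimes_\gamma K$ is the Hilbert space generated by elements $\xi\otimes\zeta\otimes\eta$ ($\xi\in\alpha,\zeta\in\mathfrak K,\eta\in\gamma$) with $\langle\xi\otimes\zeta\otimes\eta|\xi'\otimes\zeta'\otimes\eta'\rangle=\langle\zeta|\xi^*\xi'\eta^*\eta'\zeta'\rangle$. There are operators $|\xi\rangle_1\colon K\to H\,{}_\alpha\!\otimes_\gamma K$, $\eta\zeta\mapsto\xi\otimes\zeta\otimes\eta$, and $|\eta\rangle_2\colon H\to H\,{}_\alpha\!\otimes_\gamma K$,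 $\xi\zeta\mapsto\xi\otimes\zeta\otimes\eta$, with adjoints $\langle\xi|_1,\langle\eta|_2$; $|\xi\rangle_1$ is defined likewise for $\xi\in M(\alpha)$ by $|\xi\rangle_1\eta\zeta=|\eta\rangle_2\xi\zeta$. For further structures put $\delta\triangleleft\gamma=[|\gamma\rangle_2\delta]$ ($\delta\subseteq\mathcal L(\mathfrak K,H)$) and $\alpha\triangleright\delta=[|\alpha\rangle_1\delta]$ ($\delta\subseteq\mathcal L(\mathfrak K,K)$). The operators $S\otimes\mathrm{Id}$ and $\mathrm{Id}\otimes T$ are given by $(S\otimes\mathrm{Id})|\eta\rangle_2=|\eta\rangle_2S$ and $(\mathrm{Id}\otimes T)|\xi\rangle_1=|\xi\rangle_1T$, whenever $S$ intertwines the representations $\rho$ of $\mathfrak B^\dagger$ and $T$ those of $\mathfrak B$. The relative tensor product is associative up to canonical unitaries, and there are canonical unitaries $\mathfrak K\,{}_{\mathfrak B}\!\otimes_\gamma K\cong K$, $b\otimes\zeta\otimes\eta\mapsto\eta b\zeta$, and $H\,{}_\alpha\!\otimes_{\mathfrak B^\dagger}\mathfrak K\cong H$, $\xi\otimes\zeta\otimes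 b^\dagger\mapsto\xi b^\dagger\zeta$; the flip $\Sigma$ maps $\xi\otimes\zeta\otimes\eta$ to $\eta\otimes\zeta\otimes\xi$. *$C^*$-pseudo-multiplicative unitaries.* This is a tuple $(\mathfrak b,H,\hat\beta,\alpha,\beta,V)$ of a $C^*$-base $\mathfrak b$, a $C^*$-$(\mathfrak b^\dagger,\mathfrak b,\mathfrak b^\dagger)$-module $(H,\hat\beta,\alpha,\beta)$ and a unitary $V\colon H\,{}_{\hat\beta}\!\otimes_\alpha H\to H\,{}_\alpha\!\otimes_\beta H$ with $$V(\alpha\triangleleft\alpha)=\alpha\triangleright\alpha,\quad V(\hat\beta\triangleright\beta)=\hat\beta\triangleleft\beta,\quad V(\hat\beta\triangleright\hat\beta)=\alpha\triangleright\hat\beta,\quad V(\beta\triangleleft\alpha)=\beta\triangleleft\beta,$$ that satisfies the pentagon equation $V_{12}V_{13}V_{23}=V_{23}V_{12}$, where $V_{12}=V\otimes\mathrm{Id}$, $V_{23}=\mathrm{Id}\otimes V$, $V_{13}=\Sigma_{23}(V\otimes\mathrm{Id})(\mathrm{Id}\otimes\Sigma)$ and $\Sigma_{23}$ is the unitary with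 $\Sigma_{23}|\xi\rangle_2|\eta\rangle_2=|\eta\rangle_2|\xi\rangle_2$ for $\xi\in\alpha$, $\eta\in\beta$. *Fixed elements, étale, regular.* Let $\mathrm{Fix}(V)$ be the set of all $\eta\in M(\hat\beta)\cap M(\alpha)$ with $V|\eta\rangle_1=|\eta\rangle_1$. $V$ is étale if $\eta^*\eta=\mathrm{Id}_{\mathfrak K}$ for some $\eta\in\mathrm{Fix}(V)$. $V$ is regular if $[\langle\alpha|_1V|\alpha\rangle_2]=[\alpha\alpha^*]$. *Legs.* Put $\hat A_V=[\langle\beta|_2V|\alpha\rangle_2]\subseteq\mathcal L(H)$ and $\hat\Delta_V(y)=V^*(\mathrm{Id}\otimes y)V$. Let $\mathbf 1\colon\mathfrak K\,{}_{\mathfrak B^\dagger}\!\otimes_\alpha H\cong H\cong\mathfrak K\,{}_{\mathfrak B}\!\otimes_\beta H$ be the trivial representation and $\hat A_{\mathbf 1}=[\langle\beta|_2\mathbf 1|\alpha\rangle_2]\subseteq\mathcal L(\mathfrak K)$. Let $\tilde\Omega_{\beta,\alpha}$ be the space of all maps $\omega_{\xi,\eta}\colon\rho_{\hat\beta}(\mathfrak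 B)'\to\mathcal L(\mathfrak K)$, $T\mapsto\sum_n\xi_n^*T\eta_n$, where $(\xi_n)_n$ in $\beta$ and $(\eta_n)_n$ in $\alpha$ are sequences for which $\sum_n\xi_n^*\xi_n$ and $\sum_n\eta_n^*\eta_n$ converge in norm, and put $\hat\pi_V(\omega_{\xi,\eta})=\sum_n\langle\xi_n|_2V|\eta_n\rangle_2$, $\hat\pi_{\mathbf 1}(\omega_{\xi,\eta})=\sum_n\langle\xi_n|_2\mathbf 1|\eta_n\rangle_2$. *Algebras over bases.* Let $\mathfrak c=(\mathfrak K,\mathfrak C,\mathfrak C^\dagger)$ be a $C^*$-base. A $C^*$-$(\mathfrak c^\dagger,\mathfrak c)$-algebra $A_H^{\beta,\alpha}$ is a $C^*$-$(\mathfrak c^\dagger,\mathfrak c)$-module $(H,\beta,\alpha)$ with a $C^*$-algebra $A\subseteq\mathcal L(H)$ such that $\rho_\beta(\mathfrak C)A\subseteq A$ and $\rho_\alpha(\mathfrak C^\dagger)A\subseteq A$. For a $*$-homomorphism $\pi\colon A\to C\subseteq \mathcal L(K)$ let $\mathcal L^\pi(H,K)=\{T: Ta=\pi(a)T\ \forall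 a\in A\}$. It is a jointly (semi-)normal morphism $A_H^{\beta,\alpha}\to C_K^{\delta,\gamma}$ if $[I\beta]=\delta$ and $[I\alpha]=\gamma$, where $I=\mathcal L^\pi(H,K)\cap\mathcal L_{(s)}(H_\beta,K_\delta)\cap\mathcal L_{(s)}(H_\alpha,K_\gamma)$. The fiber product $A\,{}_\alpha\!*_\gamma B$ of $A\subseteq\mathcal L(H)$ and $B\subseteq\mathcal L(K)$ consists of all $x\in\mathcal L(H\,{}_\alpha\!\otimes_\gamma K)$ such that $x|\alpha\rangle_1$ and $x^*|\alpha\rangle_1$ are contained in $[|\alpha\rangle_1B]$ and $x|\gamma\rangle_2$ and $x^*|\gamma\rangle_2$ in $[|\gamma\rangle_2A]$. For morphisms $\phi,\psi$ as above on $A,B$ with values in $\mathcal L(L),\mathcal L(M)$, $(\phi*\psi)(x)$ is the unique operator $y$ with $yR=Rx$ for all $R$ of the form $(S\otimes\mathrm{Id})(\mathrm{Id}\otimes T)$ or $(\mathrm{Id}\otimes T)(S\otimes\mathrm{Id})$ with $S\in\mathcal L^\phi(H,L)$, $T\in\mathcal L^\psi(K,M)$. A (normal) Hopf $C^*$-bimodule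 over $\mathfrak c$ is a $C^*$-$(\mathfrak c^\dagger,\mathfrak c)$-algebra $A^{\beta,\alpha}_H$ with a jointly semi-normal (jointly normal) morphism $\Delta$ to $(A\,{}_\alpha\!*_\beta A)^{\beta\triangleleft\beta,\alpha\triangleright\alpha}$ such that $(\Delta*\mathrm{Id})\Delta=(\mathrm{Id}*\Delta)\Delta$. A bounded counit for it is a jointly semi-normal morphism $\epsilon\colon A_H^{\beta,\alpha}\to\mathcal L(\mathfrak K)^{\mathfrak C^\dagger,\mathfrak C}_{\mathfrak K}$ such that $(\epsilon*\mathrm{Id})(\Delta(a))$ and $(\mathrm{Id}*\epsilon)(\Delta(a))$ correspond to $a$ under the canonical unitaries $\mathfrak K\,{}_{\mathfrak C}\!\otimes_\beta H\cong H$ and $H\,{}_\alpha\!\otimes_{\mathfrak C^\dagger}\mathfrak K\cong H$, for all $a\in A$. **Theorem.** Let $(\mathfrak b,H,\hat\beta,\alpha,\beta,V)$ be an étale $C^*$-pseudo-multiplicative unitary. 1. $\hat A_V$ and $\hat A_{\mathbf 1}$ are closed under multiplication, the sums defining $\hat\pi_V$ and $\hat\pi_{\mathbf 1}$ converge in norm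 and depend only on $\omega_{\xi,\eta}$, and there exists a unique contractive homomorphism $\hat\epsilon\colon\hat A_V\to\hat A_{\mathbf 1}$ such that $\hat\pi_{\mathbf 1}=\hat\epsilon\circ\hat\pi_V$ on $\tilde\Omega_{\beta,\alpha}$. For every $\eta_0\in\mathrm{Fix}(V)$ with $\eta_0^*\eta_0=\mathrm{Id}_{\mathfrak K}$ it is given by $\hat\epsilon(\hat a)=\eta_0^*\hat a\eta_0$. 2. If $V$ is regular, then $((\hat A_V)_H^{\alpha,\hat\beta},\hat\Delta_V)$ is a normal Hopf $C^*$-bimodule over $\mathfrak b^\dagger$, $\hat\epsilon$ is a jointly normal morphism from $(\hat A_V)_H^{\alpha,\hat\beta}$ to $(\hat A_{\mathbf 1})_{\mathfrak K}^{\mathfrak B,\mathfrak B^\dagger}$, and $\hat\epsilon$ is a bounded counit for $((\hat A_V)_H^{\alpha,\hat\beta},\hat\Delta_V)$. -/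

import Mathlib

open scoped InnerProductSpace
open ContinuousLinearMap (adjoint)

noncomputable section

namespace CPMU

section General
variable {E F : Type*} [NormedAddCommGroup E] [NormedSpace ℂ E]
  [NormedAddCommGroup F] [NormedSpace ℂ F]

/-- The closed linear span `[S]` of a subset `S` of a normed space. -/
def cspan (S : Set E) : Submodule ℂ E := (Submodule.span ℂ S).topologicalClosure

theorem isClosed_cspan (S : Set E) : IsClosed (cspan S : Set E) :=
  Submodule.isClosed_topologicalClosure _

theorem subset_cspan {S : Set E} {x : E} (hx : x ∈ S) : x ∈ cspan S :=
  Submodule.le_topologicalClosure _ (Submodule.subset_span hx)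

theorem cspan_le {S : Set E} {W : Submodule ℂ E} (hW : IsClosed (W : Set E))
    (h : ∀ s ∈ S, s ∈ W) : cspan S ≤ W :=
  Submodule.topologicalClosure_minimal _ (Submodule.span_le.2 h) hW

theorem map_mem_of_mem_cspan {S : Set E} {W : Submodule ℂ F} (hW : IsClosed (W : Set F))
    (f : E →L[ℂ] F) (h : ∀ s ∈ S, f s ∈ W) {x : E} (hx : x ∈ cspan S) : f x ∈ W := by
  have : cspan S ≤ W.comap (f : E →ₗ[ℂ] F) :=
    cspan_le (hW.preimage f.continuous) h
  exact this hx

theorem comp_left_mem {G : Type*} [NormedAddCommGroup G] [NormedSpace ℂ G] {S : Set (E →L[ℂ] F)}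
    {W : Submodule ℂ (E →L[ℂ] G)} (hW : IsClosed (W : Set (E →L[ℂ] G))) (k : F →L[ℂ] G)
    (h : ∀ s ∈ S, k ∘L s ∈ W) {x : E →L[ℂ] F} (hx : x ∈ cspan S) : k ∘L x ∈ W :=
  map_mem_of_mem_cspan hW (ContinuousLinearMap.compL ℂ E F G k) h hx

theorem comp_right_mem {G : Type*} [NormedAddCommGroup G] [NormedSpace ℂ G] {S : Set (F →L[ℂ] G)}
    {W : Submodule ℂ (E →L[ℂ] G)} (hW : IsClosed (W : Set (E →L[ℂ] G))) (k : E →L[ℂ] F)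
    (h : ∀ s ∈ S, s ∘L k ∈ W) {x : F →L[ℂ] G} (hx : x ∈ cspan S) : x ∘L k ∈ W :=
  map_mem_of_mem_cspan hW ((ContinuousLinearMap.compL ℂ E F G).flip k) h hx

theorem clm_ext_of_total {I : Type*} {x : I → E} (hx : cspan (Set.range x) = ⊤)
    {S T : E →L[ℂ] F} (h : ∀ i, S (x i) = T (x i)) : S = T := by
  ext v
  have hv : v ∈ cspan (Set.range x) := by rw [hx]; trivial
  have := map_mem_of_mem_cspan (W := (⊥ : Submodule ℂ F)) (by simp) (S - T)
    (by rintro _ ⟨i, rfl⟩; simp [h i]) hv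
  simpa [sub_eq_zero] using this

/-- The bounded linear operator that maps `x i` to `y i` for each `i`. It is unique if the
`x i` span a dense subspace; the value is `0` if there is no such operator. -/
def clmOf {I : Type*} (x : I → E) (y : I → F) : E →L[ℂ] F :=
  open Classical in
  if h : ∃ T : E →L[ℂ] F, ∀ i, T (x i) = y i then h.choose else 0

theorem clmOf_spec {I : Type*} {x : I → E} {y : I → F}
    (h : ∃ T : E →L[ℂ] F, ∀ i, T (x i) = y i) (i : I) : clmOf x y (x i) = y i := by
  unfold clmOf
  rw [dif_pos h]
  exact h.choose_spec i

variable [CompleteSpace F]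

theorem exists_clm_of_bound {I : Type*} (x : I → E) (y : I → F)
    (hx : cspan (Set.range x) = ⊤) (C : ℝ)
    (h : ∀ f : I →₀ ℂ, ‖Finsupp.linearCombination ℂ y f‖ ≤
      C * ‖Finsupp.linearCombination ℂ x f‖) :
    ∃ T : E →L[ℂ] F, (∀ i, T (x i) = y i) ∧ ∀ v, ‖T v‖ ≤ C * ‖v‖ := by
  have hd : DenseRange (Finsupp.linearCombination ℂ x) := by
    have : (Submodule.span ℂ (Set.range x)).topologicalClosure = ⊤ := hx
    rw [← Finsupp.range_linearCombination] at this
    exact (Submodule.dense_iff_topologicalClosure_eq_top).2 this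
  refine ⟨(Finsupp.linearCombination ℂ y).extendOfNorm (Finsupp.linearCombination ℂ x), ?_, ?_⟩
  · intro i
    have := LinearMap.extendOfNorm_eq (f := Finsupp.linearCombination ℂ y) hd ⟨C, h⟩
      (Finsupp.single i 1)
    simpa using this
  · exact LinearMap.norm_extendOfNorm_apply_le hd C h

end General
section Hilbert

variable {X Y Z W : Type*} [NormedAddCommGroup X] [InnerProductSpace ℂ X]
  [NormedAddCommGroup Y] [InnerProductSpace ℂ Y]
  [NormedAddCommGroup Z] [InnerProductSpace ℂ Z]
  [NormedAddCommGroup W] [InnerProductSpace ℂ W]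

theorem inner_linearCombination {I : Type*} (x : I → X) (f : I →₀ ℂ) :
    inner ℂ (Finsupp.linearCombination ℂ x f) (Finsupp.linearCombination ℂ x f) =
      f.sum fun i c => f.sum fun j d => star c * d * inner ℂ (x i) (x j) := by
  simp only [Finsupp.linearCombination_apply, Finsupp.sum, sum_inner, inner_sum, inner_smul_left,
    inner_smul_right]
  rw [Finset.sum_comm]
  refine Finset.sum_congr rfl fun i _ => ?_
  rw [Finset.mul_sum, Finset.sum_congr rfl]
  intro j _
  simp only [RCLike.star_def]
  ring

theorem norm_linearCombination_eq {I : Type*} {x : I → X} {y : I → Y}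
    (h : ∀ i j, inner ℂ (x i) (x j) = inner ℂ (y i) (y j)) (f : I →₀ ℂ) :
    ‖Finsupp.linearCombination ℂ x f‖ = ‖Finsupp.linearCombination ℂ y f‖ := by
  have h1 := inner_linearCombination x f
  have h2 := inner_linearCombination y f
  simp only [h] at h1
  rw [← h2] at h1
  rw [@norm_eq_sqrt_re_inner ℂ, @norm_eq_sqrt_re_inner ℂ _ _ _ _ (Finsupp.linearCombination ℂ y f), h1]

variable [CompleteSpace X] [CompleteSpace Y] [CompleteSpace Z] [CompleteSpace W]

theorem exists_unitary {I : Type*} (x : I → X) (y : I → Y)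
    (hx : cspan (Set.range x) = ⊤) (hy : cspan (Set.range y) = ⊤)
    (h : ∀ i j, inner ℂ (x i) (x j) = inner ℂ (y i) (y j)) :
    ∃ U : X ≃ₗᵢ[ℂ] Y, ∀ i, U (x i) = y i := by
  obtain ⟨T, hT, hTn⟩ := exists_clm_of_bound x y hx 1
    (fun f => by rw [one_mul, norm_linearCombination_eq h])
  obtain ⟨S, hS, hSn⟩ := exists_clm_of_bound y x hy 1
    (fun f => by rw [one_mul, norm_linearCombination_eq h])
  have h1 : S ∘L T = ContinuousLinearMap.id ℂ X := clm_ext_of_total hx fun i => by simp [hT, hS]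
  have h2 : T ∘L S = ContinuousLinearMap.id ℂ Y := clm_ext_of_total hy fun i => by simp [hT, hS]
  have h1' : ∀ v, S (T v) = v := fun v => DFunLike.congr_fun h1 v
  have h2' : ∀ v, T (S v) = v := fun v => DFunLike.congr_fun h2 v
  have hn : ∀ v, ‖T v‖ = ‖v‖ := by
    intro v
    refine le_antisymm (by simpa using hTn v) ?_
    have := hSn (T v)
    rwa [h1' v, one_mul] at this
  exact ⟨{ toLinearEquiv := LinearEquiv.ofLinearMap (T : X →ₗ[ℂ] Y) (S : Y →ₗ[ℂ] X)
            (by ext v; exact h2' v) (by ext v; exact h1' v)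
           norm_map' := hn }, hT⟩

/-- If the operators `k i` and `k' i` satisfy `(k' i)† (k' j) S = S (k i)† (k j)` and the vectors
`k i z` are total, then there is a bounded operator that maps `k i z` to `k' i (S z)`. -/
theorem exists_twist {I : Type*} (k : I → Z →L[ℂ] X) (k' : I → W →L[ℂ] Y) (S : Z →L[ℂ] W)
    (hk : cspan (Set.range fun p : I × Z => k p.1 p.2) = ⊤)
    (h : ∀ i j, adjoint (k' i) ∘L k' j ∘L S = S ∘L adjoint (k i) ∘L k j) :
    ∃ T : X →L[ℂ] Y, (∀ p : I × Z, T (k p.1 p.2) = k' p.1 (S p.2)) ∧ ∀ v, ‖T v‖ ≤ ‖S‖ * ‖v‖ := by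
  refine exists_clm_of_bound (fun p : I × Z => k p.1 p.2) (fun p => k' p.1 (S p.2)) hk ‖S‖ ?_
  intro f
  set A : Z →L[ℂ] Z := adjoint S ∘L S with hA
  have hcomm : ∀ i j, A * (adjoint (k i) ∘L k j) = (adjoint (k i) ∘L k j) * A := by
    intro i j
    have h1 := congrArg adjoint (h j i)
    simp only [ContinuousLinearMap.adjoint_comp, ContinuousLinearMap.adjoint_adjoint] at h1
    calc A * (adjoint (k i) ∘L k j) = adjoint S ∘L (S ∘L adjoint (k i) ∘L k j) := rfl
      _ = ((adjoint S ∘L adjoint (k' i)) ∘L k' j) ∘L S := by rw [← h i j]; rfl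
      _ = _ := by
        rw [h1]; rfl
  set P : Z →L[ℂ] Z := algebraMap ℝ (Z →L[ℂ] Z) (‖S‖ ^ 2) - A with hP
  have hP0 : 0 ≤ P := by
    rw [ContinuousLinearMap.nonneg_iff_isPositive, ContinuousLinearMap.isPositive_iff_complex]
    intro v
    have hv : inner ℂ (P v) v = ((‖S‖ ^ 2 * ‖v‖ ^ 2 - ‖S v‖ ^ 2 : ℝ) : ℂ) := by
      have e1 : inner ℂ (A v) v = ((‖S v‖ ^ 2 : ℝ) : ℂ) := by
        rw [hA, ContinuousLinearMap.comp_apply, ContinuousLinearMap.adjoint_inner_left,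
          inner_self_eq_norm_sq_to_K]
        simp
      have e2 : inner ℂ v v = ((‖v‖ ^ 2 : ℝ) : ℂ) := by
        rw [inner_self_eq_norm_sq_to_K]
        simp
      have e3 : P v = ((‖S‖ ^ 2 : ℝ) : ℂ) • v - A v := by
        rw [hP]
        simp only [Algebra.algebraMap_eq_smul_one, sub_apply,
          smul_apply, one_apply_eq_self]
        rw [Complex.coe_smul]
      rw [e3, inner_sub_left, inner_smul_left, e1, e2]
      simp
    rw [hv]
    refine ⟨by rw [RCLike.re_to_complex, Complex.ofReal_re], ?_⟩
    have h1 := S.le_opNorm v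
    have h2 : ‖S v‖ ^ 2 ≤ (‖S‖ * ‖v‖) ^ 2 := pow_le_pow_left₀ (norm_nonneg _) h1 2
    simp only [RCLike.re_to_complex, Complex.ofReal_re]
    nlinarith
  set D : Z →L[ℂ] Z := CFC.sqrt P with hD
  have hDD : D * D = P := CFC.sqrt_mul_sqrt_self P hP0
  have hDs : adjoint D = D := (IsSelfAdjoint.of_nonneg (CFC.sqrt_nonneg P)).star_eq
  have hPc : ∀ i j, Commute P (adjoint (k i) ∘L k j) := fun i j =>
    Commute.sub_left (Algebra.commutes _ _) (hcomm i j)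
  have hDc : ∀ i j, D * (adjoint (k i) ∘L k j) = (adjoint (k i) ∘L k j) * D := fun i j =>
    ((hPc i j).cfcₙ_nnreal _)
  have e1 := inner_linearCombination (fun p : I × Z => k p.1 p.2) f
  have e2 := inner_linearCombination (fun p : I × Z => k' p.1 (S p.2)) f
  have e3 := inner_linearCombination (fun p : I × Z => k p.1 (D p.2)) f
  have key : ∀ p q : I × Z, inner ℂ (k p.1 (D p.2)) (k q.1 (D q.2)) =
      (‖S‖ ^ 2 : ℝ) * inner ℂ (k p.1 p.2) (k q.1 q.2) -
        inner ℂ (k' p.1 (S p.2)) (k' q.1 (S q.2)) := by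
    intro p q
    have a1 : inner ℂ (k p.1 (D p.2)) (k q.1 (D q.2)) =
        inner ℂ p.2 ((P * (adjoint (k p.1) ∘L k q.1)) q.2) := by
      rw [← hDD, mul_assoc, hDc]
      have : inner ℂ (k p.1 (D p.2)) (k q.1 (D q.2)) =
          inner ℂ p.2 ((adjoint D * (adjoint (k p.1) ∘L k q.1) * D) q.2) := by
        simp [ContinuousLinearMap.adjoint_inner_right]
      rw [this, hDs, mul_assoc]
    have a2 : inner ℂ (k' p.1 (S p.2)) (k' q.1 (S q.2)) =
        inner ℂ p.2 ((A * (adjoint (k p.1) ∘L k q.1)) q.2) := by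
      have : A * (adjoint (k p.1) ∘L k q.1) = adjoint S ∘L (adjoint (k' p.1) ∘L k' q.1 ∘L S) := by
        rw [h]; rfl
      rw [this]
      simp [ContinuousLinearMap.adjoint_inner_right]
    rw [a1, a2, hP, sub_mul]
    simp [ContinuousLinearMap.adjoint_inner_right,
      Algebra.algebraMap_eq_smul_one]
  have e4 : inner ℂ (Finsupp.linearCombination ℂ (fun p : I × Z => k p.1 (D p.2)) f)
      (Finsupp.linearCombination ℂ (fun p : I × Z => k p.1 (D p.2)) f) =
      (‖S‖ ^ 2 : ℝ) * inner ℂ (Finsupp.linearCombination ℂ (fun p : I × Z => k p.1 p.2) f)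
      (Finsupp.linearCombination ℂ (fun p : I × Z => k p.1 p.2) f) -
      inner ℂ (Finsupp.linearCombination ℂ (fun p : I × Z => k' p.1 (S p.2)) f)
      (Finsupp.linearCombination ℂ (fun p : I × Z => k' p.1 (S p.2)) f) := by
    rw [e1, e2, e3]
    simp only [key, Finsupp.sum, Finset.mul_sum, ← Finset.sum_sub_distrib]
    refine Finset.sum_congr rfl fun i _ => Finset.sum_congr rfl fun j _ => ?_
    ring
  simp only [inner_self_eq_norm_sq_to_K] at e4
  have e5 : ‖Finsupp.linearCombination ℂ (fun p : I × Z => k p.1 (D p.2)) f‖ ^ 2 =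
      ‖S‖ ^ 2 * ‖Finsupp.linearCombination ℂ (fun p : I × Z => k p.1 p.2) f‖ ^ 2 -
      ‖Finsupp.linearCombination ℂ (fun p : I × Z => k' p.1 (S p.2)) f‖ ^ 2 := by
    apply Complex.ofReal_injective
    simpa using e4
  refine (sq_le_sq₀ (norm_nonneg _) (by positivity)).1 ?_
  rw [mul_pow]
  nlinarith [sq_nonneg ‖Finsupp.linearCombination ℂ (fun p : I × Z => k p.1 (D p.2)) f‖]

/-- Positivity of the kernel that defines the relative tensor product. -/
theorem gram_nonneg {I : Type*} [Fintype I] (ξ : I → Z →L[ℂ] X) (η : I → Z →L[ℂ] Y) (ζ : I → Z)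
    (hc : ∀ i j k l, Commute (adjoint (ξ i) ∘L ξ j) (adjoint (η k) ∘L η l)) :
    0 ≤ RCLike.re (∑ i, ∑ j, inner ℂ (ζ i)
      ((adjoint (ξ i) ∘L ξ j ∘L adjoint (η i) ∘L η j) (ζ j))) := by
  classical
  let E := PiLp 2 (fun _ : I => Z)
  let pr : I → E →L[ℂ] Z := fun i => PiLp.proj 2 (fun _ : I => Z) i
  let inj : I → Z →L[ℂ] E := fun i => adjoint (pr i)
  have inj_apply : ∀ j w, inj j w = WithLp.toLp 2 (Pi.single j w) := by
    intro j w
    refine ext_inner_right ℂ fun e => ?_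
    rw [ContinuousLinearMap.adjoint_inner_left, PiLp.inner_apply, Finset.sum_eq_single j]
    · simp only [Pi.single_eq_same]
      rfl
    · intro b _ hb
      simp [Pi.single_eq_of_ne hb]
    · simp
  have prinj : ∀ i j w, pr i (inj j w) = if i = j then w else 0 := by
    intro i j w
    rw [inj_apply]
    change (Pi.single j w : I → Z) i = _
    by_cases h : i = j
    · subst h; simp
    · simp [h]
  have hsum : ∀ e : E, ∑ k, inj k (pr k e) = e := by
    intro e
    ext i
    have : (∑ k, inj k (pr k e)) i = pr i (∑ k, inj k (pr k e)) := rfl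
    rw [this, map_sum]
    simp [prinj]
    rfl
  have adjinj : ∀ i, adjoint (inj i) = pr i := fun i => ContinuousLinearMap.adjoint_adjoint _
  have hext : ∀ A B : E →L[ℂ] E, (∀ k l w, pr k (A (inj l w)) = pr k (B (inj l w))) → A = B := by
    intro A B h
    ext1 e
    rw [← hsum (A e), ← hsum (B e)]
    refine Finset.sum_congr rfl fun k _ => ?_
    congr 1
    rw [← hsum e, map_sum, map_sum, map_sum, map_sum]
    exact Finset.sum_congr rfl fun l _ => h k l _
  let T : E →L[ℂ] Y := ∑ k, η k ∘L pr k
  have Tinj : ∀ j w, T (inj j w) = η j w := by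
    intro j w
    simp only [T, ContinuousLinearMap.sum_apply, ContinuousLinearMap.comp_apply, prinj]
    rw [Finset.sum_eq_single j] <;> simp +contextual
  let M : E →L[ℂ] E := adjoint T ∘L T
  have hM0 : 0 ≤ M := by
    rw [ContinuousLinearMap.nonneg_iff_isPositive]
    exact ContinuousLinearMap.isPositive_adjoint_comp_self T
  have hTadj : ∀ i y, pr i (adjoint T y) = adjoint (η i) y := by
    intro i y
    refine ext_inner_left ℂ fun z => ?_
    rw [ContinuousLinearMap.adjoint_inner_right, ← Tinj, ← ContinuousLinearMap.adjoint_inner_right,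
      ← ContinuousLinearMap.adjoint_inner_left]
  have hMe : ∀ i j w, pr i (M (inj j w)) = adjoint (η i) (η j w) := by
    intro i j w
    simp only [M, ContinuousLinearMap.comp_apply, hTadj, Tinj]
  let C : E →L[ℂ] E := CFC.sqrt M
  have hCC : C * C = M := CFC.sqrt_mul_sqrt_self M hM0
  have hCs : adjoint C = C := (IsSelfAdjoint.of_nonneg (CFC.sqrt_nonneg M)).star_eq
  let dg : (Z →L[ℂ] Z) → E →L[ℂ] E := fun b => ∑ k, inj k ∘L b ∘L pr k
  have dginj : ∀ b j w, dg b (inj j w) = inj j (b w) := by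
    intro b j w
    simp only [dg, ContinuousLinearMap.sum_apply, ContinuousLinearMap.comp_apply, prinj]
    rw [Finset.sum_eq_single j] <;> simp +contextual
  have prdg : ∀ b j e, pr j (dg b e) = b (pr j e) := by
    intro b j e
    simp only [dg, ContinuousLinearMap.sum_apply, ContinuousLinearMap.comp_apply, map_sum, prinj]
    simp
  have hCd : ∀ i j, Commute (dg (adjoint (ξ i) ∘L ξ j)) C := by
    intro i j
    have : Commute M (dg (adjoint (ξ i) ∘L ξ j)) := by
      refine hext _ _ fun k l w => ?_
      have h1 : adjoint (ξ i) (ξ j (adjoint (η k) (η l w))) =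
          adjoint (η k) (η l (adjoint (ξ i) (ξ j w))) := DFunLike.congr_fun (hc i j k l).eq w
      change pr k (M (dg _ (inj l w))) = pr k (dg _ (M (inj l w)))
      rw [dginj, prdg, hMe, hMe]
      exact h1.symm
    exact (this.cfcₙ_nnreal _).symm
  let c : I → I → Z →L[ℂ] Z := fun k i => pr k ∘L C ∘L inj i
  have hcc : ∀ i j k l w, (adjoint (ξ i) (ξ j (c k l w))) = c k l (adjoint (ξ i) (ξ j w)) := by
    intro i j k l w
    have := DFunLike.congr_fun (hCd i j).eq (inj l w)
    have := congrArg (pr k) this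
    simpa [prdg, dginj, c] using this
  have hη : ∀ i j w, adjoint (η i) (η j w) = ∑ k, adjoint (c k i) (c k j w) := by
    intro i j w
    rw [← hMe, ← hCC]
    change pr i (C (C (inj j w))) = _
    have h1 : ∀ k y, adjoint (c k i) y = pr i (C (inj k y)) := by
      intro k y
      simp only [c, ContinuousLinearMap.adjoint_comp, adjinj, hCs]
      rfl
    simp only [h1]
    simp only [c, ContinuousLinearMap.comp_apply]
    rw [← map_sum, ← map_sum, hsum]
  have hterm : ∀ i j, inner ℂ (ζ i) ((adjoint (ξ i) ∘L ξ j ∘L adjoint (η i) ∘L η j) (ζ j)) =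
      ∑ k, inner ℂ (ξ i (c k i (ζ i))) (ξ j (c k j (ζ j))) := by
    intro i j
    simp only [ContinuousLinearMap.comp_apply, hη, map_sum, inner_sum]
    refine Finset.sum_congr rfl fun k _ => ?_
    rw [← ContinuousLinearMap.adjoint_inner_right (ξ i), ContinuousLinearMap.adjoint_inner_right (ξ i),
      ContinuousLinearMap.adjoint_inner_right (ξ i), ← ContinuousLinearMap.adjoint_inner_left (ξ j),
      ← ContinuousLinearMap.adjoint_inner_left (ξ j), ContinuousLinearMap.adjoint_inner_right (c k i),
      ← hcc, ContinuousLinearMap.adjoint_inner_left (ξ j)]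
  simp only [hterm]
  have : ∑ i, ∑ j, ∑ k, inner ℂ (ξ i (c k i (ζ i))) (ξ j (c k j (ζ j))) =
      ∑ k, inner ℂ (∑ i, ξ i (c k i (ζ i))) (∑ j, ξ j (c k j (ζ j))) := by
    simp only [sum_inner, inner_sum]
    rw [Finset.sum_comm]
    rw [Finset.sum_congr rfl fun j _ => Finset.sum_comm, Finset.sum_comm]
  rw [this, map_sum]
  exact Finset.sum_nonneg fun k _ => inner_self_nonneg

end Hilbert

section Modules

variable {𝔎 H K L M : Type*}
  [NormedAddCommGroup 𝔎] [InnerProductSpace ℂ 𝔎] [CompleteSpace 𝔎]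
  [NormedAddCommGroup H] [InnerProductSpace ℂ H] [CompleteSpace H]
  [NormedAddCommGroup K] [InnerProductSpace ℂ K] [CompleteSpace K]
  [NormedAddCommGroup L] [InnerProductSpace ℂ L] [CompleteSpace L]
  [NormedAddCommGroup M] [InnerProductSpace ℂ M] [CompleteSpace M]

/-- A `C*`-base `(𝔎, 𝔅, 𝔅†)`: two commuting nondegenerate `C*`-algebras of operators on a Hilbert
space `𝔎`. -/
structure CBase (𝔎 : Type*) [NormedAddCommGroup 𝔎] [InnerProductSpace ℂ 𝔎] [CompleteSpace 𝔎] where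
  B : NonUnitalStarSubalgebra ℂ (𝔎 →L[ℂ] 𝔎)
  Bd : NonUnitalStarSubalgebra ℂ (𝔎 →L[ℂ] 𝔎)
  isClosed_B : IsClosed (B : Set (𝔎 →L[ℂ] 𝔎))
  isClosed_Bd : IsClosed (Bd : Set (𝔎 →L[ℂ] 𝔎))
  nondeg_B : cspan {v : 𝔎 | ∃ b ∈ B, ∃ ζ, b ζ = v} = ⊤
  nondeg_Bd : cspan {v : 𝔎 | ∃ b ∈ Bd, ∃ ζ, b ζ = v} = ⊤
  comm : ∀ b ∈ B, ∀ c ∈ Bd, b * c = c * b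

/-- The opposite `C*`-base `𝔟† = (𝔎, 𝔅†, 𝔅)`. -/
abbrev CBase.op (b : CBase 𝔎) : CBase 𝔎 where
  B := b.Bd
  Bd := b.B
  isClosed_B := b.isClosed_Bd
  isClosed_Bd := b.isClosed_B
  nondeg_B := b.nondeg_Bd
  nondeg_Bd := b.nondeg_B
  comm c hc d hd := (b.comm d hd c hc).symm

/-- The closed linear span `[α* α]`. -/
def gramSpan (α : Submodule ℂ (𝔎 →L[ℂ] H)) : Submodule ℂ (𝔎 →L[ℂ] 𝔎) :=
  cspan {T : 𝔎 →L[ℂ] 𝔎 | ∃ ξ ∈ α, ∃ ξ' ∈ α, adjoint ξ ∘L ξ' = T}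

/-- A `C*`-module `(H, α)` over a `C*`-base with first algebra `B`: a closed subspace
`α ⊆ L(𝔎, H)` with `[α 𝔎] = H`, `[α B] = α` and `[α* α] = B`. A `C*`-`𝔟`-module is a
`CModule b.B H`, a `C*`-`𝔟†`-module is a `CModule b.Bd H`. -/
structure CModule (B : NonUnitalStarSubalgebra ℂ (𝔎 →L[ℂ] 𝔎)) (H : Type*)
    [NormedAddCommGroup H] [InnerProductSpace ℂ H] [CompleteSpace H] where
  carrier : Submodule ℂ (𝔎 →L[ℂ] H)
  isClosed_carrier : IsClosed (carrier : Set (𝔎 →L[ℂ] H))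
  total : cspan {v : H | ∃ ξ ∈ carrier, ∃ ζ, ξ ζ = v} = ⊤
  mul_base : cspan {T : 𝔎 →L[ℂ] H | ∃ ξ ∈ carrier, ∃ b ∈ B, ξ ∘L b = T} = carrier
  gram : (gramSpan carrier : Set (𝔎 →L[ℂ] 𝔎)) = B

namespace CModule
variable {B : NonUnitalStarSubalgebra ℂ (𝔎 →L[ℂ] 𝔎)}

theorem gram_mem (α : CModule B H) {ξ ξ' : 𝔎 →L[ℂ] H} (hξ : ξ ∈ α.carrier)
    (hξ' : ξ' ∈ α.carrier) : adjoint ξ ∘L ξ' ∈ B := by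
  have : adjoint ξ ∘L ξ' ∈ (B : Set (𝔎 →L[ℂ] 𝔎)) := by
    rw [← α.gram]
    exact subset_cspan ⟨ξ, hξ, ξ', hξ', rfl⟩
  exact this

theorem comp_mem (α : CModule B H) {ξ : 𝔎 →L[ℂ] H} (hξ : ξ ∈ α.carrier)
    {b : 𝔎 →L[ℂ] 𝔎} (hb : b ∈ B) : ξ ∘L b ∈ α.carrier := by
  rw [← α.mul_base]
  exact subset_cspan ⟨ξ, hξ, b, hb, rfl⟩

theorem total_range (α : CModule B H) :
    cspan (Set.range fun p : α.carrier × 𝔎 => p.1.1 p.2) = ⊤ := by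
  rw [← α.total]
  congr 1
  ext v
  constructor
  · rintro ⟨⟨ξ, ζ⟩, rfl⟩
    exact ⟨ξ.1, ξ.2, ζ, rfl⟩
  · rintro ⟨ξ, hξ, ζ, rfl⟩
    exact ⟨(⟨ξ, hξ⟩, ζ), rfl⟩

theorem ext_comp (α : CModule B H) {S T : H →L[ℂ] K} (h : ∀ ξ ∈ α.carrier, S ∘L ξ = T ∘L ξ) :
    S = T :=
  clm_ext_of_total α.total_range fun p => DFunLike.congr_fun (h p.1.1 p.1.2) p.2

/-- The operator `ρ_α(c)` on `H`, given by `ρ_α(c) ξ ζ = ξ c ζ` for `ξ ∈ α`, `ζ ∈ 𝔎`. It exists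
for all `c ∈ L(𝔎)` that commute with `B`, in particular for `c ∈ 𝔅†` if `B = 𝔅`. -/
def rho (α : CModule B H) (c : 𝔎 →L[ℂ] 𝔎) : H →L[ℂ] H :=
  clmOf (fun p : α.carrier × 𝔎 => p.1.1 p.2) (fun p => p.1.1 (c p.2))

theorem exists_rho (α : CModule B H) {c : 𝔎 →L[ℂ] 𝔎} (hc : ∀ b ∈ B, b * c = c * b) :
    ∃ T : H →L[ℂ] H, (∀ p : α.carrier × 𝔎, T (p.1.1 p.2) = p.1.1 (c p.2)) ∧
      ∀ v, ‖T v‖ ≤ ‖c‖ * ‖v‖ := by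
  refine exists_twist (fun ξ : α.carrier => ξ.1) (fun ξ : α.carrier => ξ.1) c α.total_range ?_
  intro i j
  exact hc _ (α.gram_mem i.2 j.2)

theorem rho_comp (α : CModule B H) {c : 𝔎 →L[ℂ] 𝔎} (hc : ∀ b ∈ B, b * c = c * b)
    {ξ : 𝔎 →L[ℂ] H} (hξ : ξ ∈ α.carrier) : α.rho c ∘L ξ = ξ ∘L c := by
  obtain ⟨T, hT, -⟩ := α.exists_rho hc
  ext ζ
  exact clmOf_spec ⟨T, hT⟩ (⟨ξ, hξ⟩, ζ)

theorem rho_apply (α : CModule B H) {c : 𝔎 →L[ℂ] 𝔎} (hc : ∀ b ∈ B, b * c = c * b)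
    {ξ : 𝔎 →L[ℂ] H} (hξ : ξ ∈ α.carrier) (ζ : 𝔎) : α.rho c (ξ ζ) = ξ (c ζ) :=
  DFunLike.congr_fun (α.rho_comp hc hξ) ζ

theorem norm_rho_le (α : CModule B H) {c : 𝔎 →L[ℂ] 𝔎} (hc : ∀ b ∈ B, b * c = c * b) :
    ‖α.rho c‖ ≤ ‖c‖ := by
  obtain ⟨T, hT, hn⟩ := α.exists_rho hc
  have : α.rho c = T := clm_ext_of_total α.total_range fun p => by
    rw [hT]; exact clmOf_spec ⟨T, hT⟩ p
  rw [this]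
  exact ContinuousLinearMap.opNorm_le_bound _ (norm_nonneg _) hn

theorem commute_sub {c d : 𝔎 →L[ℂ] 𝔎} (hc : ∀ b ∈ B, b * c = c * b)
    (hd : ∀ b ∈ B, b * d = d * b) : ∀ b ∈ B, b * (c - d) = (c - d) * b := fun b hb => by
  rw [mul_sub, sub_mul, hc b hb, hd b hb]

theorem rho_sub (α : CModule B H) {c d : 𝔎 →L[ℂ] 𝔎} (hc : ∀ b ∈ B, b * c = c * b)
    (hd : ∀ b ∈ B, b * d = d * b) : α.rho (c - d) = α.rho c - α.rho d := by
  refine α.ext_comp fun ξ hξ => ?_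
  rw [ContinuousLinearMap.sub_comp, α.rho_comp hc hξ, α.rho_comp hd hξ,
    α.rho_comp (commute_sub hc hd) hξ, ContinuousLinearMap.comp_sub]

theorem commute_mul {c d : 𝔎 →L[ℂ] 𝔎} (hc : ∀ b ∈ B, b * c = c * b)
    (hd : ∀ b ∈ B, b * d = d * b) : ∀ b ∈ B, b * (c * d) = (c * d) * b := fun b hb => by
  rw [← mul_assoc, hc b hb, mul_assoc, hd b hb, mul_assoc]

theorem rho_mul (α : CModule B H) {c d : 𝔎 →L[ℂ] 𝔎} (hc : ∀ b ∈ B, b * c = c * b)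
    (hd : ∀ b ∈ B, b * d = d * b) : α.rho c ∘L α.rho d = α.rho (c * d) := by
  refine α.ext_comp fun ξ hξ => ?_
  rw [ContinuousLinearMap.comp_assoc, α.rho_comp hd hξ, ← ContinuousLinearMap.comp_assoc,
    α.rho_comp hc hξ, α.rho_comp (commute_mul hc hd) hξ]
  rfl

/-- `ρ_α` maps closed linear spans into closed linear spans. -/
theorem rho_comp_mem (α : CModule B H) {S : Set (𝔎 →L[ℂ] 𝔎)}
    (hS : ∀ c ∈ cspan S, ∀ b ∈ B, b * c = c * b) {Z : Type*} [NormedAddCommGroup Z]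
    [InnerProductSpace ℂ Z] (d : Z →L[ℂ] H)
    {W : Submodule ℂ (Z →L[ℂ] H)} (hW : IsClosed (W : Set (Z →L[ℂ] H)))
    (h : ∀ c ∈ S, α.rho c ∘L d ∈ W) {c : 𝔎 →L[ℂ] 𝔎} (hc : c ∈ cspan S) : α.rho c ∘L d ∈ W := by
  have hadd : ∀ c ∈ cspan S, ∀ c' ∈ cspan S, α.rho (c + c') = α.rho c + α.rho c' := by
    intro c hc c' hc'
    refine α.ext_comp fun ξ hξ => ?_
    rw [α.rho_comp (hS _ (add_mem hc hc')) hξ, ContinuousLinearMap.add_comp,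
      α.rho_comp (hS _ hc) hξ, α.rho_comp (hS _ hc') hξ, ContinuousLinearMap.comp_add]
  have hsmul : ∀ (a : ℂ), ∀ c ∈ cspan S, α.rho (a • c) = a • α.rho c := by
    intro a c hc
    refine α.ext_comp fun ξ hξ => ?_
    rw [α.rho_comp (hS _ (Submodule.smul_mem _ a hc)) hξ, ContinuousLinearMap.smul_comp,
      α.rho_comp (hS _ hc) hξ, ContinuousLinearMap.comp_smul]
  let R : cspan S →L[ℂ] (H →L[ℂ] H) := LinearMap.mkContinuous
    { toFun := fun c => α.rho c.1
      map_add' := fun c c' => hadd _ c.2 _ c'.2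
      map_smul' := fun a c => hsmul a _ c.2 } 1
    (fun c => by rw [one_mul]; exact α.norm_rho_le (hS _ c.2))
  let P : cspan S →L[ℂ] (Z →L[ℂ] H) := (ContinuousLinearMap.precomp H d) ∘L R
  have hP : ∀ c, P c = α.rho c.1 ∘L d := fun c => rfl
  let Q : Submodule ℂ (𝔎 →L[ℂ] 𝔎) := (W.comap (P : cspan S →ₗ[ℂ] (Z →L[ℂ] H))).map (cspan S).subtype
  have hQ : IsClosed (Q : Set (𝔎 →L[ℂ] 𝔎)) := by
    have h1 : IsClosed ((W.comap (P : cspan S →ₗ[ℂ] (Z →L[ℂ] H)) : Submodule ℂ (cspan S)) :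
      Set (cspan S)) := hW.preimage P.continuous
    have h2 := (isClosed_cspan S).isClosedEmbedding_subtypeVal.isClosedMap _ h1
    exact h2
  have : cspan S ≤ Q := by
    refine cspan_le hQ fun s hs => ?_
    exact ⟨⟨s, subset_cspan hs⟩, h s hs, rfl⟩
  obtain ⟨c', hc', rfl⟩ := this hc
  exact hc'

theorem cspan_gram_eq (α : CModule B H) {c : 𝔎 →L[ℂ] 𝔎} :
    c ∈ gramSpan α.carrier ↔ c ∈ B := by
  change c ∈ (_ : Set _) ↔ c ∈ (B : Set _)
  rw [← α.gram]

/-- A family `κ` of operators `K → R` such that the closed span of `κ* κ δ` is `δ` and such that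
the ranges span `R` transports a `C*`-module structure `δ` on `K` to `[κ δ]` on `R`. -/
def ofKets {R : Type*} [NormedAddCommGroup R] [InnerProductSpace ℂ R] [CompleteSpace R]
    (δ : CModule B K) (κ : Set (K →L[ℂ] R))
    (htot : cspan {v : R | ∃ k ∈ κ, ∃ x, k x = v} = ⊤)
    (hκ : cspan {T : 𝔎 →L[ℂ] K | ∃ k ∈ κ, ∃ k' ∈ κ, ∃ d ∈ δ.carrier, adjoint k ∘L k' ∘L d = T} =
      δ.carrier) : CModule B R where
  carrier := cspan {T : 𝔎 →L[ℂ] R | ∃ k ∈ κ, ∃ d ∈ δ.carrier, k ∘L d = T}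
  isClosed_carrier := isClosed_cspan _
  total := by
    rw [eq_top_iff, ← htot]
    refine cspan_le (isClosed_cspan _) ?_
    rintro _ ⟨k, hk, x, rfl⟩
    have hx : x ∈ cspan {v : K | ∃ ξ ∈ δ.carrier, ∃ ζ, ξ ζ = v} := by rw [δ.total]; trivial
    refine map_mem_of_mem_cspan (isClosed_cspan _) k ?_ hx
    rintro _ ⟨d, hd, ζ, rfl⟩
    exact subset_cspan ⟨k ∘L d, subset_cspan ⟨k, hk, d, hd, rfl⟩, ζ, rfl⟩
  mul_base := by
    apply le_antisymm
    · refine cspan_le (isClosed_cspan _) ?_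
      rintro _ ⟨ξ, hξ, b, hb, rfl⟩
      refine comp_right_mem (isClosed_cspan _) b ?_ hξ
      rintro _ ⟨k, hk, d, hd, rfl⟩
      exact subset_cspan ⟨k, hk, d ∘L b, δ.comp_mem hd hb, rfl⟩
    · refine cspan_le (isClosed_cspan _) ?_
      rintro _ ⟨k, hk, d, hd, rfl⟩
      rw [← δ.mul_base] at hd
      refine comp_left_mem (isClosed_cspan _) k ?_ hd
      rintro _ ⟨d', hd', b, hb, rfl⟩
      exact subset_cspan ⟨k ∘L d', subset_cspan ⟨k, hk, d', hd', rfl⟩, b, hb, rfl⟩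
  gram := by
    have hkk : ∀ k ∈ κ, ∀ k' ∈ κ, ∀ d ∈ δ.carrier, adjoint k ∘L k' ∘L d ∈ δ.carrier := by
      intro k hk k' hk' d hd
      rw [← hκ]
      exact subset_cspan ⟨k, hk, k', hk', d, hd, rfl⟩
    rw [← δ.gram]
    refine congrArg _ (le_antisymm (cspan_le (isClosed_cspan _) ?_)
      (cspan_le (isClosed_cspan _) ?_))
    · rintro _ ⟨ξ, hξ, ξ', hξ', rfl⟩
      have h2 : ∀ k' ∈ κ, ∀ d' ∈ δ.carrier, adjoint ξ ∘L (k' ∘L d') ∈ gramSpan δ.carrier := by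
        intro k' hk' d' hd'
        rw [δ.cspan_gram_eq, ← star_mem_iff]
        change adjoint (adjoint ξ ∘L (k' ∘L d')) ∈ B
        rw [← δ.cspan_gram_eq, ContinuousLinearMap.adjoint_comp,
          ContinuousLinearMap.adjoint_adjoint]
        refine comp_left_mem (W := gramSpan δ.carrier) (isClosed_cspan _) (adjoint (k' ∘L d')) ?_ hξ
        rintro _ ⟨k, hk, d, hd, rfl⟩
        refine subset_cspan ⟨d', hd', _, hkk k' hk' k hk d hd, ?_⟩
        rw [ContinuousLinearMap.adjoint_comp]
        rfl
      refine comp_left_mem (W := gramSpan δ.carrier) (isClosed_cspan _) (adjoint ξ) ?_ hξ'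
      rintro _ ⟨k', hk', d', hd', rfl⟩
      exact h2 k' hk' d' hd'
    · rintro _ ⟨ξ, hξ, ξ', hξ', rfl⟩
      rw [← hκ] at hξ'
      refine comp_left_mem (isClosed_cspan _) (adjoint ξ) ?_ hξ'
      rintro _ ⟨k, hk, k', hk', d, hd, rfl⟩
      refine subset_cspan ⟨k ∘L ξ, subset_cspan ⟨k, hk, ξ, hξ, rfl⟩, k' ∘L d,
        subset_cspan ⟨k', hk', d, hd, rfl⟩, ?_⟩
      rw [ContinuousLinearMap.adjoint_comp]
      rfl

end CModule

end Modules

section Tensor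

variable {𝔎 H K L M : Type*}
  [NormedAddCommGroup 𝔎] [InnerProductSpace ℂ 𝔎] [CompleteSpace 𝔎]
  [NormedAddCommGroup H] [InnerProductSpace ℂ H] [CompleteSpace H]
  [NormedAddCommGroup K] [InnerProductSpace ℂ K] [CompleteSpace K]
  [NormedAddCommGroup L] [InnerProductSpace ℂ L] [CompleteSpace L]
  [NormedAddCommGroup M] [InnerProductSpace ℂ M] [CompleteSpace M]

theorem mem_cspan_mul (B : NonUnitalStarSubalgebra ℂ (𝔎 →L[ℂ] 𝔎))
    (hB : IsClosed (B : Set (𝔎 →L[ℂ] 𝔎))) {a : 𝔎 →L[ℂ] 𝔎} (ha : a ∈ B) :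
    a ∈ cspan {T : 𝔎 →L[ℂ] 𝔎 | ∃ x ∈ B, ∃ y ∈ B, x ∘L y = T} := by
  have : IsClosed (B : Set (𝔎 →L[ℂ] 𝔎)) := hB
  let : NonUnitalCStarAlgebra B := NonUnitalStarSubalgebra.nonUnitalCStarAlgebra B
  let : PartialOrder B := CStarAlgebra.spectralOrder B
  have : StarOrderedRing B := CStarAlgebra.spectralOrderedRing B
  have h := (CStarAlgebra.increasingApproximateUnit B).toIsApproximateUnit
  have := h.neBot
  have h1 := h.tendsto_mul_left ⟨a, ha⟩
  have h2 := (continuous_subtype_val.tendsto _).comp h1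
  refine IsClosed.mem_of_tendsto (isClosed_cspan _) h2 (Filter.Eventually.of_forall fun e => ?_)
  exact subset_cspan ⟨_, ha, e.1, e.2, rfl⟩

/-- The algebra `B`, regarded as a `C*`-module structure on `𝔎`. -/
def baseOf (B : NonUnitalStarSubalgebra ℂ (𝔎 →L[ℂ] 𝔎)) (hB : IsClosed (B : Set (𝔎 →L[ℂ] 𝔎)))
    (hn : cspan {v : 𝔎 | ∃ b ∈ B, ∃ ζ, b ζ = v} = ⊤) : CModule B 𝔎 where
  carrier := B.toNonUnitalSubalgebra.toSubmodule
  isClosed_carrier := hB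
  total := hn
  mul_base := by
    refine le_antisymm (cspan_le hB ?_) fun a ha => mem_cspan_mul B hB ha
    rintro _ ⟨x, hx, y, hy, rfl⟩
    exact B.mul_mem hx hy
  gram := by
    refine Set.Subset.antisymm ?_ ?_
    · have : gramSpan B.toNonUnitalSubalgebra.toSubmodule ≤ B.toNonUnitalSubalgebra.toSubmodule := by
        refine cspan_le hB ?_
        rintro _ ⟨x, hx, y, hy, rfl⟩
        exact B.mul_mem (star_mem (s := B) hx) hy
      exact this
    · intro a ha
      have : cspan {T : 𝔎 →L[ℂ] 𝔎 | ∃ x ∈ B, ∃ y ∈ B, x ∘L y = T} ≤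
          gramSpan B.toNonUnitalSubalgebra.toSubmodule := by
        refine cspan_le (isClosed_cspan _) ?_
        rintro _ ⟨x, hx, y, hy, rfl⟩
        exact subset_cspan ⟨adjoint x, star_mem (s := B) hx, y, hy, by
          rw [ContinuousLinearMap.adjoint_adjoint]⟩
      exact this (mem_cspan_mul B hB ha)

/-- The `C*`-`𝔟`-module `(𝔎, 𝔅)`. The `C*`-`𝔟†`-module `(𝔎, 𝔅†)` is `b.op.base`. -/
def CBase.base (b : CBase 𝔎) : CModule b.B 𝔎 := baseOf b.B b.isClosed_B b.nondeg_B

/-- The operator-valued kernel `((ξ, η), (ξ', η')) ↦ ξ* ξ' η* η'`. -/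
def rtpKernel (b : CBase 𝔎) (α : CModule b.B H) (γ : CModule b.Bd K) :
    Matrix (α.carrier × γ.carrier) (α.carrier × γ.carrier) (𝔎 →L[ℂ] 𝔎) :=
  .of fun p q => adjoint p.1.1 ∘L q.1.1 ∘L adjoint p.2.1 ∘L q.2.1

theorem rtpKernel_comm (b : CBase 𝔎) (α : CModule b.B H) (γ : CModule b.Bd K)
    (ξ ξ' : α.carrier) (η η' : γ.carrier) :
    Commute (adjoint ξ.1 ∘L ξ'.1) (adjoint η.1 ∘L η'.1) :=
  b.comm _ (α.gram_mem ξ.2 ξ'.2) _ (γ.gram_mem η.2 η'.2)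

theorem rtpKernel_posSemidef (b : CBase 𝔎) (α : CModule b.B H) (γ : CModule b.Bd K) :
    (rtpKernel b α γ).PosSemidef := by
  have hH : (rtpKernel b α γ).IsHermitian := by
    ext1 p q
    have h := (rtpKernel_comm b α γ p.1 q.1 p.2 q.2).eq
    change adjoint (adjoint q.1.1 ∘L p.1.1 ∘L adjoint q.2.1 ∘L p.2.1) =
      (adjoint p.1.1 ∘L q.1.1) * (adjoint p.2.1 ∘L q.2.1)
    rw [h]
    simp only [ContinuousLinearMap.adjoint_comp, ContinuousLinearMap.adjoint_adjoint]
    rfl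
  refine ((RKHS.posSemidef_tfae (K := rtpKernel b α γ)).out 0 2).mpr (And.intro hH fun vv => ?_)
  have h := gram_nonneg (fun i : vv.support => i.1.1.1) (fun i : vv.support => i.1.2.1)
    (fun i : vv.support => vv i.1)
    (fun i j k l => rtpKernel_comm b α γ i.1.1 j.1.1 k.1.2 l.1.2)
  have e : (vv.sum fun x w => vv.sum fun x' w' => ⟪rtpKernel b α γ x' x w, w'⟫_ℂ) =
      (starRingEnd ℂ) (∑ i : vv.support, ∑ j : vv.support, ⟪vv i.1,
        (adjoint i.1.1.1 ∘L j.1.1.1 ∘L adjoint i.1.2.1 ∘L j.1.2.1) (vv j.1)⟫_ℂ) := by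
    rw [Finset.sum_comm]
    simp only [map_sum, inner_conj_symm, Finsupp.sum]
    rw [← Finset.sum_coe_sort vv.support]
    refine Finset.sum_congr rfl fun i _ => ?_
    rw [← Finset.sum_coe_sort vv.support]
    rfl
  rw [e, RCLike.conj_re]
  exact h

instance rtpFact (b : CBase 𝔎) (α : CModule b.B H) (γ : CModule b.Bd K) :
    Fact (rtpKernel b α γ).PosSemidef := ⟨rtpKernel_posSemidef b α γ⟩

/-- The relative tensor product `H ⊗ K` of a `C*`-`𝔟`-module `(H, α)` and a `C*`-`𝔟†`-module
`(K, γ)`: the Hilbert space generated by elements `ξ ⊗ ζ ⊗ η` with `ξ ∈ α`, `ζ ∈ 𝔎`, `η ∈ γ` and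
the inner product `⟪ξ ⊗ ζ ⊗ η, ξ' ⊗ ζ' ⊗ η'⟫ = ⟪ζ, ξ* ξ' η* η' ζ'⟫`. -/
def RTP (b : CBase 𝔎) (α : CModule b.B H) (γ : CModule b.Bd K) : Type _ :=
  RKHS.OfKernel (rtpKernel b α γ)

instance (b : CBase 𝔎) (α : CModule b.B H) (γ : CModule b.Bd K) :
    NormedAddCommGroup (RTP b α γ) :=
  inferInstanceAs (NormedAddCommGroup (RKHS.OfKernel (rtpKernel b α γ)))

instance (b : CBase 𝔎) (α : CModule b.B H) (γ : CModule b.Bd K) :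
    InnerProductSpace ℂ (RTP b α γ) :=
  inferInstanceAs (InnerProductSpace ℂ (RKHS.OfKernel (rtpKernel b α γ)))

instance (b : CBase 𝔎) (α : CModule b.B H) (γ : CModule b.Bd K) :
    CompleteSpace (RTP b α γ) :=
  inferInstanceAs (CompleteSpace (RKHS.OfKernel (rtpKernel b α γ)))

section
variable (b : CBase 𝔎) (α : CModule b.B H) (γ : CModule b.Bd K)

/-- The map `ζ ↦ ξ ⊗ ζ ⊗ η`. -/
def elem (ξ : α.carrier) (η : γ.carrier) : 𝔎 →L[ℂ] RTP b α γ :=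
  RKHS.kerFun (RKHS.OfKernel (rtpKernel b α γ)) (ξ, η)

theorem elem_adjoint_comp (ξ ξ' : α.carrier) (η η' : γ.carrier) :
    adjoint (elem b α γ ξ η) ∘L elem b α γ ξ' η' =
      adjoint ξ.1 ∘L ξ'.1 ∘L adjoint η.1 ∘L η'.1 := by
  have h := RKHS.kernel_apply (H := RKHS.OfKernel (rtpKernel b α γ)) (ξ, η) (ξ', η')
  rw [RKHS.OfKernel.kernel_ofKernel] at h
  exact h.symm

theorem inner_elem (ξ ξ' : α.carrier) (η η' : γ.carrier) (ζ ζ' : 𝔎) :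
    ⟪elem b α γ ξ η ζ, elem b α γ ξ' η' ζ'⟫_ℂ =
      ⟪ζ, adjoint ξ.1 (ξ'.1 (adjoint η.1 (η'.1 ζ')))⟫_ℂ := by
  rw [← ContinuousLinearMap.adjoint_inner_right]
  exact congrArg _ (DFunLike.congr_fun (elem_adjoint_comp b α γ ξ ξ' η η') ζ')

theorem elem_total :
    cspan (Set.range fun p : (α.carrier × γ.carrier) × 𝔎 => elem b α γ p.1.1 p.1.2 p.2) = ⊤ := by
  have h := RKHS.kerFun_dense (H := RKHS.OfKernel (rtpKernel b α γ))
  have e : (Set.range fun p : (α.carrier × γ.carrier) × 𝔎 => elem b α γ p.1.1 p.1.2 p.2) =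
      {x | ∃ p v, RKHS.kerFun (RKHS.OfKernel (rtpKernel b α γ)) p v = x} := by
    ext v
    constructor
    · rintro ⟨⟨⟨ξ, η⟩, ζ⟩, rfl⟩
      exact ⟨(ξ, η), ζ, rfl⟩
    · rintro ⟨⟨ξ, η⟩, ζ, rfl⟩
      exact ⟨((ξ, η), ζ), rfl⟩
  rw [e]
  exact h

/-- The operator `|η⟩₂ : H → H ⊗ K`, `ξ ζ ↦ ξ ⊗ ζ ⊗ η`, for `η ∈ γ`. -/
def ket2 (η : γ.carrier) : H →L[ℂ] RTP b α γ :=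
  clmOf (fun p : α.carrier × 𝔎 => p.1.1 p.2) (fun p => elem b α γ p.1 η p.2)

theorem commB {c : 𝔎 →L[ℂ] 𝔎} (hc : c ∈ b.Bd) : ∀ a ∈ b.B, a * c = c * a :=
  fun a ha => b.comm a ha c hc

theorem exists_ket2 (η : γ.carrier) : ∃ T : H →L[ℂ] RTP b α γ,
    ∀ p : α.carrier × 𝔎, T (p.1.1 p.2) = elem b α γ p.1 η p.2 := by
  have hη := commB b (γ.gram_mem η.2 η.2)
  set R := α.rho (adjoint η.1 ∘L η.1) with hR
  have h1 : ∀ p q : α.carrier × 𝔎, ⟪elem b α γ p.1 η p.2, elem b α γ q.1 η q.2⟫_ℂ =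
      ⟪p.1.1 p.2, R (q.1.1 q.2)⟫_ℂ := by
    intro p q
    rw [inner_elem, hR, α.rho_apply hη q.1.2, ← ContinuousLinearMap.adjoint_inner_right]
    rfl
  obtain ⟨T, hT, -⟩ := exists_clm_of_bound (fun p : α.carrier × 𝔎 => p.1.1 p.2)
    (fun p => elem b α γ p.1 η p.2) α.total_range (√‖R‖) (fun f => by
      have e : ⟪Finsupp.linearCombination ℂ (fun p : α.carrier × 𝔎 => elem b α γ p.1 η p.2) f,
          Finsupp.linearCombination ℂ (fun p : α.carrier × 𝔎 => elem b α γ p.1 η p.2) f⟫_ℂ =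
          ⟪Finsupp.linearCombination ℂ (fun p : α.carrier × 𝔎 => p.1.1 p.2) f,
          R (Finsupp.linearCombination ℂ (fun p : α.carrier × 𝔎 => p.1.1 p.2) f)⟫_ℂ := by
        simp only [Finsupp.linearCombination_apply, Finsupp.sum, sum_inner, inner_sum,
          inner_smul_left, inner_smul_right, map_sum, map_smul, h1]
      set x := Finsupp.linearCombination ℂ (fun p : α.carrier × 𝔎 => p.1.1 p.2) f
      set y := Finsupp.linearCombination ℂ (fun p : α.carrier × 𝔎 => elem b α γ p.1 η p.2) f
      have h2 : ‖y‖ ^ 2 ≤ ‖R‖ * ‖x‖ ^ 2 := by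
        have h3 : ‖⟪y, y⟫_ℂ‖ = ‖y‖ ^ 2 := by
          rw [inner_self_eq_norm_sq_to_K]; simp
        rw [← h3, e]
        calc ‖⟪x, R x⟫_ℂ‖ ≤ ‖x‖ * ‖R x‖ := norm_inner_le_norm _ _
          _ ≤ ‖x‖ * (‖R‖ * ‖x‖) := by gcongr; exact R.le_opNorm x
          _ = _ := by ring
      refine (sq_le_sq₀ (norm_nonneg _) (by positivity)).1 ?_
      rw [mul_pow, Real.sq_sqrt (norm_nonneg _)]
      exact h2)
  exact ⟨T, hT⟩

theorem ket2_apply (η : γ.carrier) (ξ : α.carrier) (ζ : 𝔎) :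
    ket2 b α γ η (ξ.1 ζ) = elem b α γ ξ η ζ := clmOf_spec (exists_ket2 b α γ η) (ξ, ζ)

theorem ket2_comp (η : γ.carrier) (ξ : α.carrier) :
    ket2 b α γ η ∘L ξ.1 = elem b α γ ξ η := by
  ext ζ; exact ket2_apply b α γ η ξ ζ

theorem ket2_adjoint_comp (η η' : γ.carrier) :
    adjoint (ket2 b α γ η) ∘L ket2 b α γ η' = α.rho (adjoint η.1 ∘L η'.1) := by
  refine α.ext_comp fun ξ' hξ' => ?_
  rw [α.rho_comp (commB b (γ.gram_mem η.2 η'.2)) hξ']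
  have key : ∀ ξ ∈ α.carrier, adjoint (adjoint (ket2 b α γ η) ∘L ket2 b α γ η' ∘L ξ') ∘L ξ =
      adjoint (ξ' ∘L (adjoint η.1 ∘L η'.1)) ∘L ξ := by
    intro ξ hξ
    have h := congrArg adjoint (elem_adjoint_comp b α γ ⟨ξ, hξ⟩ ⟨ξ', hξ'⟩ η η')
    rw [← ket2_comp b α γ η ⟨ξ, hξ⟩, ← ket2_comp b α γ η' ⟨ξ', hξ'⟩] at h
    simp only [ContinuousLinearMap.adjoint_comp, ContinuousLinearMap.adjoint_adjoint] at h ⊢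
    exact h
  have := congrArg adjoint (α.ext_comp key)
  rw [ContinuousLinearMap.adjoint_adjoint, ContinuousLinearMap.adjoint_adjoint] at this
  exact this

theorem ket2_total :
    cspan (Set.range fun p : γ.carrier × H => ket2 b α γ p.1 p.2) = ⊤ := by
  rw [eq_top_iff, ← elem_total b α γ]
  refine cspan_le (isClosed_cspan _) ?_
  rintro _ ⟨⟨⟨ξ, η⟩, ζ⟩, rfl⟩
  exact subset_cspan ⟨(η, ξ.1 ζ), ket2_apply b α γ η ξ ζ⟩

/-- The operator `|ξ⟩₁ : K → H ⊗ K`, `η ζ ↦ ξ ζ ⊗ η` for `η ∈ γ`, `ζ ∈ 𝔎`. It exists for all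
`ξ ∈ α`, where it takes the form `η ζ ↦ ξ ⊗ ζ ⊗ η`, and, more generally, for all operators
`ξ : 𝔎 → H` that satisfy `ρ_α(c) ξ = ξ c` for `c ∈ 𝔅†`, in particular for all `ξ ∈ M(α)`. -/
def ket1 (ξ : 𝔎 →L[ℂ] H) : K →L[ℂ] RTP b α γ :=
  clmOf (fun p : γ.carrier × 𝔎 => p.1.1 p.2) (fun p => ket2 b α γ p.1 (ξ p.2))

theorem exists_ket1 {ξ : 𝔎 →L[ℂ] H} (hξ : ∀ c ∈ b.Bd, α.rho c ∘L ξ = ξ ∘L c) :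
    ∃ T : K →L[ℂ] RTP b α γ,
      ∀ p : γ.carrier × 𝔎, T (p.1.1 p.2) = ket2 b α γ p.1 (ξ p.2) := by
  obtain ⟨T, hT, -⟩ := exists_twist (fun η : γ.carrier => η.1) (fun η => ket2 b α γ η) ξ
    γ.total_range (fun i j => by
      rw [← ContinuousLinearMap.comp_assoc, ket2_adjoint_comp]
      exact hξ _ (γ.gram_mem i.2 j.2))
  exact ⟨T, hT⟩

theorem ket1_apply' {ξ : 𝔎 →L[ℂ] H} (hξ : ∀ c ∈ b.Bd, α.rho c ∘L ξ = ξ ∘L c)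
    (η : γ.carrier) (ζ : 𝔎) : ket1 b α γ ξ (η.1 ζ) = ket2 b α γ η (ξ ζ) :=
  clmOf_spec (exists_ket1 b α γ hξ) (η, ζ)

theorem ket1_apply (ξ : α.carrier) (η : γ.carrier) (ζ : 𝔎) :
    ket1 b α γ ξ.1 (η.1 ζ) = elem b α γ ξ η ζ := by
  rw [ket1_apply' b α γ (fun c hc => α.rho_comp (commB b hc) ξ.2), ket2_apply]

theorem ket1_comp (ξ : α.carrier) (η : γ.carrier) :
    ket1 b α γ ξ.1 ∘L η.1 = elem b α γ ξ η := by
  ext ζ; exact ket1_apply b α γ ξ η ζ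

theorem ket1_adjoint_comp (ξ ξ' : α.carrier) :
    adjoint (ket1 b α γ ξ.1) ∘L ket1 b α γ ξ'.1 = γ.rho (adjoint ξ.1 ∘L ξ'.1) := by
  refine γ.ext_comp fun η' hη' => ?_
  rw [γ.rho_comp (commB b.op (α.gram_mem ξ.2 ξ'.2)) hη']
  have key : ∀ η ∈ γ.carrier, adjoint (adjoint (ket1 b α γ ξ.1) ∘L ket1 b α γ ξ'.1 ∘L η') ∘L η =
      adjoint (η' ∘L (adjoint ξ.1 ∘L ξ'.1)) ∘L η := by
    intro η hη
    have h := congrArg adjoint (elem_adjoint_comp b α γ ξ ξ' ⟨η, hη⟩ ⟨η', hη'⟩)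
    have hc := (rtpKernel_comm b α γ ξ' ξ ⟨η', hη'⟩ ⟨η, hη⟩).eq
    rw [← ket1_comp b α γ ξ ⟨η, hη⟩, ← ket1_comp b α γ ξ' ⟨η', hη'⟩] at h
    simp only [ContinuousLinearMap.adjoint_comp, ContinuousLinearMap.adjoint_adjoint] at h ⊢
    refine h.trans ?_
    exact hc.symm
  have := congrArg adjoint (γ.ext_comp key)
  rw [ContinuousLinearMap.adjoint_adjoint, ContinuousLinearMap.adjoint_adjoint] at this
  exact this

theorem ket1_total :
    cspan (Set.range fun p : α.carrier × K => ket1 b α γ p.1.1 p.2) = ⊤ := by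
  rw [eq_top_iff, ← elem_total b α γ]
  refine cspan_le (isClosed_cspan _) ?_
  rintro _ ⟨⟨⟨ξ, η⟩, ζ⟩, rfl⟩
  exact subset_cspan ⟨(ξ, η.1 ζ), ket1_apply b α γ ξ η ζ⟩

end

end Tensor

section Products

variable {𝔎 H K L M : Type*}
  [NormedAddCommGroup 𝔎] [InnerProductSpace ℂ 𝔎] [CompleteSpace 𝔎]
  [NormedAddCommGroup H] [InnerProductSpace ℂ H] [CompleteSpace H]
  [NormedAddCommGroup K] [InnerProductSpace ℂ K] [CompleteSpace K]
  [NormedAddCommGroup L] [InnerProductSpace ℂ L] [CompleteSpace L]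
  [NormedAddCommGroup M] [InnerProductSpace ℂ M] [CompleteSpace M]
  {C D : NonUnitalStarSubalgebra ℂ (𝔎 →L[ℂ] 𝔎)}

/-- The condition `[ρ_γ(D) δ] = δ` for a `C*`-module `γ` on `K` and a subspace `δ ⊆ L(𝔎, K)`. -/
def Acts (D : NonUnitalStarSubalgebra ℂ (𝔎 →L[ℂ] 𝔎)) (γ : CModule C K)
    (δ : Submodule ℂ (𝔎 →L[ℂ] K)) : Prop :=
  cspan {T : 𝔎 →L[ℂ] K | ∃ c ∈ D, ∃ d ∈ δ, γ.rho c ∘L d = T} = δ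

theorem Acts.comp_mem {γ : CModule C K} {δ : Submodule ℂ (𝔎 →L[ℂ] K)} (h : Acts D γ δ)
    {c : 𝔎 →L[ℂ] 𝔎} (hc : c ∈ D) {d : 𝔎 →L[ℂ] K} (hd : d ∈ δ) : γ.rho c ∘L d ∈ δ := by
  unfold Acts at h
  rw [← h]
  exact subset_cspan ⟨c, hc, d, hd, rfl⟩

theorem Acts.commute {γ : CModule C K} {E : NonUnitalStarSubalgebra ℂ (𝔎 →L[ℂ] 𝔎)}
    {δ : CModule E K} (h : Acts D γ δ.carrier)
    {c e : 𝔎 →L[ℂ] 𝔎} (hc : c ∈ D) (he : ∀ x ∈ E, x * e = e * x) :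
    γ.rho c ∘L δ.rho e = δ.rho e ∘L γ.rho c := by
  refine δ.ext_comp fun d hd => ?_
  rw [ContinuousLinearMap.comp_assoc, ContinuousLinearMap.comp_assoc, δ.rho_comp he hd,
    δ.rho_comp he (h.comp_mem hc hd), ContinuousLinearMap.comp_assoc]

theorem Acts.cspan_gram {X : Type*} [NormedAddCommGroup X] [InnerProductSpace ℂ X]
    [CompleteSpace X] {α : CModule D X} {γ : CModule C K}
    (hDC : ∀ c ∈ D, ∀ x ∈ C, x * c = c * x)
    {δ : Submodule ℂ (𝔎 →L[ℂ] K)} (h : Acts D γ δ) :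
    cspan {T : 𝔎 →L[ℂ] K | ∃ ξ ∈ α.carrier, ∃ ξ' ∈ α.carrier, ∃ d ∈ δ,
      γ.rho (adjoint ξ ∘L ξ') ∘L d = T} = δ := by
  have hcl : IsClosed (δ : Set (𝔎 →L[ℂ] K)) := by
    unfold Acts at h
    rw [← h]; exact isClosed_cspan _
  refine le_antisymm (cspan_le hcl ?_) ?_
  · rintro _ ⟨ξ, hξ, ξ', hξ', d, hd, rfl⟩
    exact h.comp_mem (α.gram_mem hξ hξ') hd
  · conv_lhs => rw [← h]
    refine cspan_le (isClosed_cspan _) ?_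
    rintro _ ⟨c, hc, d, hd, rfl⟩
    refine γ.rho_comp_mem (fun c hc => hDC c (α.cspan_gram_eq.1 hc)) d (isClosed_cspan _) ?_
      (α.cspan_gram_eq.2 hc)
    rintro _ ⟨ξ, hξ, ξ', hξ', rfl⟩
    exact subset_cspan ⟨ξ, hξ, ξ', hξ', d, hd, rfl⟩

theorem CModule.rho_ofKets {R : Type*} [NormedAddCommGroup R] [InnerProductSpace ℂ R]
    [CompleteSpace R] (δ : CModule C K) (κ : Set (K →L[ℂ] R))
    (htot : cspan {v : R | ∃ k ∈ κ, ∃ x, k x = v} = ⊤)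
    (hκ : cspan {T : 𝔎 →L[ℂ] K | ∃ k ∈ κ, ∃ k' ∈ κ, ∃ d ∈ δ.carrier, adjoint k ∘L k' ∘L d = T} =
      δ.carrier) {c : 𝔎 →L[ℂ] 𝔎} (hc : ∀ x ∈ C, x * c = c * x) {k : K →L[ℂ] R} (hk : k ∈ κ) :
    (δ.ofKets κ htot hκ).rho c ∘L k = k ∘L δ.rho c := by
  refine δ.ext_comp fun d hd => ?_
  have h : k ∘L d ∈ (δ.ofKets κ htot hκ).carrier := subset_cspan ⟨k, hk, d, hd, rfl⟩
  rw [ContinuousLinearMap.comp_assoc, CModule.rho_comp _ hc h, ContinuousLinearMap.comp_assoc,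
    ContinuousLinearMap.comp_assoc, δ.rho_comp hc hd]

section
variable (b : CBase 𝔎) (α : CModule b.B H) (γ : CModule b.Bd K)

/-- The `C*`-module `α ▷ δ = [|α⟩₁ δ]` on the relative tensor product, where `δ` is a
`C*`-module on `K` with `[ρ_γ(𝔅) δ] = δ`. -/
def triR (δ : CModule D K) (h : Acts b.B γ δ.carrier) : CModule D (RTP b α γ) :=
  δ.ofKets {k | ∃ ξ ∈ α.carrier, ket1 b α γ ξ = k}
    (by
      rw [← ket1_total b α γ]
      congr 1
      ext v
      constructor
      · rintro ⟨_, ⟨ξ, hξ, rfl⟩, x, rfl⟩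
        exact ⟨(⟨ξ, hξ⟩, x), rfl⟩
      · rintro ⟨⟨ξ, x⟩, rfl⟩
        exact ⟨_, ⟨ξ.1, ξ.2, rfl⟩, x, rfl⟩)
    (by
      refine Eq.trans ?_ (h.cspan_gram (α := α) (fun _ hc => commB b.op hc))
      congr 1
      ext T
      constructor
      · rintro ⟨_, ⟨ξ, hξ, rfl⟩, _, ⟨ξ', hξ', rfl⟩, d, hd, rfl⟩
        exact ⟨ξ, hξ, ξ', hξ', d, hd, by
          rw [← ket1_adjoint_comp b α γ ⟨ξ, hξ⟩ ⟨ξ', hξ'⟩]; rfl⟩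
      · rintro ⟨ξ, hξ, ξ', hξ', d, hd, rfl⟩
        exact ⟨_, ⟨ξ, hξ, rfl⟩, _, ⟨ξ', hξ', rfl⟩, d, hd, by
          rw [← ket1_adjoint_comp b α γ ⟨ξ, hξ⟩ ⟨ξ', hξ'⟩]; rfl⟩)

/-- The `C*`-module `δ ◁ γ = [|γ⟩₂ δ]` on the relative tensor product, where `δ` is a
`C*`-module on `H` with `[ρ_α(𝔅†) δ] = δ`. -/
def triL (δ : CModule D H) (h : Acts b.Bd α δ.carrier) : CModule D (RTP b α γ) :=
  δ.ofKets (Set.range (ket2 b α γ))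
    (by
      rw [← ket2_total b α γ]
      congr 1
      ext v
      constructor
      · rintro ⟨_, ⟨η, rfl⟩, x, rfl⟩
        exact ⟨(η, x), rfl⟩
      · rintro ⟨⟨η, x⟩, rfl⟩
        exact ⟨_, ⟨η, rfl⟩, x, rfl⟩)
    (by
      refine Eq.trans ?_ (h.cspan_gram (α := γ) (fun _ hc => commB b hc))
      congr 1
      ext T
      constructor
      · rintro ⟨_, ⟨η, rfl⟩, _, ⟨η', rfl⟩, d, hd, rfl⟩
        exact ⟨η.1, η.2, η'.1, η'.2, d, hd, by
          rw [← ket2_adjoint_comp b α γ η η']; rfl⟩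
      · rintro ⟨η, hη, η', hη', d, hd, rfl⟩
        exact ⟨_, ⟨⟨η, hη⟩, rfl⟩, _, ⟨⟨η', hη'⟩, rfl⟩, d, hd, by
          rw [← ket2_adjoint_comp b α γ ⟨η, hη⟩ ⟨η', hη'⟩]; rfl⟩)

theorem triR_rho (δ : CModule D K) (h : Acts b.B γ δ.carrier) {c : 𝔎 →L[ℂ] 𝔎}
    (hc : ∀ x ∈ D, x * c = c * x) (ξ : α.carrier) (x : K) :
    (triR b α γ δ h).rho c (ket1 b α γ ξ.1 x) = ket1 b α γ ξ.1 (δ.rho c x) :=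
  DFunLike.congr_fun (CModule.rho_ofKets δ {k | ∃ ξ ∈ α.carrier, ket1 b α γ ξ = k} _ _ hc
    ⟨ξ.1, ξ.2, rfl⟩) x

theorem triL_rho (δ : CModule D H) (h : Acts b.Bd α δ.carrier) {c : 𝔎 →L[ℂ] 𝔎}
    (hc : ∀ x ∈ D, x * c = c * x) (η : γ.carrier) (x : H) :
    (triL b α γ δ h).rho c (ket2 b α γ η x) = ket2 b α γ η (δ.rho c x) :=
  DFunLike.congr_fun (CModule.rho_ofKets δ (Set.range (ket2 b α γ)) _ _ hc ⟨η, rfl⟩) x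

theorem inner_ket1 (ξ ξ' : α.carrier) (x y : K) :
    ⟪ket1 b α γ ξ.1 x, ket1 b α γ ξ'.1 y⟫_ℂ = ⟪x, γ.rho (adjoint ξ.1 ∘L ξ'.1) y⟫_ℂ := by
  rw [← ContinuousLinearMap.adjoint_inner_right, ← ket1_adjoint_comp b α γ]
  rfl

theorem inner_ket2 (η η' : γ.carrier) (x y : H) :
    ⟪ket2 b α γ η x, ket2 b α γ η' y⟫_ℂ = ⟪x, α.rho (adjoint η.1 ∘L η'.1) y⟫_ℂ := by
  rw [← ContinuousLinearMap.adjoint_inner_right, ← ket2_adjoint_comp b α γ]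
  rfl

theorem exists_flip : ∃ U : RTP b α γ ≃ₗᵢ[ℂ] RTP b.op γ α,
    ∀ p : (α.carrier × γ.carrier) × 𝔎,
      U (elem b α γ p.1.1 p.1.2 p.2) = elem b.op γ α p.1.2 p.1.1 p.2 := by
  refine exists_unitary _ _ (elem_total b α γ) ?_ ?_
  · rw [← elem_total b.op γ α]
    congr 1
    ext v
    constructor
    · rintro ⟨⟨⟨ξ, η⟩, ζ⟩, rfl⟩
      exact ⟨((η, ξ), ζ), rfl⟩
    · rintro ⟨⟨⟨ξ, η⟩, ζ⟩, rfl⟩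
      exact ⟨((η, ξ), ζ), rfl⟩
  · intro p q
    rw [inner_elem, inner_elem]
    exact congrArg _ (DFunLike.congr_fun (rtpKernel_comm b α γ p.1.1 q.1.1 p.1.2 q.1.2).eq q.2)

/-- The flip `Σ : H ⊗ K → K ⊗ H`, `ξ ⊗ ζ ⊗ η ↦ η ⊗ ζ ⊗ ξ`. -/
def flipU : RTP b α γ ≃ₗᵢ[ℂ] RTP b.op γ α := (exists_flip b α γ).choose

theorem exists_unitR : ∃ U : RTP b b.base γ ≃ₗᵢ[ℂ] K,
    ∀ p : (b.base.carrier × γ.carrier) × 𝔎,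
      U (elem b b.base γ p.1.1 p.1.2 p.2) = p.1.2.1 (p.1.1.1 p.2) := by
  refine exists_unitary _ _ (elem_total b b.base γ) ?_ ?_
  · rw [eq_top_iff, ← γ.total]
    refine cspan_le (isClosed_cspan _) ?_
    rintro _ ⟨η, hη, ζ, rfl⟩
    have hζ : ζ ∈ cspan {v : 𝔎 | ∃ a ∈ b.B, ∃ ζ, a ζ = v} := by rw [b.nondeg_B]; trivial
    refine map_mem_of_mem_cspan (isClosed_cspan _) η ?_ hζ
    rintro _ ⟨a, ha, ζ, rfl⟩
    exact subset_cspan ⟨((⟨a, ha⟩, ⟨η, hη⟩), ζ), rfl⟩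
  · intro p q
    rw [inner_elem, ← ContinuousLinearMap.adjoint_inner_right,
      ← ContinuousLinearMap.adjoint_inner_right]
    have h : q.1.1.1 * (adjoint p.1.2.1 ∘L q.1.2.1) = (adjoint p.1.2.1 ∘L q.1.2.1) * q.1.1.1 :=
      b.comm _ q.1.1.2 _ (γ.gram_mem p.1.2.2 q.1.2.2)
    exact congrArg (fun v => ⟪p.2, adjoint p.1.1.1 v⟫_ℂ) (DFunLike.congr_fun h q.2)

/-- The canonical isomorphism `𝔎 ⊗ K → K`, `b ⊗ ζ ⊗ η ↦ η b ζ`. -/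
def unitR : RTP b b.base γ ≃ₗᵢ[ℂ] K := (exists_unitR b γ).choose

theorem exists_unitL : ∃ U : RTP b α b.op.base ≃ₗᵢ[ℂ] H,
    ∀ p : (α.carrier × b.op.base.carrier) × 𝔎,
      U (elem b α b.op.base p.1.1 p.1.2 p.2) = p.1.1.1 (p.1.2.1 p.2) := by
  refine exists_unitary _ _ (elem_total b α b.op.base) ?_ ?_
  · rw [eq_top_iff, ← α.total]
    refine cspan_le (isClosed_cspan _) ?_
    rintro _ ⟨ξ, hξ, ζ, rfl⟩
    have hζ : ζ ∈ cspan {v : 𝔎 | ∃ a ∈ b.Bd, ∃ ζ, a ζ = v} := by rw [b.nondeg_Bd]; trivial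
    refine map_mem_of_mem_cspan (isClosed_cspan _) ξ ?_ hζ
    rintro _ ⟨a, ha, ζ, rfl⟩
    exact subset_cspan ⟨((⟨ξ, hξ⟩, ⟨a, ha⟩), ζ), rfl⟩
  · intro p q
    rw [inner_elem, ← ContinuousLinearMap.adjoint_inner_right,
      ← ContinuousLinearMap.adjoint_inner_right]
    have hp : adjoint p.1.2.1 ∈ b.Bd := star_mem (s := b.Bd) p.1.2.2
    have h : (adjoint p.1.1.1 ∘L q.1.1.1) * (adjoint p.1.2.1) =
        (adjoint p.1.2.1) * (adjoint p.1.1.1 ∘L q.1.1.1) :=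
      b.comm _ (α.gram_mem p.1.1.2 q.1.1.2) _ hp
    exact congrArg (fun v => ⟪p.2, v⟫_ℂ) (DFunLike.congr_fun h (q.1.2.1 q.2))

/-- The canonical isomorphism `H ⊗ 𝔎 → H`, `ξ ⊗ ζ ⊗ b† ↦ ξ b† ζ`. -/
def unitL : RTP b α b.op.base ≃ₗᵢ[ℂ] H := (exists_unitL b α).choose

end

theorem total_comp {I J X Y : Type*} [NormedAddCommGroup X] [NormedSpace ℂ X]
    [NormedAddCommGroup Y] [NormedSpace ℂ Y] {k : I → X →L[ℂ] Y} {y : J → X}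
    (hk : cspan (Set.range fun p : I × X => k p.1 p.2) = ⊤) (hy : cspan (Set.range y) = ⊤) :
    cspan (Set.range fun p : I × J => k p.1 (y p.2)) = ⊤ := by
  rw [eq_top_iff, ← hk]
  refine cspan_le (isClosed_cspan _) ?_
  rintro _ ⟨⟨i, x⟩, rfl⟩
  have hx : x ∈ cspan (Set.range y) := by rw [hy]; trivial
  refine map_mem_of_mem_cspan (isClosed_cspan _) (k i) ?_ hx
  rintro _ ⟨j, rfl⟩
  exact subset_cspan ⟨(i, j), rfl⟩

section
variable (b d : CBase 𝔎)

theorem exists_assoc (β : CModule b.B H) (γ : CModule b.Bd K) (ε : CModule d.B K)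
    (φ : CModule d.Bd L) (h₁ : Acts b.B γ ε.carrier) (h₂ : Acts d.Bd ε γ.carrier) :
    ∃ U : RTP d (triR b β γ ε h₁) φ ≃ₗᵢ[ℂ] RTP b β (triL d ε φ γ h₂),
      ∀ p : φ.carrier × β.carrier × K,
        U (ket2 d (triR b β γ ε h₁) φ p.1 (ket1 b β γ p.2.1.1 p.2.2)) =
          ket1 b β (triL d ε φ γ h₂) p.2.1.1 (ket2 d ε φ p.1 p.2.2) := by
  refine exists_unitary _ _ ?_ ?_ ?_
  · exact total_comp (k := ket2 d (triR b β γ ε h₁) φ)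
      (y := fun p : β.carrier × K => ket1 b β γ p.1.1 p.2) (ket2_total d (triR b β γ ε h₁) φ)
      (ket1_total b β γ)
  · have h := total_comp (k := fun ξ : β.carrier => ket1 b β (triL d ε φ γ h₂) ξ.1)
      (y := fun p : φ.carrier × K => ket2 d ε φ p.1 p.2) (ket1_total b β (triL d ε φ γ h₂))
      (ket2_total d ε φ)
    rw [← h]
    congr 1
    ext v
    constructor
    · rintro ⟨⟨η, ξ, x⟩, rfl⟩
      exact ⟨(ξ, η, x), rfl⟩
    · rintro ⟨⟨ξ, η, x⟩, rfl⟩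
      exact ⟨(η, ξ, x), rfl⟩
  · intro p q
    have hφ := φ.gram_mem p.1.2 q.1.2
    have hβ := β.gram_mem p.2.1.2 q.2.1.2
    rw [inner_ket2, triR_rho _ _ _ _ _ (commB d hφ), inner_ket1, inner_ket1,
      triL_rho _ _ _ _ _ (commB b.op hβ), inner_ket2]
    exact congrArg (fun v => ⟪p.2.2, v⟫_ℂ)
      (DFunLike.congr_fun (h₁.commute hβ (commB d hφ)) q.2.2)

/-- The canonical isomorphism `(H ⊗ K) ⊗ L → H ⊗ (K ⊗ L)`, which maps `|φ⟩₂ |ξ⟩₁ x` to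
`|ξ⟩₁ |φ⟩₂ x` for `ξ ∈ β`, `x ∈ K` and `φ` in the module on `L`. -/
def assocU (β : CModule b.B H) (γ : CModule b.Bd K) (ε : CModule d.B K)
    (φ : CModule d.Bd L) (h₁ : Acts b.B γ ε.carrier) (h₂ : Acts d.Bd ε γ.carrier) :
    RTP d (triR b β γ ε h₁) φ ≃ₗᵢ[ℂ] RTP b β (triL d ε φ γ h₂) :=
  (exists_assoc b d β γ ε φ h₁ h₂).choose

theorem exists_swap (α : CModule b.B H) (γ : CModule b.Bd K) (δ : CModule d.B H)
    (φ : CModule d.Bd L) (h₁ : Acts b.Bd α δ.carrier) (h₂ : Acts d.Bd δ α.carrier) :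
    ∃ U : RTP d (triL b α γ δ h₁) φ ≃ₗᵢ[ℂ] RTP b (triL d δ φ α h₂) γ,
      ∀ p : φ.carrier × γ.carrier × H,
        U (ket2 d (triL b α γ δ h₁) φ p.1 (ket2 b α γ p.2.1 p.2.2)) =
          ket2 b (triL d δ φ α h₂) γ p.2.1 (ket2 d δ φ p.1 p.2.2) := by
  refine exists_unitary _ _ ?_ ?_ ?_
  · exact total_comp (k := ket2 d (triL b α γ δ h₁) φ)
      (y := fun p : γ.carrier × H => ket2 b α γ p.1 p.2) (ket2_total d (triL b α γ δ h₁) φ)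
      (ket2_total b α γ)
  · have h := total_comp (k := ket2 b (triL d δ φ α h₂) γ)
      (y := fun p : φ.carrier × H => ket2 d δ φ p.1 p.2) (ket2_total b (triL d δ φ α h₂) γ)
      (ket2_total d δ φ)
    rw [← h]
    congr 1
    ext v
    constructor
    · rintro ⟨⟨η, ξ, x⟩, rfl⟩
      exact ⟨(ξ, η, x), rfl⟩
    · rintro ⟨⟨ξ, η, x⟩, rfl⟩
      exact ⟨(η, ξ, x), rfl⟩
  · intro p q
    have hφ := φ.gram_mem p.1.2 q.1.2
    have hγ := γ.gram_mem p.2.1.2 q.2.1.2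
    rw [inner_ket2, triL_rho _ _ _ _ _ (commB d hφ), inner_ket2, inner_ket2,
      triL_rho _ _ _ _ _ (commB b hγ), inner_ket2]
    exact congrArg (fun v => ⟪p.2.2, v⟫_ℂ)
      (DFunLike.congr_fun (h₁.commute hγ (commB d hφ)) q.2.2)

/-- The isomorphism `Σ₂₃ : (H ⊗ K) ⊗ L → (H ⊗ L) ⊗ K`, which maps `|φ⟩₂ |η⟩₂ x` to
`|η⟩₂ |φ⟩₂ x` for `x ∈ H` and `η`, `φ` in the modules on `K` and `L`, respectively. -/
def swapU (α : CModule b.B H) (γ : CModule b.Bd K) (δ : CModule d.B H)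
    (φ : CModule d.Bd L) (h₁ : Acts b.Bd α δ.carrier) (h₂ : Acts d.Bd δ α.carrier) :
    RTP d (triL b α γ δ h₁) φ ≃ₗᵢ[ℂ] RTP b (triL d δ φ α h₂) γ :=
  (exists_swap b d α γ δ φ h₁ h₂).choose

/-- The operator `S ⊗ Id : H ⊗ K → L ⊗ K`, `|η⟩₂ x ↦ |η⟩₂ S x`. It exists if
`S ρ(b†) = ρ(b†) S` for `b† ∈ 𝔅†`, in particular for every semi-morphism `S`. -/
def ampL (α : CModule b.B H) (α' : CModule b.B L) (γ : CModule b.Bd K) (S : H →L[ℂ] L) :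
    RTP b α γ →L[ℂ] RTP b α' γ :=
  clmOf (fun p : γ.carrier × H => ket2 b α γ p.1 p.2) (fun p => ket2 b α' γ p.1 (S p.2))

theorem ampL_ket2 {α : CModule b.B H} {α' : CModule b.B L} {γ : CModule b.Bd K} {S : H →L[ℂ] L}
    (hS : ∀ c ∈ b.Bd, α'.rho c ∘L S = S ∘L α.rho c) (η : γ.carrier) (x : H) :
    ampL b α α' γ S (ket2 b α γ η x) = ket2 b α' γ η (S x) := by
  obtain ⟨T, hT, -⟩ := exists_twist (fun η => ket2 b α γ η) (fun η => ket2 b α' γ η) S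
    (ket2_total b α γ) (fun i j => by
      rw [← ContinuousLinearMap.comp_assoc, ket2_adjoint_comp, ket2_adjoint_comp]
      exact hS _ (γ.gram_mem i.2 j.2))
  exact clmOf_spec ⟨T, hT⟩ (η, x)

/-- The operator `Id ⊗ T : H ⊗ K → H ⊗ L`, `|ξ⟩₁ y ↦ |ξ⟩₁ T y`. It exists if
`T ρ(b) = ρ(b) T` for `b ∈ 𝔅`, in particular for every semi-morphism `T`. -/
def ampR (α : CModule b.B H) (γ : CModule b.Bd K) (γ' : CModule b.Bd L) (T : K →L[ℂ] L) :
    RTP b α γ →L[ℂ] RTP b α γ' :=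
  clmOf (fun p : α.carrier × K => ket1 b α γ p.1.1 p.2) (fun p => ket1 b α γ' p.1.1 (T p.2))

theorem ampR_ket1 {α : CModule b.B H} {γ : CModule b.Bd K} {γ' : CModule b.Bd L} {T : K →L[ℂ] L}
    (hT : ∀ c ∈ b.B, γ'.rho c ∘L T = T ∘L γ.rho c) (ξ : α.carrier) (y : K) :
    ampR b α γ γ' T (ket1 b α γ ξ.1 y) = ket1 b α γ' ξ.1 (T y) := by
  obtain ⟨U, hU, -⟩ := exists_twist (fun ξ : α.carrier => ket1 b α γ ξ.1)
    (fun ξ => ket1 b α γ' ξ.1) T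
    (ket1_total b α γ) (fun i j => by
      rw [← ContinuousLinearMap.comp_assoc, ket1_adjoint_comp, ket1_adjoint_comp]
      exact hT _ (α.gram_mem i.2 j.2))
  exact clmOf_spec ⟨U, hU⟩ (ξ, y)

end

end Products

section Unitaries

variable {𝔎 H K L M : Type*}
  [NormedAddCommGroup 𝔎] [InnerProductSpace ℂ 𝔎] [CompleteSpace 𝔎]
  [NormedAddCommGroup H] [InnerProductSpace ℂ H] [CompleteSpace H]
  [NormedAddCommGroup K] [InnerProductSpace ℂ K] [CompleteSpace K]
  [NormedAddCommGroup L] [InnerProductSpace ℂ L] [CompleteSpace L]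
  [NormedAddCommGroup M] [InnerProductSpace ℂ M] [CompleteSpace M]

/-- A unitary, regarded as a bounded operator. -/
abbrev toOp (U : H ≃ₗᵢ[ℂ] K) : H →L[ℂ] K := (U.toContinuousLinearEquiv : H →L[ℂ] K)

/-- The image `T γ = {T ξ : ξ ∈ γ}`. -/
def opImage (T : H →L[ℂ] K) (γ : Submodule ℂ (𝔎 →L[ℂ] H)) : Set (𝔎 →L[ℂ] K) :=
  (fun ξ => T ∘L ξ) '' (γ : Set (𝔎 →L[ℂ] H))

/-- A `C*`-`(𝔟†, 𝔟, 𝔟†)`-module `(H, β̂, α, β)`. -/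
structure TriModule (b : CBase 𝔎) (H : Type*) [NormedAddCommGroup H] [InnerProductSpace ℂ H]
    [CompleteSpace H] where
  βhat : CModule b.Bd H
  α : CModule b.B H
  β : CModule b.Bd H
  βhat_α : Acts b.B βhat α.carrier
  βhat_β : Acts b.B βhat β.carrier
  α_βhat : Acts b.Bd α βhat.carrier
  α_β : Acts b.Bd α β.carrier
  β_βhat : Acts b.B β βhat.carrier
  β_α : Acts b.B β α.carrier

namespace TriModule
variable {b : CBase 𝔎} (m : TriModule b H)

/-- The space `H ⊗ H` over `𝔟†` with respect to `β̂` and `α`. -/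
abbrev Src := RTP b.op m.βhat m.α

/-- The space `H ⊗ H` over `𝔟` with respect to `α` and `β`. -/
abbrev Rng := RTP b m.α m.β

/-- `α ◁ α`, `β ◁ α`, `β̂ ▷ β`, `β̂ ▷ β̂` on the first space. -/
abbrev srcαα : CModule b.B m.Src := triL b.op m.βhat m.α m.α m.βhat_α
abbrev srcβα : CModule b.Bd m.Src := triL b.op m.βhat m.α m.β m.βhat_β
abbrev srcββ : CModule b.Bd m.Src := triR b.op m.βhat m.α m.β m.α_β
abbrev srcβhβh : CModule b.Bd m.Src := triR b.op m.βhat m.α m.βhat m.α_βhat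

/-- `α ▷ α`, `β̂ ◁ β`, `α ▷ β̂`, `β ◁ β` on the second space. -/
abbrev rngαα : CModule b.B m.Rng := triR b m.α m.β m.α m.β_α
abbrev rngβhβ : CModule b.Bd m.Rng := triL b m.α m.β m.βhat m.α_βhat
abbrev rngαβh : CModule b.Bd m.Rng := triR b m.α m.β m.βhat m.β_βhat
abbrev rngββ : CModule b.Bd m.Rng := triL b m.α m.β m.β m.α_β

/-- `α ◁ α` on the flipped second space. -/
abbrev flipαα : CModule b.B (RTP b.op m.β m.α) := triL b.op m.β m.α m.α m.β_α

variable (V : m.Src ≃ₗᵢ[ℂ] m.Rng)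

/-- The composition `V₂₃ V₁₂` in the pentagon diagram. -/
def pentLeft : RTP b.op m.srcβhβh m.α →L[ℂ] RTP b m.rngαα m.β :=
  toOp (assocU b b m.α m.β m.α m.β m.β_α m.α_β).symm
    ∘L ampR b m.α m.srcβα m.rngββ (toOp V)
    ∘L toOp (assocU b b.op m.α m.β m.βhat m.α m.β_βhat m.βhat_β)
    ∘L ampL b.op m.srcβhβh m.rngαβh m.α (toOp V)

/-- The composition `V₁₂ V₁₃ V₂₃` in the pentagon diagram, where
`V₁₃ = Σ₂₃ (V ⊗ Id) (Id ⊗ Σ)`. -/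
def pentRight : RTP b.op m.srcβhβh m.α →L[ℂ] RTP b m.rngαα m.β :=
  ampL b m.srcαα m.rngαα m.β (toOp V)
    ∘L toOp (swapU b b.op m.α m.β m.βhat m.α m.α_βhat m.βhat_α)
    ∘L ampL b.op m.srcββ m.rngβhβ m.α (toOp V)
    ∘L toOp (assocU b.op b.op m.βhat m.α m.β m.α m.α_β m.β_α).symm
    ∘L ampR b.op m.βhat m.rngαα m.flipαα (toOp (flipU b m.α m.β))
    ∘L ampR b.op m.βhat m.srcαα m.rngαα (toOp V)
    ∘L toOp (assocU b.op b.op m.βhat m.α m.βhat m.α m.α_βhat m.βhat_α)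

end TriModule

/-- A `C*`-pseudo-multiplicative unitary `(𝔟, H, β̂, α, β, V)`. -/
structure PMU (b : CBase 𝔎) (H : Type*) [NormedAddCommGroup H] [InnerProductSpace ℂ H]
    [CompleteSpace H] extends TriModule b H where
  V : toTriModule.Src ≃ₗᵢ[ℂ] toTriModule.Rng
  map_αα : opImage (toOp V) toTriModule.srcαα.carrier = toTriModule.rngαα.carrier
  map_βhβ : opImage (toOp V) toTriModule.srcββ.carrier = toTriModule.rngβhβ.carrier
  map_βhβh : opImage (toOp V) toTriModule.srcβhβh.carrier = toTriModule.rngαβh.carrier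
  map_βα : opImage (toOp V) toTriModule.srcβα.carrier = toTriModule.rngββ.carrier
  pentagon : toTriModule.pentLeft V = toTriModule.pentRight V

/-- The space of multipliers
`M(γ) = {T ∈ L(𝔎, H) : T B ⊆ γ, T* γ ⊆ B}` of a `C*`-module `γ`. -/
def CModule.multipliers {B : NonUnitalStarSubalgebra ℂ (𝔎 →L[ℂ] 𝔎)} (γ : CModule B H) :
    Set (𝔎 →L[ℂ] H) :=
  {T | (∀ x ∈ B, T ∘L x ∈ γ.carrier) ∧ ∀ ξ ∈ γ.carrier, adjoint T ∘L ξ ∈ B}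

/-- For an operator `X : K ⊗ H → K ⊗ H` with the source taken over `𝔟†` with respect to `δ̂`, `α`
and the target over `𝔟` with respect to `γ`, `β`: the closed linear span of the operators
`⟨η|₂ X |ξ⟩₂` on `K`, where `η ∈ β`, `ξ ∈ α`. -/
def legSpace (b : CBase 𝔎) (δ : CModule b.Bd K) (γ : CModule b.B K) (α : CModule b.B H)
    (β : CModule b.Bd H) (X : RTP b.op δ α →L[ℂ] RTP b γ β) : Submodule ℂ (K →L[ℂ] K) :=
  cspan {T | ∃ (η : β.carrier) (ξ : α.carrier),
    adjoint (ket2 b γ β η) ∘L X ∘L ket2 b.op δ α ξ = T}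

/-- The sequences `ξ` in `γ` for which `∑ ξₖ* ξₖ` converges in norm. -/
def seqSpace {B : NonUnitalStarSubalgebra ℂ (𝔎 →L[ℂ] 𝔎)} (γ : CModule B H) :
    Set (ℕ → γ.carrier) :=
  {ξ | Summable fun k => adjoint (ξ k).1 ∘L (ξ k).1}

namespace PMU
variable {b : CBase 𝔎} (V : PMU b H)

/-- The trivial representation `1 = Ψ* Φ` of `V` on `𝔎`, where `Φ : 𝔎 ⊗ H → H` and
`Ψ : 𝔎 ⊗ H → H` are the canonical isomorphisms. -/
def triv : RTP b.op b.op.base V.α ≃ₗᵢ[ℂ] RTP b b.base V.β :=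
  (unitR b.op V.α).trans (unitR b V.β).symm

/-- The algebra `Â_V ⊆ L(H)`. -/
def hatA : Submodule ℂ (H →L[ℂ] H) := legSpace b V.βhat V.α V.α V.β (toOp V.V)

/-- The algebra `Â_1 ⊆ L(𝔎)` of the trivial representation. -/
def hatOne : Submodule ℂ (𝔎 →L[ℂ] 𝔎) := legSpace b b.op.base b.base V.α V.β (toOp V.triv)

/-- The commutant `ρ_β̂(𝔅)'` in `L(H)`. -/
def comm : Set (H →L[ℂ] H) := {T | ∀ x ∈ b.B, T ∘L V.βhat.rho x = V.βhat.rho x ∘L T}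

/-- The map `ω_{ξ,η} : ρ_β̂(𝔅)' → L(𝔎)`, `T ↦ ∑ₖ ξₖ* T ηₖ`. -/
def omega (ξ : ℕ → V.β.carrier) (η : ℕ → V.α.carrier) : V.comm → 𝔎 →L[ℂ] 𝔎 :=
  fun T => ∑' k, adjoint (ξ k).1 ∘L T.1 ∘L (η k).1

/-- The space `Ω̃_{β,α}` of all maps `ω_{ξ,η}`, where `∑ ξₖ* ξₖ` and `∑ ηₖ* ηₖ` converge. -/
def Omega : Set (V.comm → 𝔎 →L[ℂ] 𝔎) :=
  {ω | ∃ ξ ∈ seqSpace V.β, ∃ η ∈ seqSpace V.α, V.omega ξ η = ω}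

/-- The map `π̂_X : ω_{ξ,η} ↦ ∑ₙ ⟨ξₙ|₂ X |ηₙ⟩₂` on `Ω̃_{β,α}`. -/
def piHat {δ : CModule b.Bd K} {γ : CModule b.B K} (X : RTP b.op δ V.α →L[ℂ] RTP b γ V.β)
    (ω : V.comm → 𝔎 →L[ℂ] 𝔎) : K →L[ℂ] K :=
  open Classical in
  if h : ∃ p : (ℕ → V.β.carrier) × (ℕ → V.α.carrier),
      p.1 ∈ seqSpace V.β ∧ p.2 ∈ seqSpace V.α ∧ V.omega p.1 p.2 = ω then
    ∑' n, adjoint (ket2 b γ V.β (h.choose.1 n)) ∘L X ∘L ket2 b.op δ V.α (h.choose.2 n)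
  else 0

/-- The map `π̂_V`. -/
def piV (ω : V.comm → 𝔎 →L[ℂ] 𝔎) : H →L[ℂ] H := V.piHat (δ := V.βhat) (γ := V.α) (toOp V.V) ω

/-- The map `π̂_1`. -/
def piOne (ω : V.comm → 𝔎 →L[ℂ] 𝔎) : 𝔎 →L[ℂ] 𝔎 :=
  V.piHat (δ := b.op.base) (γ := b.base) (toOp V.triv) ω

/-- The set of fixed elements `η ∈ M(β̂) ∩ M(α)`, `V |η⟩₁ = |η⟩₁`. -/
def Fix : Set (𝔎 →L[ℂ] H) :=
  {η | η ∈ V.βhat.multipliers ∧ η ∈ V.α.multipliers ∧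
    toOp V.V ∘L ket1 b.op V.βhat V.α η = ket1 b V.α V.β η}

/-- `V` is étale. -/
def IsEtale : Prop := ∃ η ∈ V.Fix, adjoint η ∘L η = ContinuousLinearMap.id ℂ 𝔎

/-- The space `C_V = [⟨α|₁ V |α⟩₂]`. -/
def CV : Submodule ℂ (H →L[ℂ] H) :=
  cspan {T | ∃ ξ' ξ : V.α.carrier,
    adjoint (ket1 b V.α V.β ξ'.1) ∘L toOp V.V ∘L ket2 b.op V.βhat V.α ξ = T}

/-- `V` is regular: `C_V = [α α*]`. -/
def IsRegular : Prop :=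
  V.CV = cspan {T | ∃ ξ ∈ V.α.carrier, ∃ ξ' ∈ V.α.carrier, ξ ∘L adjoint ξ' = T}

/-- The comultiplication `Δ̂_V(y) = V* (Id ⊗ y) V`, restricted to `Â_V`. -/
def hatDelta (y : V.hatA) : V.Src →L[ℂ] V.Src :=
  toOp V.V.symm ∘L ampR b V.α V.β V.β y.1 ∘L toOp V.V

/-- `ε` is a contractive homomorphism `Â_V → Â_1` with `ε ∘ π̂_V = π̂_1` on `Ω̃_{β,α}`. -/
structure IsCompatibleHom (ε : V.hatA →ₗ[ℂ] V.hatOne) : Prop where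
  map_mul : ∀ x y z : V.hatA, (z : H →L[ℂ] H) = x.1 ∘L y.1 →
    (ε z : 𝔎 →L[ℂ] 𝔎) = (ε x).1 ∘L (ε y).1
  norm_le : ∀ x, ‖ε x‖ ≤ ‖x‖
  comp_piV : ∀ ω ∈ V.Omega, ∃ h : V.piV ω ∈ V.hatA, (ε ⟨V.piV ω, h⟩ : 𝔎 →L[ℂ] 𝔎) = V.piOne ω

end PMU

section Algebras

/-- `L_s(H_γ, K_δ)`: the operators `T` with `T γ ⊆ δ`. -/
def semiMor {B : NonUnitalStarSubalgebra ℂ (𝔎 →L[ℂ] 𝔎)} (γ : CModule B H) (δ : CModule B K) :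
    Set (H →L[ℂ] K) := {T | ∀ ξ ∈ γ.carrier, T ∘L ξ ∈ δ.carrier}

/-- `L(H_γ, K_δ)`: the operators `T` with `T γ ⊆ δ` and `T* δ ⊆ γ`. -/
def mor {B : NonUnitalStarSubalgebra ℂ (𝔎 →L[ℂ] 𝔎)} (γ : CModule B H) (δ : CModule B K) :
    Set (H →L[ℂ] K) := {T | T ∈ semiMor γ δ ∧ adjoint T ∈ semiMor δ γ}

/-- A `C*`-`(𝔠†, 𝔠)`-algebra `A^{β,α}_H`. -/
structure IsBiAlgebra (c : CBase 𝔎) (β : CModule c.Bd H) (α : CModule c.B H)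
    (A : Submodule ℂ (H →L[ℂ] H)) : Prop where
  acts_α : Acts c.B β α.carrier
  acts_β : Acts c.Bd α β.carrier
  closed : IsClosed (A : Set (H →L[ℂ] H))
  mul_mem : ∀ x ∈ A, ∀ y ∈ A, x ∘L y ∈ A
  star_mem : ∀ x ∈ A, adjoint x ∈ A
  rho_β_mem : ∀ d ∈ c.B, ∀ x ∈ A, β.rho d ∘L x ∈ A
  rho_α_mem : ∀ d ∈ c.Bd, ∀ x ∈ A, α.rho d ∘L x ∈ A

/-- A `*`-homomorphism between algebras of operators `A ⊆ L(H)` and `C ⊆ L(K)`. -/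
structure IsStarHom (A : Submodule ℂ (H →L[ℂ] H)) (C : Submodule ℂ (K →L[ℂ] K))
    (π : A → K →L[ℂ] K) : Prop where
  mem : ∀ x, π x ∈ C
  add : ∀ x y, π (x + y) = π x + π y
  smul : ∀ (a : ℂ) (x), π (a • x) = a • π x
  mul : ∀ x y z : A, (z : H →L[ℂ] H) = x.1 ∘L y.1 → π z = π x ∘L π y
  star : ∀ x y : A, (y : H →L[ℂ] H) = adjoint x.1 → π y = adjoint (π x)

/-- `L^π(H, K)`: the operators `T` with `T x = π(x) T` for all `x ∈ A`. -/
def intertwiners {A : Submodule ℂ (H →L[ℂ] H)} (π : A → K →L[ℂ] K) : Set (H →L[ℂ] K) :=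
  {T | ∀ x, T ∘L x.1 = π x ∘L T}

/-- A jointly semi-normal morphism from `A^{β,α}_H` to `C^{δ,γ}_K`. -/
structure IsJointlySemiNormal (c : CBase 𝔎) (β : CModule c.Bd H) (α : CModule c.B H)
    (A : Submodule ℂ (H →L[ℂ] H)) (δ : CModule c.Bd K) (γ : CModule c.B K)
    (C : Submodule ℂ (K →L[ℂ] K)) (π : A → K →L[ℂ] K) : Prop where
  source : IsBiAlgebra c β α A
  target : IsBiAlgebra c δ γ C
  hom : IsStarHom A C π
  span_β : cspan {T | ∃ S ∈ intertwiners π ∩ (semiMor β δ ∩ semiMor α γ),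
    ∃ ξ ∈ β.carrier, S ∘L ξ = T} = δ.carrier
  span_α : cspan {T | ∃ S ∈ intertwiners π ∩ (semiMor β δ ∩ semiMor α γ),
    ∃ ξ ∈ α.carrier, S ∘L ξ = T} = γ.carrier

/-- A jointly normal morphism from `A^{β,α}_H` to `C^{δ,γ}_K`. -/
structure IsJointlyNormal (c : CBase 𝔎) (β : CModule c.Bd H) (α : CModule c.B H)
    (A : Submodule ℂ (H →L[ℂ] H)) (δ : CModule c.Bd K) (γ : CModule c.B K)
    (C : Submodule ℂ (K →L[ℂ] K)) (π : A → K →L[ℂ] K) : Prop where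
  source : IsBiAlgebra c β α A
  target : IsBiAlgebra c δ γ C
  hom : IsStarHom A C π
  span_β : cspan {T | ∃ S ∈ intertwiners π ∩ (mor β δ ∩ mor α γ),
    ∃ ξ ∈ β.carrier, S ∘L ξ = T} = δ.carrier
  span_α : cspan {T | ∃ S ∈ intertwiners π ∩ (mor β δ ∩ mor α γ),
    ∃ ξ ∈ α.carrier, S ∘L ξ = T} = γ.carrier

/-- The space `[|α⟩₁ B]`. -/
def ket1Span (c : CBase 𝔎) (α : CModule c.B H) (γ : CModule c.Bd K)
    (B : Submodule ℂ (K →L[ℂ] K)) : Submodule ℂ (K →L[ℂ] RTP c α γ) :=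
  cspan {T | ∃ ξ ∈ α.carrier, ∃ y ∈ B, ket1 c α γ ξ ∘L y = T}

/-- The space `[|γ⟩₂ A]`. -/
def ket2Span (c : CBase 𝔎) (α : CModule c.B H) (γ : CModule c.Bd K)
    (A : Submodule ℂ (H →L[ℂ] H)) : Submodule ℂ (H →L[ℂ] RTP c α γ) :=
  cspan {T | ∃ η : γ.carrier, ∃ x ∈ A, ket2 c α γ η ∘L x = T}

/-- The fiber product of `A ⊆ L(H)` and `B ⊆ L(K)` relative to `α` and `γ`. -/
def fiber (c : CBase 𝔎) (α : CModule c.B H) (γ : CModule c.Bd K)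
    (A : Submodule ℂ (H →L[ℂ] H)) (B : Submodule ℂ (K →L[ℂ] K)) :
    Submodule ℂ (RTP c α γ →L[ℂ] RTP c α γ) where
  carrier := {x | (∀ ξ ∈ α.carrier, x ∘L ket1 c α γ ξ ∈ ket1Span c α γ B ∧
      adjoint x ∘L ket1 c α γ ξ ∈ ket1Span c α γ B) ∧
    ∀ η : γ.carrier, x ∘L ket2 c α γ η ∈ ket2Span c α γ A ∧
      adjoint x ∘L ket2 c α γ η ∈ ket2Span c α γ A}
  add_mem' := by
    rintro x y ⟨hx, hx'⟩ ⟨hy, hy'⟩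
    refine ⟨fun ξ hξ => ?_, fun η => ?_⟩
    · rw [map_add, ContinuousLinearMap.add_comp, ContinuousLinearMap.add_comp]
      exact ⟨add_mem (hx ξ hξ).1 (hy ξ hξ).1, add_mem (hx ξ hξ).2 (hy ξ hξ).2⟩
    · rw [map_add, ContinuousLinearMap.add_comp, ContinuousLinearMap.add_comp]
      exact ⟨add_mem (hx' η).1 (hy' η).1, add_mem (hx' η).2 (hy' η).2⟩
  zero_mem' := by
    refine ⟨fun ξ _ => ?_, fun η => ?_⟩ <;>
    · rw [map_zero, ContinuousLinearMap.zero_comp]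
      exact ⟨zero_mem _, zero_mem _⟩
  smul_mem' := by
    rintro a x ⟨hx, hx'⟩
    refine ⟨fun ξ hξ => ?_, fun η => ?_⟩
    · rw [map_smulₛₗ, ContinuousLinearMap.smul_comp, ContinuousLinearMap.smul_comp]
      exact ⟨Submodule.smul_mem _ _ (hx ξ hξ).1, Submodule.smul_mem _ _ (hx ξ hξ).2⟩
    · rw [map_smulₛₗ, ContinuousLinearMap.smul_comp, ContinuousLinearMap.smul_comp]
      exact ⟨Submodule.smul_mem _ _ (hx' η).1, Submodule.smul_mem _ _ (hx' η).2⟩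

/-- The relation `(φ * ψ)(x) = y`: by definition, `(φ * ψ)(x)` is the unique operator `y` such
that `y R = R x` for all operators `R` of the form `(S ⊗ Id)(Id ⊗ T)` or `(Id ⊗ T)(S ⊗ Id)`,
where `S ∈ L^φ(H, L)` and `T ∈ L^ψ(K, M)`. -/
def FiberMapsTo (c : CBase 𝔎) (α : CModule c.B H) (γ : CModule c.Bd K)
    (α' : CModule c.B L) (γ' : CModule c.Bd M)
    {A : Submodule ℂ (H →L[ℂ] H)} {B : Submodule ℂ (K →L[ℂ] K)}
    (φ : A → L →L[ℂ] L) (ψ : B → M →L[ℂ] M)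
    (x : RTP c α γ →L[ℂ] RTP c α γ) (y : RTP c α' γ' →L[ℂ] RTP c α' γ') : Prop :=
  ∀ S ∈ intertwiners φ, ∀ T ∈ intertwiners ψ,
    y ∘L (ampL c α α' γ' S ∘L ampR c α γ γ' T) = (ampL c α α' γ' S ∘L ampR c α γ γ' T) ∘L x ∧
    y ∘L (ampR c α' γ γ' T ∘L ampL c α α' γ S) = (ampR c α' γ γ' T ∘L ampL c α α' γ S) ∘L x

/-- A comultiplication `Δ` on `A^{β,α}_H` is coassociative: `(Δ * Id)(Δ(x))` and
`(Id * Δ)(Δ(x))` exist and agree after identification of the threefold tensor products. -/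
def IsCoassociative (c : CBase 𝔎) (β : CModule c.Bd H) (α : CModule c.B H)
    (hβ : Acts c.Bd α β.carrier) (hα : Acts c.B β α.carrier) (A : Submodule ℂ (H →L[ℂ] H))
    (Δ : A → RTP c α β →L[ℂ] RTP c α β) : Prop :=
  ∀ x, ∃ z : RTP c (triR c α β α hα) β →L[ℂ] RTP c (triR c α β α hα) β,
    FiberMapsTo c α β (triR c α β α hα) β Δ (fun a : A => a.1) (Δ x) z ∧
    FiberMapsTo c α β α (triL c α β β hβ) (fun a : A => a.1) Δ (Δ x)
      (toOp (assocU c c α β α β hα hβ) ∘L z ∘L toOp (assocU c c α β α β hα hβ).symm)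

/-- A (semi-normal) Hopf `C*`-bimodule `(A^{β,α}_H, Δ)` over `𝔠`. -/
structure IsHopf (c : CBase 𝔎) (β : CModule c.Bd H) (α : CModule c.B H)
    (hβ : Acts c.Bd α β.carrier) (hα : Acts c.B β α.carrier) (A : Submodule ℂ (H →L[ℂ] H))
    (Δ : A → RTP c α β →L[ℂ] RTP c α β) : Prop where
  semiNormal : IsJointlySemiNormal c β α A (triL c α β β hβ) (triR c α β α hα)
    (fiber c α β A A) Δ
  coassoc : IsCoassociative c β α hβ hα A Δ

/-- A normal Hopf `C*`-bimodule `(A^{β,α}_H, Δ)` over `𝔠`. -/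
structure IsNormalHopf (c : CBase 𝔎) (β : CModule c.Bd H) (α : CModule c.B H)
    (hβ : Acts c.Bd α β.carrier) (hα : Acts c.B β α.carrier) (A : Submodule ℂ (H →L[ℂ] H))
    (Δ : A → RTP c α β →L[ℂ] RTP c α β) : Prop where
  normal : IsJointlyNormal c β α A (triL c α β β hβ) (triR c α β α hα) (fiber c α β A A) Δ
  coassoc : IsCoassociative c β α hβ hα A Δ

/-- A bounded counit for a Hopf `C*`-bimodule `(A^{β,α}_H, Δ)` over `𝔠 = (𝔎, ℭ, ℭ†)`: a jointly
semi-normal morphism `ε` from `A^{β,α}_H` to `L(𝔎)` with the modules `ℭ†`, `ℭ` such that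
`(ε * Id)(Δ(x))` and `(Id * ε)(Δ(x))` correspond to `x` under the isomorphisms
`𝔎 ⊗ H ≅ H` and `H ⊗ 𝔎 ≅ H`. -/
structure IsBoundedCounit (c : CBase 𝔎) (β : CModule c.Bd H) (α : CModule c.B H)
    (hβ : Acts c.Bd α β.carrier) (hα : Acts c.B β α.carrier) (A : Submodule ℂ (H →L[ℂ] H))
    (Δ : A → RTP c α β →L[ℂ] RTP c α β) (ε : A → 𝔎 →L[ℂ] 𝔎) : Prop where
  hopf : IsHopf c β α hβ hα A Δ
  semiNormal : IsJointlySemiNormal c β α A c.op.base c.base ⊤ ε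
  left : ∀ x, FiberMapsTo c α β c.base β ε (fun a : A => a.1) (Δ x)
    (toOp (unitR c β).symm ∘L x.1 ∘L toOp (unitR c β))
  right : ∀ x, FiberMapsTo c α β α c.op.base (fun a : A => a.1) ε (Δ x)
    (toOp (unitL c α).symm ∘L x.1 ∘L toOp (unitL c α))

end Algebras

end Unitaries

end CPMU

end

/-!
# The counit of an étale `C*`-pseudo-multiplicative unitary

Write `V` for the unitary and `⟨ξ|₂ V |φ⟩₂` (`ξ ∈ β`, `φ ∈ α`) for the slices that generate `Â_V`
(`CPMU.PMU.slice`). Since kets and bras in different legs commute, all identities between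
operators on relative tensor products are checked after applying kets or bras, and the four
relations between `V` and the modules `α ◁ α`, `β̂ ▷ β`, … say that `V` maps the closed span of one
kind of products of kets onto that of another. Combined with norm estimates for kets, for `ρ` and
for amplifications, this extends identities from generators to these spans.

**Multiplication.** Applying `⟨ξ|₂` and `|φ⟩₂` to the third leg of the pentagon equation gives a
formula for `Δ̂_V` on slices (`CPMU.PMU.delta_slice`): `Δ̂_V(⟨ξ|₂ V |φ⟩₂) |η⟩₂` depends linearly
and continuously on `Y = V |φ⟩₂ η ∈ α ▷ α`, and for `Y = |θ⟩₁ κ` the value is `|θ⟩₂ ⟨ξ|₂ V |κ⟩₂`.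
As `V (α ◁ α) = α ▷ α`, products of slices lie in `Â_V` (`CPMU.PMU.slice_comp_slice_mem`).

**The counit.** Let `η₀` be a fixed isometry. Then
`⟨ξ|₂ V |φ⟩₂ η₀ = ⟨ξ|₂ V |η₀⟩₁ φ = ⟨ξ|₂ |η₀⟩₁ φ = η₀ ξ* φ` (`CPMU.PMU.slice_comp_fix`). Hence
`ε̂(x) = η₀* x η₀` satisfies `x η₀ = η₀ ε̂(x)`, which makes it a homomorphism, and
`ε̂(⟨ξ|₂ V |φ⟩₂) = ξ* φ = ⟨ξ|₂ 1 |φ⟩₂`, which determines it. The sums that define `π̂_V` and `π̂_1`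
converge by the Cauchy–Schwarz inequality (`CPMU.norm_sum_adjoint_comp_le`). They depend only on
`ω_{ξ,η}` because `κ* π̂_V(ω) κ' = ω(⟨κ|₁ V |κ'⟩₁)` and `π̂_1(ω) = ω(Id)`.

**Regularity.** The map `T ↦ ⟨ξ|₂ V (Id ⊗ T) V* |ξ'⟩₂` carries `[⟨α|₁ V |α⟩₂]` to `Â_V*` and
`[α α*]` to `[Â_V Â_V*]`. If `V` is regular, these spaces agree, so `Â_V* = [Â_V Â_V*]` is
self-adjoint (`CPMU.PMU.IsRegular.adjoint_mem`). Then `Δ̂_V` takes values in the fiber product, and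
it is normal because the operators `V* |ξ⟩₁` intertwine the identity and `Δ̂_V`. Likewise, `ε̂` is
normal because `η₀*` intertwines the identity and `ε̂`.

**Coassociativity.** The operator `z = V₁₂* (Id ⊗ Δ̂_V(x)) V₁₂` is the value of both
`(Δ̂_V * Id)(Δ̂_V(x))` and, after reassociation, `(Id * Δ̂_V)(Δ̂_V(x))`. Indeed, the operators
`⟨ξ|₁ V` are jointly injective and carry intertwiners of `Δ̂_V` to the commutant of `Â_V`, so it
suffices that `z` and `Δ̂_V(x)` are intertwined by `⟨ξ|₁ V₁₂` and by `⟨θ|₂ V₂₃`. The former is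
immediate and the latter (`CPMU.PMU.bra1V23_comp_delta₂`) is again the pentagon equation.

**The counit property.** An intertwiner `S` of `ε̂` satisfies `S ⟨ξ|₂ V |κ⟩₂ = ξ* κ S`. The formulas
for `Δ̂_V` on slices and on their adjoints then show that `S ⊗ Id` and `Id ⊗ S`, followed by the
canonical unitaries onto `H`, intertwine `Δ̂_V(x)` and `x`
(`CPMU.PMU.unitR_comp_ampL_comp_delta`, `CPMU.PMU.IsRegular.unitL_comp_ampR_comp_delta`).
-/

noncomputable section

namespace CPMU

/-! ### Closed linear spans -/

section General
variable {E F : Type*} [NormedAddCommGroup E] [NormedSpace ℂ E]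
  [NormedAddCommGroup F] [NormedSpace ℂ F]

theorem cspan_mono {S T : Set E} (h : S ⊆ T) : cspan S ≤ cspan T :=
  cspan_le (isClosed_cspan _) fun _ hs => subset_cspan (h hs)

/-- A bounded linear map that is only defined on a closed subspace `W` maps closed linear spans of
subsets of `W` into closed subspaces as soon as it does so on generators. -/
theorem apply_mem_of_mem_cspan {W : Submodule ℂ E} (hW : IsClosed (W : Set E)) (f : W →L[ℂ] F)
    {S : Set E} (hS : S ⊆ W) {Q : Submodule ℂ F} (hQ : IsClosed (Q : Set F))
    (h : ∀ s (hs : s ∈ S), f ⟨s, hS hs⟩ ∈ Q) {x : E} (hx : x ∈ cspan S) :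
    ∃ hxW : x ∈ W, f ⟨x, hxW⟩ ∈ Q := by
  let P : Submodule ℂ E := (Q.comap (f : W →ₗ[ℂ] F)).map W.subtype
  have hP : IsClosed (P : Set E) := by
    have h1 : IsClosed ((Q.comap (f : W →ₗ[ℂ] F) : Submodule ℂ W) : Set W) :=
      hQ.preimage f.continuous
    exact hW.isClosedEmbedding_subtypeVal.isClosedMap _ h1
  have hSP : cspan S ≤ P := cspan_le hP fun s hs => ⟨⟨s, hS hs⟩, h s hs, rfl⟩
  obtain ⟨y, hy, rfl⟩ := hSP hx
  exact ⟨y.2, hy⟩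

/-- Two bounded linear maps on a closed subspace agree on the closed linear span of a subset on
which they agree. -/
theorem eq_of_mem_cspan {W : Submodule ℂ E} (hW : IsClosed (W : Set E)) (f g : W →L[ℂ] F)
    {S : Set E} (hS : S ⊆ W) (h : ∀ s (hs : s ∈ S), f ⟨s, hS hs⟩ = g ⟨s, hS hs⟩) {x : E}
    (hx : x ∈ cspan S) (hxW : x ∈ W) : f ⟨x, hxW⟩ = g ⟨x, hxW⟩ := by
  obtain ⟨_, h2⟩ := apply_mem_of_mem_cspan hW (f - g) hS (Q := ⊥) (by simp)
    (fun s hs => by simp [h s hs]) hx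
  simpa [sub_eq_zero] using h2

theorem eqOn_cspan (f g : E →L[ℂ] F) {S : Set E} (h : ∀ s ∈ S, f s = g s) {x : E}
    (hx : x ∈ cspan S) : f x = g x := by
  have := map_mem_of_mem_cspan (W := (⊥ : Submodule ℂ F)) (by simp) (f - g)
    (fun s hs => by simp [h s hs]) hx
  simpa [sub_eq_zero] using this

end General

section Rho
variable {𝔎 H K : Type*}
  [NormedAddCommGroup 𝔎] [InnerProductSpace ℂ 𝔎] [CompleteSpace 𝔎]
  [NormedAddCommGroup H] [InnerProductSpace ℂ H] [CompleteSpace H]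
  [NormedAddCommGroup K] [InnerProductSpace ℂ K] [CompleteSpace K]
  {B : NonUnitalStarSubalgebra ℂ (𝔎 →L[ℂ] 𝔎)}

/-- Operators with values in `H` are determined by their compositions with `ξ*`, `ξ ∈ α`. -/
theorem CModule.ext_adjoint_comp (α : CModule B H) {S T : K →L[ℂ] H}
    (h : ∀ ξ ∈ α.carrier, adjoint ξ ∘L S = adjoint ξ ∘L T) : S = T := by
  have := α.ext_comp (S := adjoint S) (T := adjoint T) fun ξ hξ => by
    have := congrArg adjoint (h ξ hξ)
    simpa only [ContinuousLinearMap.adjoint_comp, ContinuousLinearMap.adjoint_adjoint] using this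
  exact adjoint.injective this

/-! ### The representation `ρ` -/

namespace CModule

/-- The commutant of `B` in `L(𝔎)`, on which `ρ_α` is defined for modules over `B`. -/
def commutant (B : NonUnitalStarSubalgebra ℂ (𝔎 →L[ℂ] 𝔎)) : Submodule ℂ (𝔎 →L[ℂ] 𝔎) where
  carrier := {c | ∀ b ∈ B, b * c = c * b}
  add_mem' := fun hc hd b hb => by rw [mul_add, add_mul, hc b hb, hd b hb]
  zero_mem' := fun b _ => by rw [mul_zero, zero_mul]
  smul_mem' := fun a c hc b hb => by rw [mul_smul_comm, smul_mul_assoc, hc b hb]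

theorem adjoint_mem_commutant {c : 𝔎 →L[ℂ] 𝔎} (hc : ∀ b ∈ B, b * c = c * b) :
    ∀ b ∈ B, b * adjoint c = adjoint c * b := by
  intro b hb
  have h := congrArg star (hc (star b) (star_mem hb))
  simp only [star_mul, star_star] at h
  exact h.symm

/-- The map `c ↦ ρ_α(c)` as a bounded linear map on the commutant of `B`. -/
def rhoL (α : CModule B H) : commutant B →L[ℂ] (H →L[ℂ] H) :=
  LinearMap.mkContinuous
    { toFun := fun c => α.rho c.1
      map_add' := fun c d => by
        refine α.ext_comp fun ξ hξ => ?_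
        rw [α.rho_comp (c + d).2 hξ, ContinuousLinearMap.add_comp, α.rho_comp c.2 hξ,
          α.rho_comp d.2 hξ, ← ContinuousLinearMap.comp_add]
        rfl
      map_smul' := fun a c => by
        refine α.ext_comp fun ξ hξ => ?_
        rw [α.rho_comp (a • c).2 hξ, RingHom.id_apply, ContinuousLinearMap.smul_comp,
          α.rho_comp c.2 hξ, ← ContinuousLinearMap.comp_smul]
        rfl } 1
    (fun c => by rw [one_mul]; exact α.norm_rho_le c.2)

theorem adjoint_rho (α : CModule B H) {c : 𝔎 →L[ℂ] 𝔎} (hc : ∀ b ∈ B, b * c = c * b) :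
    adjoint (α.rho c) = α.rho (adjoint c) := by
  refine α.ext_comp fun ξ hξ => α.ext_adjoint_comp fun ξ' hξ' => ?_
  have hc' := adjoint_mem_commutant hc
  rw [α.rho_comp hc' hξ]
  have h1 : adjoint ξ' ∘L adjoint (α.rho c) = adjoint c ∘L adjoint ξ' := by
    rw [← ContinuousLinearMap.adjoint_comp, α.rho_comp hc hξ', ContinuousLinearMap.adjoint_comp]
  rw [← ContinuousLinearMap.comp_assoc, h1, ContinuousLinearMap.comp_assoc,
    ← ContinuousLinearMap.comp_assoc]
  exact (hc' _ (α.gram_mem hξ' hξ)).symm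

/-- Semi-morphisms intertwine the representations `ρ`. -/
theorem rho_comm_of_semiMor {γ : CModule B H} {δ : CModule B K} {T : H →L[ℂ] K}
    (hT : T ∈ semiMor γ δ) {c : 𝔎 →L[ℂ] 𝔎} (hc : ∀ b ∈ B, b * c = c * b) :
    δ.rho c ∘L T = T ∘L γ.rho c := by
  refine γ.ext_comp fun ξ hξ => ?_
  rw [ContinuousLinearMap.comp_assoc, ContinuousLinearMap.comp_assoc, γ.rho_comp hc hξ,
    δ.rho_comp hc (hT ξ hξ), ContinuousLinearMap.comp_assoc]

/-- The adjoint of an intertwiner of `ρ` on a self-adjoint set is again an intertwiner. -/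
theorem rho_comm_adjoint {D : NonUnitalStarSubalgebra ℂ (𝔎 →L[ℂ] 𝔎)}
    (hD : ∀ c ∈ D, ∀ b ∈ B, b * c = c * b) {γ : CModule B H} {δ : CModule B K} {T : H →L[ℂ] K}
    (hT : ∀ c ∈ D, δ.rho c ∘L T = T ∘L γ.rho c) :
    ∀ c ∈ D, γ.rho c ∘L adjoint T = adjoint T ∘L δ.rho c := by
  intro c hc
  have h := congrArg adjoint (hT (adjoint c) (star_mem (s := D) hc))
  have h1 : ∀ b ∈ B, b * adjoint c = adjoint c * b := hD _ (star_mem (s := D) hc)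
  simp only [ContinuousLinearMap.adjoint_comp] at h
  rw [δ.adjoint_rho h1, γ.adjoint_rho h1, ContinuousLinearMap.adjoint_adjoint] at h
  exact h.symm

end CModule
end Rho

/-! ### Kets and bras -/

section Kets
variable {𝔎 H K L M : Type*}
  [NormedAddCommGroup 𝔎] [InnerProductSpace ℂ 𝔎] [CompleteSpace 𝔎]
  [NormedAddCommGroup H] [InnerProductSpace ℂ H] [CompleteSpace H]
  [NormedAddCommGroup K] [InnerProductSpace ℂ K] [CompleteSpace K]
  [NormedAddCommGroup L] [InnerProductSpace ℂ L] [CompleteSpace L]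
  [NormedAddCommGroup M] [InnerProductSpace ℂ M] [CompleteSpace M]
  {C D : NonUnitalStarSubalgebra ℂ (𝔎 →L[ℂ] 𝔎)}

section
variable (b : CBase 𝔎) (α : CModule b.B H) (γ : CModule b.Bd K)

variable {b α γ} in
theorem ket2_comp_ket1 (η : γ.carrier) (ξ : α.carrier) :
    ket2 b α γ η ∘L ξ.1 = ket1 b α γ ξ.1 ∘L η.1 := by rw [ket2_comp, ket1_comp]

variable {b α γ} in
theorem ext_ket1 {S T : RTP b α γ →L[ℂ] L}
    (h : ∀ ξ : α.carrier, S ∘L ket1 b α γ ξ.1 = T ∘L ket1 b α γ ξ.1) : S = T :=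
  clm_ext_of_total (ket1_total b α γ) fun p => DFunLike.congr_fun (h p.1) p.2

variable {b α γ} in
theorem ext_ket2 {S T : RTP b α γ →L[ℂ] L}
    (h : ∀ η : γ.carrier, S ∘L ket2 b α γ η = T ∘L ket2 b α γ η) : S = T :=
  clm_ext_of_total (ket2_total b α γ) fun p => DFunLike.congr_fun (h p.1) p.2

variable {b α γ} in
theorem ext_bra1 {S T : L →L[ℂ] RTP b α γ}
    (h : ∀ ξ : α.carrier, adjoint (ket1 b α γ ξ.1) ∘L S = adjoint (ket1 b α γ ξ.1) ∘L T) :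
    S = T := by
  refine adjoint.injective (ext_ket1 fun ξ => ?_)
  have := congrArg adjoint (h ξ)
  simpa only [ContinuousLinearMap.adjoint_comp, ContinuousLinearMap.adjoint_adjoint] using this

variable {b α γ} in
theorem ext_bra2 {S T : L →L[ℂ] RTP b α γ}
    (h : ∀ η : γ.carrier, adjoint (ket2 b α γ η) ∘L S = adjoint (ket2 b α γ η) ∘L T) :
    S = T := by
  refine adjoint.injective (ext_ket2 fun ξ => ?_)
  have := congrArg adjoint (h ξ)
  simpa only [ContinuousLinearMap.adjoint_comp, ContinuousLinearMap.adjoint_adjoint] using this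

theorem norm_le_of_adjoint_comp_self {T : K →L[ℂ] L} {r : ℝ} (hr : 0 ≤ r)
    (h : ‖adjoint T ∘L T‖ ≤ r ^ 2) : ‖T‖ ≤ r := by
  rw [ContinuousLinearMap.norm_adjoint_comp_self] at h
  exact abs_le_of_sq_le_sq' (by rwa [sq]) hr |>.2

theorem norm_ket2_le (η : γ.carrier) : ‖ket2 b α γ η‖ ≤ ‖η‖ := by
  refine norm_le_of_adjoint_comp_self (norm_nonneg _) ?_
  rw [ket2_adjoint_comp]
  refine (α.norm_rho_le (commB b (γ.gram_mem η.2 η.2))).trans ?_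
  rw [ContinuousLinearMap.norm_adjoint_comp_self, sq]
  rfl

theorem norm_ket1_le (ξ : α.carrier) : ‖ket1 b α γ ξ.1‖ ≤ ‖ξ‖ := by
  refine norm_le_of_adjoint_comp_self (norm_nonneg _) ?_
  rw [ket1_adjoint_comp]
  refine (γ.norm_rho_le (commB b.op (α.gram_mem ξ.2 ξ.2))).trans ?_
  rw [ContinuousLinearMap.norm_adjoint_comp_self, sq]
  rfl

/-- The map `η ↦ |η⟩₂` as a bounded linear map on `γ`. -/
def ket2L : γ.carrier →L[ℂ] (H →L[ℂ] RTP b α γ) :=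
  LinearMap.mkContinuous
    { toFun := ket2 b α γ
      map_add' := fun η η' => by
        refine α.ext_comp fun ξ hξ => ?_
        rw [ContinuousLinearMap.add_comp, ket2_comp_ket1 _ ⟨ξ, hξ⟩, ket2_comp_ket1 _ ⟨ξ, hξ⟩,
          ket2_comp_ket1 _ ⟨ξ, hξ⟩, ← ContinuousLinearMap.comp_add]
        rfl
      map_smul' := fun a η => by
        refine α.ext_comp fun ξ hξ => ?_
        rw [RingHom.id_apply, ContinuousLinearMap.smul_comp, ket2_comp_ket1 _ ⟨ξ, hξ⟩,
          ket2_comp_ket1 _ ⟨ξ, hξ⟩, ← ContinuousLinearMap.comp_smul]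
        rfl } 1
    (fun η => by rw [one_mul]; exact norm_ket2_le b α γ η)

/-- The map `ξ ↦ |ξ⟩₁` as a bounded linear map on `α`. -/
def ket1L : α.carrier →L[ℂ] (K →L[ℂ] RTP b α γ) :=
  LinearMap.mkContinuous
    { toFun := fun ξ => ket1 b α γ ξ.1
      map_add' := fun ξ ξ' => by
        refine γ.ext_comp fun η hη => ?_
        rw [ContinuousLinearMap.add_comp, ← ket2_comp_ket1 ⟨η, hη⟩, ← ket2_comp_ket1 ⟨η, hη⟩,
          ← ket2_comp_ket1 ⟨η, hη⟩, ← ContinuousLinearMap.comp_add]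
        rfl
      map_smul' := fun a ξ => by
        refine γ.ext_comp fun η hη => ?_
        rw [RingHom.id_apply, ContinuousLinearMap.smul_comp, ← ket2_comp_ket1 ⟨η, hη⟩,
          ← ket2_comp_ket1 ⟨η, hη⟩, ← ContinuousLinearMap.comp_smul]
        rfl } 1
    (fun ξ => by rw [one_mul]; exact norm_ket1_le b α γ ξ)

variable {b α γ} in
/-- Bras and kets in different legs commute: `⟨η|₂ |ξ⟩₁ = ξ η*`. -/
theorem bra2_comp_ket1 (η : γ.carrier) (ξ : α.carrier) :
    adjoint (ket2 b α γ η) ∘L ket1 b α γ ξ.1 = ξ.1 ∘L adjoint η.1 := by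
  refine γ.ext_comp fun η' hη' => ?_
  rw [ContinuousLinearMap.comp_assoc, ← ket2_comp_ket1 ⟨η', hη'⟩, ← ContinuousLinearMap.comp_assoc,
    ket2_adjoint_comp, α.rho_comp (commB b (γ.gram_mem η.2 hη')) ξ.2]
  rfl

theorem ket2_mul_base (η : γ.carrier) {d : 𝔎 →L[ℂ] 𝔎} (hd : d ∈ b.Bd) :
    ket2 b α γ ⟨η.1 ∘L d, γ.comp_mem η.2 hd⟩ = ket2 b α γ η ∘L α.rho d := by
  refine α.ext_comp fun ξ hξ => ?_
  rw [ket2_comp_ket1 _ ⟨ξ, hξ⟩, ContinuousLinearMap.comp_assoc, α.rho_comp (commB b hd) hξ,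
    ← ContinuousLinearMap.comp_assoc, ← ContinuousLinearMap.comp_assoc, ket2_comp_ket1 η ⟨ξ, hξ⟩]

/-! ### Amplifications `S ⊗ Id` and `Id ⊗ T` -/

variable {b α γ}
variable {α' : CModule b.B L} {γ' : CModule b.Bd L} {α'' : CModule b.B M} {γ'' : CModule b.Bd M}

/-- The operators `T` that intertwine the representations `ρ` of `D`. -/
def rhoIntertwiners (D : NonUnitalStarSubalgebra ℂ (𝔎 →L[ℂ] 𝔎)) (γ : CModule C K)
    (γ' : CModule C L) : Submodule ℂ (K →L[ℂ] L) where
  carrier := {T | ∀ c ∈ D, γ'.rho c ∘L T = T ∘L γ.rho c}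
  add_mem' := fun hS hT c hc => by
    rw [ContinuousLinearMap.comp_add, ContinuousLinearMap.add_comp, hS c hc, hT c hc]
  zero_mem' := fun c _ => by rw [ContinuousLinearMap.comp_zero, ContinuousLinearMap.zero_comp]
  smul_mem' := fun a T hT c hc => by
    rw [ContinuousLinearMap.comp_smul, ContinuousLinearMap.smul_comp, hT c hc]

theorem isClosed_rhoIntertwiners (γ : CModule C K) (γ' : CModule C L) :
    IsClosed (rhoIntertwiners D γ γ' : Set (K →L[ℂ] L)) := by
  have : (rhoIntertwiners D γ γ' : Set (K →L[ℂ] L)) =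
      ⋂ c ∈ D, {T | γ'.rho c ∘L T = T ∘L γ.rho c} := by
    ext T
    simp only [Set.mem_iInter]
    rfl
  rw [this]
  refine isClosed_biInter fun c _ => isClosed_eq ?_ ?_
  · exact (ContinuousLinearMap.compL ℂ K L L (γ'.rho c)).continuous
  · exact ((ContinuousLinearMap.compL ℂ K K L).flip (γ.rho c)).continuous

theorem ampR_comp_ket1 {T : K →L[ℂ] L} (hT : T ∈ rhoIntertwiners b.B γ γ') (ξ : α.carrier) :
    ampR b α γ γ' T ∘L ket1 b α γ ξ.1 = ket1 b α γ' ξ.1 ∘L T := by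
  ext y
  exact ampR_ket1 b hT ξ y

theorem ampL_comp_ket2 {S : H →L[ℂ] L} (hS : S ∈ rhoIntertwiners b.Bd α α') (η : γ.carrier) :
    ampL b α α' γ S ∘L ket2 b α γ η = ket2 b α' γ η ∘L S := by
  ext y
  exact ampL_ket2 b hS η y

theorem rhoIntertwiners_comp {γ' : CModule C L} {γ'' : CModule C M} {γ : CModule C K}
    {S : L →L[ℂ] M} {T : K →L[ℂ] L} (hS : S ∈ rhoIntertwiners D γ' γ'')
    (hT : T ∈ rhoIntertwiners D γ γ') : S ∘L T ∈ rhoIntertwiners D γ γ'' := fun c hc => by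
  rw [← ContinuousLinearMap.comp_assoc, hS c hc, ContinuousLinearMap.comp_assoc, hT c hc,
    ContinuousLinearMap.comp_assoc]

theorem adjoint_mem_rhoIntertwiners (hD : ∀ c ∈ D, ∀ b ∈ C, b * c = c * b)
    {γ : CModule C K} {γ' : CModule C L} {T : K →L[ℂ] L}
    (hT : T ∈ rhoIntertwiners D γ γ') : adjoint T ∈ rhoIntertwiners D γ' γ :=
  CModule.rho_comm_adjoint hD hT

theorem semiMor_le_rhoIntertwiners (hD : ∀ c ∈ D, ∀ b ∈ C, b * c = c * b)
    {γ : CModule C K} {γ' : CModule C L} {T : K →L[ℂ] L} (hT : T ∈ semiMor γ γ') :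
    T ∈ rhoIntertwiners D γ γ' := fun c hc => CModule.rho_comm_of_semiMor hT (hD c hc)

theorem ampR_comp {S : L →L[ℂ] M} {T : K →L[ℂ] L} (hS : S ∈ rhoIntertwiners b.B γ' γ'')
    (hT : T ∈ rhoIntertwiners b.B γ γ') :
    ampR b α γ γ'' (S ∘L T) = ampR b α γ' γ'' S ∘L ampR b α γ γ' T := by
  refine ext_ket1 fun ξ => ?_
  rw [ampR_comp_ket1 (rhoIntertwiners_comp hS hT), ContinuousLinearMap.comp_assoc,
    ampR_comp_ket1 hT, ← ContinuousLinearMap.comp_assoc, ← ContinuousLinearMap.comp_assoc,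
    ampR_comp_ket1 hS]

theorem ampL_comp {S : L →L[ℂ] M} {T : H →L[ℂ] L} (hS : S ∈ rhoIntertwiners b.Bd α' α'')
    (hT : T ∈ rhoIntertwiners b.Bd α α') :
    ampL b α α'' γ (S ∘L T) = ampL b α' α'' γ S ∘L ampL b α α' γ T := by
  refine ext_ket2 fun ξ => ?_
  rw [ampL_comp_ket2 (rhoIntertwiners_comp hS hT), ContinuousLinearMap.comp_assoc,
    ampL_comp_ket2 hT, ← ContinuousLinearMap.comp_assoc, ← ContinuousLinearMap.comp_assoc,
    ampL_comp_ket2 hS]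

theorem bra1_comp_ampR {T : K →L[ℂ] L} (hT : T ∈ rhoIntertwiners b.B γ γ') (ξ : α.carrier) :
    adjoint (ket1 b α γ' ξ.1) ∘L ampR b α γ γ' T = T ∘L adjoint (ket1 b α γ ξ.1) := by
  refine ext_ket1 fun ξ' => ?_
  rw [ContinuousLinearMap.comp_assoc, ampR_comp_ket1 hT, ContinuousLinearMap.comp_assoc,
    ← ContinuousLinearMap.comp_assoc, ket1_adjoint_comp, ket1_adjoint_comp,
    hT _ (α.gram_mem ξ.2 ξ'.2)]

theorem bra2_comp_ampL {S : H →L[ℂ] L} (hS : S ∈ rhoIntertwiners b.Bd α α') (η : γ.carrier) :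
    adjoint (ket2 b α' γ η) ∘L ampL b α α' γ S = S ∘L adjoint (ket2 b α γ η) := by
  refine ext_ket2 fun ξ' => ?_
  rw [ContinuousLinearMap.comp_assoc, ampL_comp_ket2 hS, ContinuousLinearMap.comp_assoc,
    ← ContinuousLinearMap.comp_assoc, ket2_adjoint_comp, ket2_adjoint_comp,
    hS _ (γ.gram_mem η.2 ξ'.2)]

theorem adjoint_ampR {T : K →L[ℂ] L} (hT : T ∈ rhoIntertwiners b.B γ γ') :
    adjoint (ampR b α γ γ' T) = ampR b α γ' γ (adjoint T) := by
  have hT' := adjoint_mem_rhoIntertwiners (fun _ hc => commB b.op hc) hT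
  refine ext_ket1 fun ξ => ?_
  rw [ampR_comp_ket1 hT']
  have := congrArg adjoint (bra1_comp_ampR hT ξ)
  simpa only [ContinuousLinearMap.adjoint_comp, ContinuousLinearMap.adjoint_adjoint] using this

theorem adjoint_ampL {S : H →L[ℂ] L} (hS : S ∈ rhoIntertwiners b.Bd α α') :
    adjoint (ampL b α α' γ S) = ampL b α' α γ (adjoint S) := by
  have hS' := adjoint_mem_rhoIntertwiners (fun _ hc => commB b hc) hS
  refine ext_ket2 fun ξ => ?_
  rw [ampL_comp_ket2 hS']
  have := congrArg adjoint (bra2_comp_ampL hS ξ)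
  simpa only [ContinuousLinearMap.adjoint_comp, ContinuousLinearMap.adjoint_adjoint] using this

/-- The bound `‖Id ⊗ T‖ ≤ ‖T‖` makes `T ↦ Id ⊗ T` continuous, which allows to check identities for
`Δ̂_V` on generators of `Â_V`. -/
theorem norm_ampR_le {T : K →L[ℂ] L} (hT : T ∈ rhoIntertwiners b.B γ γ') :
    ‖ampR b α γ γ' T‖ ≤ ‖T‖ := by
  obtain ⟨U, hU, hn⟩ := exists_twist (fun ξ : α.carrier => ket1 b α γ ξ.1)
    (fun ξ => ket1 b α γ' ξ.1) T
    (ket1_total b α γ) (fun i j => by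
      rw [← ContinuousLinearMap.comp_assoc, ket1_adjoint_comp, ket1_adjoint_comp]
      exact hT _ (α.gram_mem i.2 j.2))
  have : ampR b α γ γ' T = U := ext_ket1 fun ξ => by
    rw [ampR_comp_ket1 hT]
    ext y
    exact (hU (ξ, y)).symm
  rw [this]
  exact ContinuousLinearMap.opNorm_le_bound _ (norm_nonneg _) hn

variable (b α γ γ') in
/-- The map `T ↦ Id ⊗ T` as a bounded linear map. -/
def ampRL : rhoIntertwiners b.B γ γ' →L[ℂ] (RTP b α γ →L[ℂ] RTP b α γ') :=
  LinearMap.mkContinuous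
    { toFun := fun T => ampR b α γ γ' T.1
      map_add' := fun S T => by
        refine ext_ket1 fun ξ => ?_
        rw [ContinuousLinearMap.add_comp, ampR_comp_ket1 (S + T).2, ampR_comp_ket1 S.2,
          ampR_comp_ket1 T.2, ← ContinuousLinearMap.comp_add]
        rfl
      map_smul' := fun a T => by
        refine ext_ket1 fun ξ => ?_
        rw [RingHom.id_apply, ContinuousLinearMap.smul_comp, ampR_comp_ket1 (a • T).2,
          ampR_comp_ket1 T.2, ← ContinuousLinearMap.comp_smul]
        rfl } 1
    (fun T => by rw [one_mul]; exact norm_ampR_le T.2)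

/-- `(Id ⊗ T) |η⟩₂ = |T η⟩₂` as soon as `T η` belongs to the module again. -/
theorem ampR_comp_ket2 {T : K →L[ℂ] L} (hT : T ∈ rhoIntertwiners b.B γ γ') (η : γ.carrier)
    (hη : T ∘L η.1 ∈ γ'.carrier) :
    ampR b α γ γ' T ∘L ket2 b α γ η = ket2 b α γ' ⟨T ∘L η.1, hη⟩ := by
  refine α.ext_comp fun ξ hξ => ?_
  rw [ContinuousLinearMap.comp_assoc, ket2_comp_ket1 _ ⟨ξ, hξ⟩, ket2_comp_ket1 _ ⟨ξ, hξ⟩,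
    ← ContinuousLinearMap.comp_assoc, ampR_comp_ket1 hT, ContinuousLinearMap.comp_assoc]

/-- `(S ⊗ Id) |ξ⟩₁ = |S ξ⟩₁` as soon as `S ξ` belongs to the module again. -/
theorem ampL_comp_ket1 {S : H →L[ℂ] L} (hS : S ∈ rhoIntertwiners b.Bd α α') (ξ : α.carrier)
    (hξ : S ∘L ξ.1 ∈ α'.carrier) :
    ampL b α α' γ S ∘L ket1 b α γ ξ.1 = ket1 b α' γ (S ∘L ξ.1) := by
  refine γ.ext_comp fun η hη => ?_
  have h := ket2_comp_ket1 (b := b) (γ := γ) ⟨η, hη⟩ ⟨S ∘L ξ.1, hξ⟩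
  rw [ContinuousLinearMap.comp_assoc, ← ket2_comp_ket1 ⟨η, hη⟩, ← h,
    ← ContinuousLinearMap.comp_assoc, ampL_comp_ket2 hS, ContinuousLinearMap.comp_assoc]

/-- `(S ⊗ Id)(Id ⊗ T) = (Id ⊗ T)(S ⊗ Id)` if `S` is a semi-morphism. -/
theorem ampL_comm_ampR {S : H →L[ℂ] M} {T : K →L[ℂ] L} (hS : S ∈ semiMor α α'')
    (hT : T ∈ rhoIntertwiners b.B γ γ') :
    ampL b α α'' γ' S ∘L ampR b α γ γ' T = ampR b α'' γ γ' T ∘L ampL b α α'' γ S := by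
  have hS' := semiMor_le_rhoIntertwiners (fun _ hc => commB b hc) hS
  refine ext_ket1 fun ξ => ?_
  rw [ContinuousLinearMap.comp_assoc, ampR_comp_ket1 hT, ContinuousLinearMap.comp_assoc,
    ampL_comp_ket1 hS' ξ (hS _ ξ.2), ← ContinuousLinearMap.comp_assoc,
    ampL_comp_ket1 hS' ξ (hS _ ξ.2)]
  exact (ampR_comp_ket1 hT ⟨S ∘L ξ.1, hS _ ξ.2⟩).symm

/-- `(S ⊗ Id)(Id ⊗ T) = (Id ⊗ T)(S ⊗ Id)` if `T` is a semi-morphism. -/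
theorem ampR_comm_ampL {S : H →L[ℂ] M} {T : K →L[ℂ] L}
    (hS : S ∈ rhoIntertwiners b.Bd α α'') (hT : T ∈ semiMor γ γ') :
    ampL b α α'' γ' S ∘L ampR b α γ γ' T = ampR b α'' γ γ' T ∘L ampL b α α'' γ S := by
  have hT' := semiMor_le_rhoIntertwiners (fun _ hc => commB b.op hc) hT
  refine ext_ket2 fun η => ?_
  rw [ContinuousLinearMap.comp_assoc, ampR_comp_ket2 hT' η (hT _ η.2), ampL_comp_ket2 hS,
    ContinuousLinearMap.comp_assoc, ampL_comp_ket2 hS, ← ContinuousLinearMap.comp_assoc,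
    ampR_comp_ket2 hT' η (hT _ η.2)]

end
end Kets

/-! ### Module structures on the relative tensor product -/

section Tri
variable {𝔎 H K L M : Type*}
  [NormedAddCommGroup 𝔎] [InnerProductSpace ℂ 𝔎] [CompleteSpace 𝔎]
  [NormedAddCommGroup H] [InnerProductSpace ℂ H] [CompleteSpace H]
  [NormedAddCommGroup K] [InnerProductSpace ℂ K] [CompleteSpace K]
  [NormedAddCommGroup L] [InnerProductSpace ℂ L] [CompleteSpace L]
  [NormedAddCommGroup M] [InnerProductSpace ℂ M] [CompleteSpace M]
  {C D : NonUnitalStarSubalgebra ℂ (𝔎 →L[ℂ] 𝔎)}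

section
variable {b : CBase 𝔎} {α : CModule b.B H} {γ : CModule b.Bd K}

theorem triR_carrier (δ : CModule D K) (h : Acts b.B γ δ.carrier) :
    (triR b α γ δ h).carrier =
      cspan {T | ∃ ξ : α.carrier, ∃ d ∈ δ.carrier, ket1 b α γ ξ.1 ∘L d = T} := by
  refine congrArg cspan (Set.ext fun T => ?_)
  constructor
  · rintro ⟨_, ⟨ξ, hξ, rfl⟩, d, hd, rfl⟩
    exact ⟨⟨ξ, hξ⟩, d, hd, rfl⟩
  · rintro ⟨ξ, d, hd, rfl⟩
    exact ⟨_, ⟨ξ.1, ξ.2, rfl⟩, d, hd, rfl⟩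

theorem triL_carrier (δ : CModule D H) (h : Acts b.Bd α δ.carrier) :
    (triL b α γ δ h).carrier =
      cspan {T | ∃ η : γ.carrier, ∃ d ∈ δ.carrier, ket2 b α γ η ∘L d = T} := by
  refine congrArg cspan (Set.ext fun T => ?_)
  constructor
  · rintro ⟨_, ⟨η, rfl⟩, d, hd, rfl⟩
    exact ⟨η, d, hd, rfl⟩
  · rintro ⟨η, d, hd, rfl⟩
    exact ⟨_, ⟨η, rfl⟩, d, hd, rfl⟩

theorem ket1_comp_mem (δ : CModule D K) (h : Acts b.B γ δ.carrier) (ξ : α.carrier)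
    {d : 𝔎 →L[ℂ] K} (hd : d ∈ δ.carrier) : ket1 b α γ ξ.1 ∘L d ∈ (triR b α γ δ h).carrier := by
  rw [triR_carrier]
  exact subset_cspan ⟨ξ, d, hd, rfl⟩

theorem ket2_comp_mem (δ : CModule D H) (h : Acts b.Bd α δ.carrier) (η : γ.carrier)
    {d : 𝔎 →L[ℂ] H} (hd : d ∈ δ.carrier) : ket2 b α γ η ∘L d ∈ (triL b α γ δ h).carrier := by
  rw [triL_carrier]
  exact subset_cspan ⟨η, d, hd, rfl⟩

theorem bra1_comp_mem (δ : CModule D K) (h : Acts b.B γ δ.carrier) (ξ : α.carrier)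
    {T : 𝔎 →L[ℂ] RTP b α γ} (hT : T ∈ (triR b α γ δ h).carrier) :
    adjoint (ket1 b α γ ξ.1) ∘L T ∈ δ.carrier := by
  rw [triR_carrier] at hT
  refine comp_left_mem δ.isClosed_carrier _ ?_ hT
  rintro _ ⟨ξ', d, hd, rfl⟩
  rw [← ContinuousLinearMap.comp_assoc, ket1_adjoint_comp]
  exact h.comp_mem (α.gram_mem ξ.2 ξ'.2) hd

theorem bra2_comp_mem (δ : CModule D H) (h : Acts b.Bd α δ.carrier) (η : γ.carrier)
    {T : 𝔎 →L[ℂ] RTP b α γ} (hT : T ∈ (triL b α γ δ h).carrier) :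
    adjoint (ket2 b α γ η) ∘L T ∈ δ.carrier := by
  rw [triL_carrier] at hT
  refine comp_left_mem δ.isClosed_carrier _ ?_ hT
  rintro _ ⟨η', d, hd, rfl⟩
  rw [← ContinuousLinearMap.comp_assoc, ket2_adjoint_comp]
  exact h.comp_mem (γ.gram_mem η.2 η'.2) hd

theorem ket1_mem_mor (δ : CModule D K) (h : Acts b.B γ δ.carrier) (ξ : α.carrier) :
    ket1 b α γ ξ.1 ∈ mor δ (triR b α γ δ h) :=
  ⟨fun _ hd => ket1_comp_mem δ h ξ hd, fun _ hT => bra1_comp_mem δ h ξ hT⟩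

theorem ket2_mem_mor (δ : CModule D H) (h : Acts b.Bd α δ.carrier) (η : γ.carrier) :
    ket2 b α γ η ∈ mor δ (triL b α γ δ h) :=
  ⟨fun _ hd => ket2_comp_mem δ h η hd, fun _ hT => bra2_comp_mem δ h η hT⟩

theorem rho_triR_comp_ket1 (δ : CModule D K) (h : Acts b.B γ δ.carrier) (ξ : α.carrier)
    {c : 𝔎 →L[ℂ] 𝔎} (hc : ∀ x ∈ D, x * c = c * x) :
    (triR b α γ δ h).rho c ∘L ket1 b α γ ξ.1 = ket1 b α γ ξ.1 ∘L δ.rho c :=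
  CModule.rho_comm_of_semiMor (ket1_mem_mor δ h ξ).1 hc

theorem rho_triL_comp_ket2 (δ : CModule D H) (h : Acts b.Bd α δ.carrier) (η : γ.carrier)
    {c : 𝔎 →L[ℂ] 𝔎} (hc : ∀ x ∈ D, x * c = c * x) :
    (triL b α γ δ h).rho c ∘L ket2 b α γ η = ket2 b α γ η ∘L δ.rho c :=
  CModule.rho_comm_of_semiMor (ket2_mem_mor δ h η).1 hc

theorem bra2_comp_rho_triL (δ : CModule D H) (h : Acts b.Bd α δ.carrier) (η : γ.carrier)
    {c : 𝔎 →L[ℂ] 𝔎} (hc : ∀ x ∈ D, x * c = c * x) :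
    adjoint (ket2 b α γ η) ∘L (triL b α γ δ h).rho c = δ.rho c ∘L adjoint (ket2 b α γ η) :=
  (CModule.rho_comm_of_semiMor (ket2_mem_mor δ h η).2 hc).symm

/-- `ρ_{δ ◁ γ}(c) = ρ_δ(c) ⊗ Id`, evaluated on `|ξ⟩₁`. -/
theorem rho_triL_comp_ket1 (δ : CModule D H) (h : Acts b.Bd α δ.carrier) (ξ : α.carrier)
    {c : 𝔎 →L[ℂ] 𝔎} (hc : ∀ x ∈ D, x * c = c * x) (hξ : δ.rho c ∘L ξ.1 ∈ α.carrier) :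
    (triL b α γ δ h).rho c ∘L ket1 b α γ ξ.1 = ket1 b α γ (δ.rho c ∘L ξ.1) := by
  refine γ.ext_comp fun η hη => ?_
  have h1 := ket2_comp_ket1 (b := b) (γ := γ) ⟨η, hη⟩ ⟨δ.rho c ∘L ξ.1, hξ⟩
  rw [ContinuousLinearMap.comp_assoc, ← ket2_comp_ket1 ⟨η, hη⟩, ← h1,
    ← ContinuousLinearMap.comp_assoc, rho_triL_comp_ket2 δ h _ hc, ContinuousLinearMap.comp_assoc]

/-- `ρ_{α ▷ δ}(c) = Id ⊗ ρ_δ(c)`, evaluated on `|η⟩₂`. -/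
theorem rho_triR_comp_ket2 (δ : CModule D K) (h : Acts b.B γ δ.carrier) (η : γ.carrier)
    {c : 𝔎 →L[ℂ] 𝔎} (hc : ∀ x ∈ D, x * c = c * x) (hη : δ.rho c ∘L η.1 ∈ γ.carrier) :
    (triR b α γ δ h).rho c ∘L ket2 b α γ η = ket2 b α γ ⟨δ.rho c ∘L η.1, hη⟩ := by
  refine α.ext_comp fun ξ hξ => ?_
  rw [ContinuousLinearMap.comp_assoc, ket2_comp_ket1 _ ⟨ξ, hξ⟩, ket2_comp_ket1 _ ⟨ξ, hξ⟩,
    ← ContinuousLinearMap.comp_assoc, rho_triR_comp_ket1 δ h _ hc, ContinuousLinearMap.comp_assoc]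

/-! ### The canonical unitaries -/

section Unitary

theorem toOp_symm_comp (U : H ≃ₗᵢ[ℂ] K) : toOp U.symm ∘L toOp U = ContinuousLinearMap.id ℂ H := by
  ext x
  exact U.symm_apply_apply x

theorem toOp_comp_symm (U : H ≃ₗᵢ[ℂ] K) : toOp U ∘L toOp U.symm = ContinuousLinearMap.id ℂ K := by
  ext x
  exact U.apply_symm_apply x

theorem adjoint_toOp (U : H ≃ₗᵢ[ℂ] K) : adjoint (toOp U) = toOp U.symm := by
  ext x
  refine ext_inner_right ℂ fun y => ?_
  rw [ContinuousLinearMap.adjoint_inner_left]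
  change ⟪x, U y⟫_ℂ = ⟪U.symm x, y⟫_ℂ
  rw [← U.inner_map_map, U.apply_symm_apply]

theorem adjoint_toOp_symm (U : H ≃ₗᵢ[ℂ] K) : adjoint (toOp U.symm) = toOp U := by
  rw [← adjoint_toOp, ContinuousLinearMap.adjoint_adjoint]

theorem eq_symm_comp {U : H ≃ₗᵢ[ℂ] K} {S : L →L[ℂ] H} {T : L →L[ℂ] K} (h : toOp U ∘L S = T) :
    S = toOp U.symm ∘L T := by
  rw [← h, ← ContinuousLinearMap.comp_assoc, toOp_symm_comp, ContinuousLinearMap.id_comp]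

end Unitary

theorem flipU_comp_ket1 (ξ : α.carrier) :
    toOp (flipU b α γ) ∘L ket1 b α γ ξ.1 = ket2 b.op γ α ξ := by
  refine γ.ext_comp fun η hη => ?_
  ext ζ
  have h := (exists_flip b α γ).choose_spec ((ξ, ⟨η, hη⟩), ζ)
  have h1 := ket1_apply b α γ ξ ⟨η, hη⟩ ζ
  have h2 := ket2_apply b.op γ α ξ ⟨η, hη⟩ ζ
  exact (congrArg (flipU b α γ) h1).trans (h.trans h2.symm)

theorem flipU_comp_ket2 (η : γ.carrier) :
    toOp (flipU b α γ) ∘L ket2 b α γ η = ket1 b.op γ α η.1 := by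
  refine α.ext_comp fun ξ hξ => ?_
  ext ζ
  have h := (exists_flip b α γ).choose_spec ((⟨ξ, hξ⟩, η), ζ)
  have h1 := ket2_apply b α γ η ⟨ξ, hξ⟩ ζ
  have h2 := ket1_apply b.op γ α η ⟨ξ, hξ⟩ ζ
  exact (congrArg (flipU b α γ) h1).trans (h.trans h2.symm)

theorem unitR_comp_ket2 (η : γ.carrier) :
    toOp (unitR b γ) ∘L ket2 b b.base γ η = η.1 := by
  refine b.base.ext_comp fun a ha => ?_
  ext ζ
  have h := (exists_unitR b γ).choose_spec ((⟨a, ha⟩, η), ζ)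
  have h1 := ket2_apply b b.base γ η ⟨a, ha⟩ ζ
  exact (congrArg (unitR b γ) h1).trans h

theorem unitR_comp_ket1 (a : b.base.carrier) :
    toOp (unitR b γ) ∘L ket1 b b.base γ a.1 = γ.rho a.1 := by
  refine γ.ext_comp fun η hη => ?_
  have ha : a.1 ∈ b.B := a.2
  rw [ContinuousLinearMap.comp_assoc, ← ket2_comp_ket1 ⟨η, hη⟩, ← ContinuousLinearMap.comp_assoc,
    unitR_comp_ket2, γ.rho_comp (commB b.op ha) hη]

theorem unitL_comp_ket1 (ξ : α.carrier) :
    toOp (unitL b α) ∘L ket1 b α b.op.base ξ.1 = ξ.1 := by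
  refine b.op.base.ext_comp fun a ha => ?_
  ext ζ
  have h := (exists_unitL b α).choose_spec ((ξ, ⟨a, ha⟩), ζ)
  have h1 := ket1_apply b α b.op.base ξ ⟨a, ha⟩ ζ
  exact (congrArg (unitL b α) h1).trans h

theorem unitL_comp_ket2 (a : b.op.base.carrier) :
    toOp (unitL b α) ∘L ket2 b α b.op.base a = α.rho a.1 := by
  refine α.ext_comp fun ξ hξ => ?_
  have ha : a.1 ∈ b.Bd := a.2
  rw [ContinuousLinearMap.comp_assoc, ket2_comp_ket1 _ ⟨ξ, hξ⟩, ← ContinuousLinearMap.comp_assoc,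
    unitL_comp_ket1 ⟨ξ, hξ⟩, α.rho_comp (commB b ha) hξ]

end

section
variable {b d : CBase 𝔎}

section Assoc
variable {β : CModule b.B H} {γ : CModule b.Bd K} {ε : CModule d.B K} {φ : CModule d.Bd L}
  (h₁ : Acts b.B γ ε.carrier) (h₂ : Acts d.Bd ε γ.carrier)

theorem assocU_ket2_ket1 (η : φ.carrier) (ξ : β.carrier) :
    toOp (assocU b d β γ ε φ h₁ h₂) ∘L ket2 d (triR b β γ ε h₁) φ η ∘L ket1 b β γ ξ.1 =
      ket1 b β (triL d ε φ γ h₂) ξ.1 ∘L ket2 d ε φ η := by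
  ext x
  exact (exists_assoc b d β γ ε φ h₁ h₂).choose_spec (η, ξ, x)

theorem ket2_mem_rhoIntertwiners (η : φ.carrier) :
    ket2 d ε φ η ∈ rhoIntertwiners b.B γ (triL d ε φ γ h₂) :=
  semiMor_le_rhoIntertwiners (fun _ hc => commB b.op hc) (ket2_mem_mor γ h₂ η).1

theorem bra2_mem_rhoIntertwiners (η : φ.carrier) :
    adjoint (ket2 d ε φ η) ∈ rhoIntertwiners b.B (triL d ε φ γ h₂) γ :=
  semiMor_le_rhoIntertwiners (fun _ hc => commB b.op hc) (ket2_mem_mor γ h₂ η).2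

theorem ket1_mem_rhoIntertwiners (ξ : β.carrier) :
    ket1 b β γ ξ.1 ∈ rhoIntertwiners d.Bd ε (triR b β γ ε h₁) :=
  semiMor_le_rhoIntertwiners (fun _ hc => commB d hc) (ket1_mem_mor ε h₁ ξ).1

theorem assocU_comp_ket2 (η : φ.carrier) :
    toOp (assocU b d β γ ε φ h₁ h₂) ∘L ket2 d (triR b β γ ε h₁) φ η =
      ampR b β γ (triL d ε φ γ h₂) (ket2 d ε φ η) := by
  refine ext_ket1 fun ξ => ?_
  rw [ContinuousLinearMap.comp_assoc, assocU_ket2_ket1,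
    ampR_comp_ket1 (ket2_mem_rhoIntertwiners h₂ η)]

theorem bra2_comp_assocU_symm (η : φ.carrier) :
    adjoint (ket2 d (triR b β γ ε h₁) φ η) ∘L toOp (assocU b d β γ ε φ h₁ h₂).symm =
      ampR b β (triL d ε φ γ h₂) γ (adjoint (ket2 d ε φ η)) := by
  have := congrArg adjoint (assocU_comp_ket2 (β := β) h₁ h₂ η)
  rwa [ContinuousLinearMap.adjoint_comp, adjoint_toOp,
    adjoint_ampR (α := β) (ket2_mem_rhoIntertwiners h₂ η)] at this

theorem assocU_symm_comp_ket1 (ξ : β.carrier) :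
    toOp (assocU b d β γ ε φ h₁ h₂).symm ∘L ket1 b β (triL d ε φ γ h₂) ξ.1 =
      ampL d ε (triR b β γ ε h₁) φ (ket1 b β γ ξ.1) := by
  refine ext_ket2 fun η => ?_
  rw [ampL_comp_ket2 (ket1_mem_rhoIntertwiners h₁ ξ), ContinuousLinearMap.comp_assoc]
  exact (eq_symm_comp (assocU_ket2_ket1 h₁ h₂ η ξ)).symm

theorem bra1_comp_assocU (ξ : β.carrier) :
    adjoint (ket1 b β (triL d ε φ γ h₂) ξ.1) ∘L toOp (assocU b d β γ ε φ h₁ h₂) =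
      ampL d (triR b β γ ε h₁) ε φ (adjoint (ket1 b β γ ξ.1)) := by
  have := congrArg adjoint (assocU_symm_comp_ket1 (φ := φ) h₁ h₂ ξ)
  rwa [ContinuousLinearMap.adjoint_comp, adjoint_toOp_symm,
    adjoint_ampL (γ := φ) (ket1_mem_rhoIntertwiners h₁ ξ)] at this

/-- Reassociation turns `|φ⟩₂ |η⟩₂` into the ket of `|φ⟩₂ η ∈ γ ◁ φ`. -/
theorem assocU_comp_ket2_ket2 (η : φ.carrier) (θ : γ.carrier) :
    toOp (assocU b d β γ ε φ h₁ h₂) ∘L ket2 d (triR b β γ ε h₁) φ η ∘L ket2 b β γ θ =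
      ket2 b β (triL d ε φ γ h₂) ⟨ket2 d ε φ η ∘L θ.1, ket2_comp_mem γ h₂ η θ.2⟩ := by
  rw [← ContinuousLinearMap.comp_assoc, assocU_comp_ket2,
    ampR_comp_ket2 (ket2_mem_rhoIntertwiners h₂ η)]

/-- Reassociation turns the ket of `|ξ⟩₁ κ ∈ β ▷ ε` into `|ξ⟩₁ |κ⟩₁`. -/
theorem assocU_comp_ket1_ket1 (ξ : β.carrier) (κ : ε.carrier) :
    toOp (assocU b d β γ ε φ h₁ h₂) ∘L ket1 d (triR b β γ ε h₁) φ (ket1 b β γ ξ.1 ∘L κ.1) =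
      ket1 b β (triL d ε φ γ h₂) ξ.1 ∘L ket1 d ε φ κ.1 := by
  refine φ.ext_comp fun η hη => ?_
  have h := ket2_comp_ket1 (b := d) (γ := φ) ⟨η, hη⟩
    (⟨ket1 b β γ ξ.1 ∘L κ.1, ket1_comp_mem ε h₁ ξ κ.2⟩ : (triR b β γ ε h₁).carrier)
  rw [ContinuousLinearMap.comp_assoc, ← h]
  have h2 := congrArg (fun T => T ∘L κ.1) (assocU_ket2_ket1 h₁ h₂ ⟨η, hη⟩ ξ)
  refine Eq.trans h2 ?_
  change ket1 b β (triL d ε φ γ h₂) ξ.1 ∘L (ket2 d ε φ ⟨η, hη⟩ ∘L κ.1) = _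
  rw [ket2_comp_ket1]
  rfl

end Assoc

section Swap
variable {α : CModule b.B H} {γ : CModule b.Bd K} {δ : CModule d.B H} {φ : CModule d.Bd L}
  (h₁ : Acts b.Bd α δ.carrier) (h₂ : Acts d.Bd δ α.carrier)

theorem swapU_ket2_ket2 (η : φ.carrier) (θ : γ.carrier) :
    toOp (swapU b d α γ δ φ h₁ h₂) ∘L ket2 d (triL b α γ δ h₁) φ η ∘L ket2 b α γ θ =
      ket2 b (triL d δ φ α h₂) γ θ ∘L ket2 d δ φ η := by
  ext x
  exact (exists_swap b d α γ δ φ h₁ h₂).choose_spec (η, θ, x)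

/-- Bras commute with the permutation `Σ₂₃` of the last two legs. -/
theorem bra2_comp_swapU (θ : γ.carrier) :
    adjoint (ket2 b (triL d δ φ α h₂) γ θ) ∘L toOp (swapU b d α γ δ φ h₁ h₂) =
      ampL d (triL b α γ δ h₁) δ φ (adjoint (ket2 b α γ θ)) := by
  have hθ : adjoint (ket2 b α γ θ) ∈ rhoIntertwiners d.Bd (triL b α γ δ h₁) δ :=
    semiMor_le_rhoIntertwiners (fun _ hc => commB d hc) (ket2_mem_mor δ h₁ θ).2
  refine ext_ket2 fun η => ext_ket2 fun θ' => ?_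
  rw [ampL_comp_ket2 hθ, ContinuousLinearMap.comp_assoc, ContinuousLinearMap.comp_assoc,
    swapU_ket2_ket2, ← ContinuousLinearMap.comp_assoc, ket2_adjoint_comp,
    rho_triL_comp_ket2 α h₂ η (commB b (γ.gram_mem θ.2 θ'.2)), ContinuousLinearMap.comp_assoc,
    ket2_adjoint_comp]

end Swap
end

end Tri

section PMU
variable {𝔎 H K L M : Type*}
  [NormedAddCommGroup 𝔎] [InnerProductSpace ℂ 𝔎] [CompleteSpace 𝔎]
  [NormedAddCommGroup H] [InnerProductSpace ℂ H] [CompleteSpace H]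
  [NormedAddCommGroup K] [InnerProductSpace ℂ K] [CompleteSpace K]
  [NormedAddCommGroup L] [InnerProductSpace ℂ L] [CompleteSpace L]
  [NormedAddCommGroup M] [InnerProductSpace ℂ M] [CompleteSpace M]
  {C D : NonUnitalStarSubalgebra ℂ (𝔎 →L[ℂ] 𝔎)}

/-! ### Morphisms of modules -/

/-- Rewriting `A B = T` inside a composition that is associated to the right. -/
theorem comp_reassoc {A : L →L[ℂ] M} {B : K →L[ℂ] L} {T : K →L[ℂ] M} (h : A ∘L B = T)
    (X : H →L[ℂ] K) : A ∘L (B ∘L X) = T ∘L X := by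
  rw [← ContinuousLinearMap.comp_assoc, h]

/-- The space of adjoints of the elements of `A`. -/
def adjointSub (A : Submodule ℂ (K →L[ℂ] L)) : Submodule ℂ (L →L[ℂ] K) where
  carrier := {x | adjoint x ∈ A}
  add_mem' := fun {x y} hx hy => by
    change adjoint (x + y) ∈ A
    rw [map_add]
    exact add_mem hx hy
  zero_mem' := by
    change adjoint (0 : L →L[ℂ] K) ∈ A
    rw [map_zero]
    exact zero_mem _
  smul_mem' := fun a x hx => by
    change adjoint (a • x) ∈ A
    rw [map_smulₛₗ]
    exact Submodule.smul_mem _ _ hx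

theorem mem_adjointSub {A : Submodule ℂ (K →L[ℂ] L)} {x : L →L[ℂ] K} :
    x ∈ adjointSub A ↔ adjoint x ∈ A := Iff.rfl

theorem isClosed_adjointSub {A : Submodule ℂ (K →L[ℂ] L)} (hA : IsClosed (A : Set (K →L[ℂ] L))) :
    IsClosed (adjointSub A : Set (L →L[ℂ] K)) :=
  hA.preimage (adjoint (𝕜 := ℂ) (E := L) (F := K)).continuous

theorem toOp_mem_mor {γ : CModule C H} {δ : CModule C K} {U : H ≃ₗᵢ[ℂ] K}
    (h : opImage (toOp U) γ.carrier = δ.carrier) : toOp U ∈ mor γ δ := by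
  refine ⟨fun ξ hξ => ?_, fun η hη => ?_⟩
  · have : toOp U ∘L ξ ∈ (δ.carrier : Set (𝔎 →L[ℂ] K)) := by
      rw [← h]
      exact ⟨ξ, hξ, rfl⟩
    exact this
  · have : η ∈ opImage (toOp U) γ.carrier := by
      rw [h]
      exact hη
    obtain ⟨ξ, hξ, rfl⟩ := this
    rw [adjoint_toOp]
    change toOp U.symm ∘L (toOp U ∘L ξ) ∈ γ.carrier
    rw [comp_reassoc (toOp_symm_comp U), ContinuousLinearMap.id_comp]
    exact hξ

theorem adjoint_mem_mor {γ : CModule C H} {δ : CModule C K} {T : H →L[ℂ] K} (h : T ∈ mor γ δ) :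
    adjoint T ∈ mor δ γ :=
  ⟨h.2, by rw [ContinuousLinearMap.adjoint_adjoint]; exact h.1⟩

theorem mor_comp {γ : CModule C H} {δ : CModule C K} {ε : CModule C L} {S : K →L[ℂ] L}
    {T : H →L[ℂ] K} (hS : S ∈ mor δ ε) (hT : T ∈ mor γ δ) : S ∘L T ∈ mor γ ε := by
  refine ⟨fun ξ hξ => ?_, fun ξ hξ => ?_⟩
  · rw [ContinuousLinearMap.comp_assoc]
    exact hS.1 _ (hT.1 _ hξ)
  · rw [ContinuousLinearMap.adjoint_comp, ContinuousLinearMap.comp_assoc]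
    exact hT.2 _ (hS.2 _ hξ)

theorem flipU_mem_mor {b : CBase 𝔎} {α : CModule b.B H} {γ : CModule b.Bd K} (δ : CModule D K)
    (h : Acts b.B γ δ.carrier) :
    toOp (flipU b α γ) ∈ mor (triR b α γ δ h) (triL b.op γ α δ h) := by
  refine ⟨fun T hT => ?_, fun T hT => ?_⟩
  · rw [triR_carrier] at hT
    refine comp_left_mem (triL b.op γ α δ h).isClosed_carrier _ ?_ hT
    rintro _ ⟨ξ, d, hd, rfl⟩
    rw [comp_reassoc (flipU_comp_ket1 ξ)]
    exact ket2_comp_mem (b := b.op) δ h ξ hd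
  · rw [triL_carrier] at hT
    refine comp_left_mem (triR b α γ δ h).isClosed_carrier _ ?_ hT
    rintro _ ⟨ξ, d, hd, rfl⟩
    rw [← flipU_comp_ket1 (b := b) (γ := γ) ξ, adjoint_toOp, ContinuousLinearMap.comp_assoc,
      comp_reassoc (toOp_symm_comp _), ContinuousLinearMap.id_comp]
    exact ket1_comp_mem δ h ξ hd

namespace PMU
variable {b : CBase 𝔎} (V : PMU b H)

theorem V_mem_αα : toOp V.V ∈ mor V.srcαα V.rngαα := toOp_mem_mor V.map_αα
theorem V_mem_βhβ : toOp V.V ∈ mor V.srcββ V.rngβhβ := toOp_mem_mor V.map_βhβ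
theorem V_mem_βhβh : toOp V.V ∈ mor V.srcβhβh V.rngαβh := toOp_mem_mor V.map_βhβh
theorem V_mem_βα : toOp V.V ∈ mor V.srcβα V.rngββ := toOp_mem_mor V.map_βα

/-! ### Slices of the unitary -/

/-- The slice `⟨ξ|₂ V |φ⟩₂` of `V`, for `ξ ∈ β` and `φ ∈ α`; these slices generate `Â_V`. -/
def slice (ξ : V.β.carrier) (φ : V.α.carrier) : H →L[ℂ] H :=
  adjoint (ket2 b V.α V.β ξ) ∘L toOp V.V ∘L ket2 b.op V.βhat V.α φ

/-- The slice `⟨ξ'|₁ V |ξ⟩₂` of `V`, for `ξ, ξ' ∈ α`; these slices generate `C_V`. -/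
def crossSlice (ξ' ξ : V.α.carrier) : H →L[ℂ] H :=
  adjoint (ket1 b V.α V.β ξ'.1) ∘L toOp V.V ∘L ket2 b.op V.βhat V.α ξ

theorem slice_mem (ξ : V.β.carrier) (φ : V.α.carrier) : V.slice ξ φ ∈ V.hatA :=
  subset_cspan ⟨ξ, φ, rfl⟩

theorem isClosed_hatA : IsClosed (V.hatA : Set (H →L[ℂ] H)) := isClosed_cspan _

theorem slice_mem_mor (ξ : V.β.carrier) (φ : V.α.carrier) : V.slice ξ φ ∈ mor V.β V.β :=
  mor_comp (adjoint_mem_mor (ket2_mem_mor V.β V.α_β ξ))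
    (mor_comp V.V_mem_βα (ket2_mem_mor (b := b.op) V.β V.βhat_β φ))

theorem mor_of_mem_hatA {x : H →L[ℂ] H} (hx : x ∈ V.hatA) : x ∈ mor V.β V.β := by
  refine ⟨fun ξ hξ => ?_, fun ξ hξ => ?_⟩
  · refine comp_right_mem V.β.isClosed_carrier ξ ?_ hx
    rintro _ ⟨ξ', φ, rfl⟩
    exact (V.slice_mem_mor ξ' φ).1 ξ hξ
  · let W : Submodule ℂ (H →L[ℂ] H) := adjointSub (V.β.carrier.comap
      (((ContinuousLinearMap.compL ℂ 𝔎 H H).flip ξ : (H →L[ℂ] H) →L[ℂ] (𝔎 →L[ℂ] H)) :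
        (H →L[ℂ] H) →ₗ[ℂ] (𝔎 →L[ℂ] H)))
    have hW : IsClosed (W : Set (H →L[ℂ] H)) := isClosed_adjointSub
      (V.β.isClosed_carrier.preimage ((ContinuousLinearMap.compL ℂ 𝔎 H H).flip ξ).continuous)
    refine cspan_le hW ?_ hx
    rintro _ ⟨ξ', φ, rfl⟩
    exact (V.slice_mem_mor ξ' φ).2 ξ hξ

theorem hatA_le_rhoIntertwiners : V.hatA ≤ rhoIntertwiners b.B V.β V.β := fun _ hx =>
  semiMor_le_rhoIntertwiners (fun _ hc => commB b.op hc) (V.mor_of_mem_hatA hx).1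

/-- `ρ_β̂(c) ⟨ξ|₂ V |φ⟩₂ = ⟨ξ|₂ V |ρ_β(c) φ⟩₂`, since `V` intertwines `Id ⊗ ρ_β(c)` and
`ρ_β̂(c) ⊗ Id`. -/
theorem rho_βhat_comp_slice (ξ : V.β.carrier) (φ : V.α.carrier) {c : 𝔎 →L[ℂ] 𝔎} (hc : c ∈ b.B) :
    V.βhat.rho c ∘L V.slice ξ φ = V.slice ξ ⟨V.β.rho c ∘L φ.1, V.β_α.comp_mem hc φ.2⟩ := by
  have hc' := commB b.op hc
  unfold slice
  rw [← ContinuousLinearMap.comp_assoc, ← bra2_comp_rho_triL V.βhat V.α_βhat ξ hc',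
    ContinuousLinearMap.comp_assoc, comp_reassoc (CModule.rho_comm_of_semiMor V.V_mem_βhβ.1 hc'),
    ContinuousLinearMap.comp_assoc]
  rw [rho_triR_comp_ket2 (b := b.op) V.β V.α_β φ hc' (V.β_α.comp_mem hc φ.2)]

theorem rho_α_comp_slice (ξ : V.β.carrier) (φ : V.α.carrier) {d : 𝔎 →L[ℂ] 𝔎} (hd : d ∈ b.Bd) :
    V.α.rho d ∘L V.slice ξ φ =
      V.slice ⟨ξ.1 ∘L adjoint d, V.β.comp_mem ξ.2 (star_mem (s := b.Bd) hd)⟩ φ := by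
  have hd' : adjoint d ∈ b.Bd := star_mem (s := b.Bd) hd
  unfold slice
  rw [ket2_mul_base b V.α V.β ξ hd', ContinuousLinearMap.adjoint_comp,
    V.α.adjoint_rho (commB b hd'), ContinuousLinearMap.adjoint_adjoint,
    ContinuousLinearMap.comp_assoc]

theorem rho_βhat_comp_mem {c : 𝔎 →L[ℂ] 𝔎} (hc : c ∈ b.B) {x : H →L[ℂ] H} (hx : x ∈ V.hatA) :
    V.βhat.rho c ∘L x ∈ V.hatA := by
  refine comp_left_mem V.isClosed_hatA _ ?_ hx
  rintro _ ⟨ξ, φ, rfl⟩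
  have := V.rho_βhat_comp_slice ξ φ hc
  unfold slice at this
  rw [this]
  exact V.slice_mem _ _

theorem rho_α_comp_mem {d : 𝔎 →L[ℂ] 𝔎} (hd : d ∈ b.Bd) {x : H →L[ℂ] H} (hx : x ∈ V.hatA) :
    V.α.rho d ∘L x ∈ V.hatA := by
  refine comp_left_mem V.isClosed_hatA _ ?_ hx
  rintro _ ⟨ξ, φ, rfl⟩
  have := V.rho_α_comp_slice ξ φ hd
  unfold slice at this
  rw [this]
  exact V.slice_mem _ _

/-! ### The pentagon equation in terms of slices -/

/-- The operator `V* (Id ⊗ y) V`. -/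
def delta (y : H →L[ℂ] H) : V.Src →L[ℂ] V.Src :=
  toOp V.V.symm ∘L ampR b V.α V.β V.β y ∘L toOp V.V

theorem V_comp_delta (y : H →L[ℂ] H) :
    toOp V.V ∘L V.delta y = ampR b V.α V.β V.β y ∘L toOp V.V := by
  unfold delta
  rw [comp_reassoc (toOp_comp_symm V.V), ContinuousLinearMap.id_comp]

/-- The map `y ↦ V* (Id ⊗ y) V` as a bounded linear map on the commutant of `ρ_β(𝔅)`. -/
def deltaL : rhoIntertwiners b.B V.β V.β →L[ℂ] (V.Src →L[ℂ] V.Src) :=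
  (ContinuousLinearMap.compL ℂ V.Src V.Rng V.Src (toOp V.V.symm)) ∘L
    ((ContinuousLinearMap.compL ℂ V.Src V.Rng V.Rng).flip (toOp V.V)) ∘L ampRL b V.α V.β V.β

theorem deltaL_apply (y : rhoIntertwiners b.B V.β V.β) : V.deltaL y = V.delta y.1 := rfl

/-- The permutation of `(H ⊗ H) ⊗ H` that moves the last leg to the middle; it maps `|θ⟩₂ |η⟩₂`
to the ket of `|θ⟩₁ η`, and the ket of `|κ⟩₁ ξ` to `|κ⟩₁ |ξ⟩₂`. -/
def lastToMiddle : RTP b.op V.srcββ V.α →L[ℂ] RTP b.op V.βhat V.rngαα :=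
  ampR b.op V.βhat V.flipαα V.rngαα (toOp (flipU b V.α V.β).symm) ∘L
    toOp (assocU b.op b.op V.βhat V.α V.β V.α V.α_β V.β_α)

theorem flip_mem : toOp (flipU b V.α V.β) ∈ mor V.rngαα V.flipαα := flipU_mem_mor V.α V.β_α

theorem flip_symm_mem : toOp (flipU b V.α V.β).symm ∈ mor V.flipαα V.rngαα := by
  rw [← adjoint_toOp]
  exact adjoint_mem_mor V.flip_mem

theorem adjoint_lastToMiddle : adjoint V.lastToMiddle =
    toOp (assocU b.op b.op V.βhat V.α V.β V.α V.α_β V.β_α).symm ∘L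
      ampR b.op V.βhat V.rngαα V.flipαα (toOp (flipU b V.α V.β)) := by
  unfold lastToMiddle
  rw [ContinuousLinearMap.adjoint_comp, adjoint_toOp, adjoint_ampR (b := b.op)
    (semiMor_le_rhoIntertwiners (fun _ hc => commB b hc) V.flip_symm_mem.1), adjoint_toOp_symm]

/-- `⟨ξ|₃ V₁₃`, regarded as an operator on `H ⊗ (H ⊗ H)`. -/
def braV13 (ξ : V.β.carrier) : RTP b.op V.βhat V.rngαα →L[ℂ] V.Src :=
  ampL b.op V.srcββ V.βhat V.α (adjoint (ket2 b V.α V.β ξ) ∘L toOp V.V) ∘L adjoint V.lastToMiddle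

theorem bra2V_mem (ξ : V.β.carrier) :
    adjoint (ket2 b V.α V.β ξ) ∘L toOp V.V ∈ mor V.srcββ V.βhat :=
  mor_comp (adjoint_mem_mor (ket2_mem_mor V.βhat V.α_βhat ξ)) V.V_mem_βhβ

theorem bra2V_intertwines (ξ : V.β.carrier) :
    adjoint (ket2 b V.α V.β ξ) ∘L toOp V.V ∈ rhoIntertwiners b.op.Bd V.srcββ V.βhat :=
  semiMor_le_rhoIntertwiners (fun _ hc => commB b.op hc) (V.bra2V_mem ξ).1

/-- `⟨ξ|₃ V₁₃` sends the ket of `|θ⟩₁ κ ∈ α ▷ α` to `|θ⟩₂ ⟨ξ|₂ V |κ⟩₂`, as it does not affect the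
leg in which `θ` stands. -/
theorem braV13_comp_ket2 (ξ : V.β.carrier) (θ κ : V.α.carrier) :
    V.braV13 ξ ∘L ket2 b.op V.βhat V.rngαα
        ⟨ket1 b V.α V.β θ.1 ∘L κ.1, ket1_comp_mem V.α V.β_α θ κ.2⟩ =
      ket2 b.op V.βhat V.α θ ∘L V.slice ξ κ := by
  have hf := semiMor_le_rhoIntertwiners (fun _ hc => commB b hc) V.flip_mem.1
  have h1 : ampR b.op V.βhat V.rngαα V.flipαα (toOp (flipU b V.α V.β)) ∘L
      ket2 b.op V.βhat V.rngαα ⟨ket1 b V.α V.β θ.1 ∘L κ.1, ket1_comp_mem V.α V.β_α θ κ.2⟩ =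
      ket2 b.op V.βhat V.flipαα
        ⟨ket2 b.op V.β V.α θ ∘L κ.1, ket2_comp_mem (b := b.op) V.α V.β_α θ κ.2⟩ := by
    rw [ampR_comp_ket2 (b := b.op) hf _ (V.flip_mem.1 _ (ket1_comp_mem V.α V.β_α θ κ.2))]
    congr 2
    exact comp_reassoc (flipU_comp_ket1 θ) κ.1
  have h2 := eq_symm_comp
    (assocU_comp_ket2_ket2 (b := b.op) (d := b.op) (β := V.βhat) V.α_β V.β_α θ κ)
  unfold braV13 slice
  rw [adjoint_lastToMiddle, ContinuousLinearMap.comp_assoc, ContinuousLinearMap.comp_assoc, h1,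
    ← h2, ← ContinuousLinearMap.comp_assoc, ampL_comp_ket2 (b := b.op) (V.bra2V_intertwines ξ),
    ContinuousLinearMap.comp_assoc, ContinuousLinearMap.comp_assoc]

theorem lastToMiddle_comp_ket1 (κ : V.βhat.carrier) (ξ : V.β.carrier) :
    V.lastToMiddle ∘L ket1 b.op V.srcββ V.α (ket1 b.op V.βhat V.α κ.1 ∘L ξ.1) =
      ket1 b.op V.βhat V.rngαα κ.1 ∘L ket2 b V.α V.β ξ := by
  have hf := semiMor_le_rhoIntertwiners (fun _ hc => commB b hc) V.flip_symm_mem.1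
  have h1 := assocU_comp_ket1_ket1 (b := b.op) (d := b.op) (φ := V.α) V.α_β V.β_α κ ξ
  unfold lastToMiddle
  rw [ContinuousLinearMap.comp_assoc, h1, ← ContinuousLinearMap.comp_assoc,
    ampR_comp_ket1 (b := b.op) hf, ContinuousLinearMap.comp_assoc]
  congr 1
  exact (eq_symm_comp (flipU_comp_ket2 ξ)).symm

/-- `V₁₃* |ξ⟩₃ |κ⟩₁` is the ket of `V* |ξ⟩₂ κ ∈ β̂ ▷ β` in the first two legs, up to the
permutation. -/
theorem adjoint_braV13_comp_ket1 (ξ : V.β.carrier) (κ : V.βhat.carrier) :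
    adjoint (V.braV13 ξ) ∘L ket1 b.op V.βhat V.α κ.1 =
      V.lastToMiddle ∘L ket1 b.op V.srcββ V.α (toOp V.V.symm ∘L ket2 b V.α V.β ξ ∘L κ.1) := by
  have h1 := adjoint_mem_rhoIntertwiners (fun _ hc => commB b.op hc) (V.bra2V_intertwines ξ)
  have h2 : adjoint (adjoint (ket2 b V.α V.β ξ) ∘L toOp V.V) =
      toOp V.V.symm ∘L ket2 b V.α V.β ξ := by
    rw [ContinuousLinearMap.adjoint_comp, ContinuousLinearMap.adjoint_adjoint, adjoint_toOp]
  unfold braV13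
  rw [ContinuousLinearMap.adjoint_comp, ContinuousLinearMap.adjoint_adjoint,
    adjoint_ampL (b := b.op) (V.bra2V_intertwines ξ), ContinuousLinearMap.comp_assoc,
    ampL_comp_ket1 (b := b.op) h1 κ ((V.bra2V_mem ξ).2 _ κ.2), h2, ContinuousLinearMap.comp_assoc]

theorem Vket2_intertwines (φ : V.α.carrier) :
    toOp V.V ∘L ket2 b.op V.βhat V.α φ ∈ rhoIntertwiners b.op.B V.α V.rngαα :=
  semiMor_le_rhoIntertwiners (fun _ hc => commB b hc)
    (mor_comp V.V_mem_αα (ket2_mem_mor (b := b.op) V.α V.βhat_α φ)).1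

end PMU
end PMU

section PMU
variable {𝔎 H : Type*}
  [NormedAddCommGroup 𝔎] [InnerProductSpace ℂ 𝔎] [CompleteSpace 𝔎]
  [NormedAddCommGroup H] [InnerProductSpace ℂ H] [CompleteSpace H]

/-- The bookkeeping for the left-hand side of the pentagon equation: `k` is moved through `l` and
`a`, and `k'` is absorbed by `a'`. -/
theorem comp_eq_left {X₁ X₂ X₃ X₄ X₅ X₆ X₇ X₈ : Type*}
    [NormedAddCommGroup X₁] [NormedSpace ℂ X₁] [NormedAddCommGroup X₂] [NormedSpace ℂ X₂]
    [NormedAddCommGroup X₃] [NormedSpace ℂ X₃] [NormedAddCommGroup X₄] [NormedSpace ℂ X₄]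
    [NormedAddCommGroup X₅] [NormedSpace ℂ X₅] [NormedAddCommGroup X₆] [NormedSpace ℂ X₆]
    [NormedAddCommGroup X₇] [NormedSpace ℂ X₇] [NormedAddCommGroup X₈] [NormedSpace ℂ X₈]
    {k : X₁ →L[ℂ] X₂} {l : X₂ →L[ℂ] X₃} {a : X₃ →L[ℂ] X₄} {r : X₄ →L[ℂ] X₅} {a' : X₅ →L[ℂ] X₆}
    {k' : X₆ →L[ℂ] X₇} {v : X₁ →L[ℂ] X₈} {k₁ : X₈ →L[ℂ] X₃} {k₂ : X₈ →L[ℂ] X₄}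
    {k₃ : X₅ →L[ℂ] X₇} {s : X₈ →L[ℂ] X₇} (h₁ : l ∘L k = k₁ ∘L v) (h₂ : a ∘L k₁ = k₂)
    (h₃ : k' ∘L a' = k₃) (h₄ : k₃ ∘L r ∘L k₂ = s) :
    k' ∘L (a' ∘L r ∘L a ∘L l) ∘L k = s ∘L v := by
  subst h₂ h₃ h₄
  ext x
  have := DFunLike.congr_fun h₁ x
  simp only [ContinuousLinearMap.comp_apply] at this ⊢
  rw [this]

/-- The bookkeeping for the right-hand side of the pentagon equation: `k` is moved through `a` and
`r`, and `k'` through `l'`, `w` and `l`. -/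
theorem comp_eq_right {X₁ X₂ X₃ X₄ X₅ X₆ X₇ X₈ X₉ X₁₀ X₁₁ : Type*}
    [NormedAddCommGroup X₁] [NormedSpace ℂ X₁] [NormedAddCommGroup X₂] [NormedSpace ℂ X₂]
    [NormedAddCommGroup X₃] [NormedSpace ℂ X₃] [NormedAddCommGroup X₄] [NormedSpace ℂ X₄]
    [NormedAddCommGroup X₅] [NormedSpace ℂ X₅] [NormedAddCommGroup X₆] [NormedSpace ℂ X₆]
    [NormedAddCommGroup X₇] [NormedSpace ℂ X₇] [NormedAddCommGroup X₈] [NormedSpace ℂ X₈]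
    [NormedAddCommGroup X₉] [NormedSpace ℂ X₉] [NormedAddCommGroup X₁₀] [NormedSpace ℂ X₁₀]
    [NormedAddCommGroup X₁₁] [NormedSpace ℂ X₁₁]
    {k : X₁ →L[ℂ] X₂} {a : X₂ →L[ℂ] X₃} {r : X₃ →L[ℂ] X₄} {f : X₄ →L[ℂ] X₅} {a' : X₅ →L[ℂ] X₆}
    {l : X₆ →L[ℂ] X₇} {w : X₇ →L[ℂ] X₈} {l' : X₈ →L[ℂ] X₉} {k' : X₉ →L[ℂ] X₁₁}
    {m : X₁ →L[ℂ] X₃} {m' : X₁ →L[ℂ] X₄} {v : X₁₀ →L[ℂ] X₁₁} {k₁ : X₈ →L[ℂ] X₁₀}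
    {n : X₇ →L[ℂ] X₁₀} {n' : X₆ →L[ℂ] X₁₀} {g : X₄ →L[ℂ] X₆}
    (h₁ : a ∘L k = m) (h₂ : r ∘L m = m') (h₃ : k' ∘L l' = v ∘L k₁) (h₄ : k₁ ∘L w = n)
    (h₅ : n ∘L l = n') (h₆ : a' ∘L f = g) :
    k' ∘L (l' ∘L w ∘L l ∘L a' ∘L f ∘L r ∘L a) ∘L k = v ∘L (n' ∘L g) ∘L m' := by
  subst h₁ h₂ h₄ h₅ h₆
  ext x
  exact DFunLike.congr_fun h₃ _

namespace PMU
variable {b : CBase 𝔎} (V : PMU b H)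

/-- `⟨ξ|₃ V₂₃ V₁₂ |φ⟩₃ = (Id ⊗ ⟨ξ|₂ V |φ⟩₂) V`. -/
theorem slice_pentLeft (ξ : V.β.carrier) (φ : V.α.carrier) :
    adjoint (ket2 b V.rngαα V.β ξ) ∘L V.pentLeft V.V ∘L ket2 b.op V.srcβhβh V.α φ =
      ampR b V.α V.β V.β (V.slice ξ φ) ∘L toOp V.V := by
  have hVβα := semiMor_le_rhoIntertwiners (D := b.B) (fun _ hc => commB b.op hc) V.V_mem_βα.1
  have hVβh := semiMor_le_rhoIntertwiners (D := b.B) (fun _ hc => commB b.op hc) V.V_mem_βhβh.1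
  have hφ2 : ket2 b.op V.βhat V.α φ ∈ rhoIntertwiners b.B V.β V.srcβα :=
    ket2_mem_rhoIntertwiners (b := b) (d := b.op) V.βhat_β φ
  have hξ2 : adjoint (ket2 b V.α V.β ξ) ∈ rhoIntertwiners b.B V.rngββ V.β :=
    bra2_mem_rhoIntertwiners (b := b) (d := b) V.α_β ξ
  refine comp_eq_left (ampL_comp_ket2 (b := b.op) hVβh φ)
    (assocU_comp_ket2 (b := b) (d := b.op) (β := V.α) V.β_βhat V.βhat_β φ)
    (bra2_comp_assocU_symm (b := b) (d := b) V.β_α V.α_β ξ) ?_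
  rw [← ampR_comp hVβα hφ2, ← ampR_comp hξ2 (rhoIntertwiners_comp hVβα hφ2)]
  rfl

/-- `⟨ξ|₃ V₁₂ V₁₃ V₂₃ |φ⟩₃ = V ⟨ξ|₃ V₁₃ V₂₃ |φ⟩₃`. -/
theorem slice_pentRight (ξ : V.β.carrier) (φ : V.α.carrier) :
    adjoint (ket2 b V.rngαα V.β ξ) ∘L V.pentRight V.V ∘L ket2 b.op V.srcβhβh V.α φ =
      toOp V.V ∘L V.braV13 ξ ∘L
        ampR b.op V.βhat V.α V.rngαα (toOp V.V ∘L ket2 b.op V.βhat V.α φ) := by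
  have hVαα := semiMor_le_rhoIntertwiners (D := b.Bd) (fun _ hc => commB b hc) V.V_mem_αα.1
  have hVββ := semiMor_le_rhoIntertwiners (D := b.B) (fun _ hc => commB b.op hc) V.V_mem_βhβ.1
  have hφ3 : ket2 b.op V.βhat V.α φ ∈ rhoIntertwiners b.Bd V.α V.srcαα :=
    ket2_mem_rhoIntertwiners (b := b.op) (d := b.op) V.βhat_α φ
  have hξ3 : adjoint (ket2 b V.α V.β ξ) ∈ rhoIntertwiners b.B V.rngβhβ V.βhat :=
    semiMor_le_rhoIntertwiners (fun _ hc => commB b.op hc) (ket2_mem_mor V.βhat V.α_βhat ξ).2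
  exact comp_eq_right
    (assocU_comp_ket2 (b := b.op) (d := b.op) (β := V.βhat) V.α_βhat V.βhat_α φ)
    (ampR_comp (b := b.op) hVαα hφ3).symm
    (bra2_comp_ampL hVαα ξ)
    (bra2_comp_swapU (b := b) (d := b.op) V.α_βhat V.βhat_α ξ)
    (ampL_comp (b := b.op) hξ3 hVββ).symm V.adjoint_lastToMiddle.symm

/-- The pentagon equation, with `⟨ξ|` applied on the left and `|φ⟩` on the right in the third leg:
`V₁₂* ⟨ξ|₃ V₂₃ |φ⟩₃ V₁₂ = ⟨ξ|₃ V₁₃ V₂₃ |φ⟩₃`. -/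
theorem delta_slice (ξ : V.β.carrier) (φ : V.α.carrier) : V.delta (V.slice ξ φ) =
    V.braV13 ξ ∘L ampR b.op V.βhat V.α V.rngαα (toOp V.V ∘L ket2 b.op V.βhat V.α φ) := by
  have h : toOp V.V ∘L V.braV13 ξ ∘L
      ampR b.op V.βhat V.α V.rngαα (toOp V.V ∘L ket2 b.op V.βhat V.α φ) =
      ampR b V.α V.β V.β (V.slice ξ φ) ∘L toOp V.V := by
    rw [← V.slice_pentRight, ← V.slice_pentLeft, V.pentagon]
  exact (eq_symm_comp h).symm

end PMU
end PMU

section PMU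
variable {𝔎 H : Type*}
  [NormedAddCommGroup 𝔎] [InnerProductSpace ℂ 𝔎] [CompleteSpace 𝔎]
  [NormedAddCommGroup H] [InnerProductSpace ℂ H] [CompleteSpace H]

/-! ### Continuity arguments -/

section Continuity
variable {K L X : Type*}
  [NormedAddCommGroup K] [InnerProductSpace ℂ K] [CompleteSpace K]
  [NormedAddCommGroup L] [InnerProductSpace ℂ L] [CompleteSpace L]
  [NormedAddCommGroup X] [NormedSpace ℂ X]
  {C D : NonUnitalStarSubalgebra ℂ (𝔎 →L[ℂ] 𝔎)}

/-- The map `ξ ↦ T ξ` from `γ` to `δ` that is induced by a semi-morphism `T`. -/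
def semiMorL {γ : CModule C H} {δ : CModule C K} {T : H →L[ℂ] K} (hT : T ∈ semiMor γ δ) :
    γ.carrier →L[ℂ] δ.carrier :=
  ((ContinuousLinearMap.compL ℂ 𝔎 H K T) ∘L γ.carrier.subtypeL).codRestrict δ.carrier
    fun ξ => hT ξ.1 ξ.2

section
variable {b : CBase 𝔎} {α : CModule b.B H} {γ : CModule b.Bd K}

/-- A bounded linear map on `α ▷ δ` takes values in a closed subspace as soon as it does so on the
generators `|ξ⟩₁ d`. -/
theorem triR_clm_mem {δ : CModule D K} {h : Acts b.B γ δ.carrier}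
    (f : (triR b α γ δ h).carrier →L[ℂ] X) {Q : Submodule ℂ X} (hQ : IsClosed (Q : Set X))
    (hf : ∀ (ξ : α.carrier) (d : δ.carrier),
      f ⟨ket1 b α γ ξ.1 ∘L d.1, ket1_comp_mem δ h ξ d.2⟩ ∈ Q) (T) : f T ∈ Q := by
  have hS : {T | ∃ ξ : α.carrier, ∃ d ∈ δ.carrier, ket1 b α γ ξ.1 ∘L d = T} ⊆
      ((triR b α γ δ h).carrier : Set (𝔎 →L[ℂ] RTP b α γ)) := by
    rintro _ ⟨ξ, d, hd, rfl⟩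
    exact ket1_comp_mem δ h ξ hd
  obtain ⟨T, hT₀⟩ := T
  have hT := hT₀
  rw [triR_carrier] at hT
  obtain ⟨_, h2⟩ := apply_mem_of_mem_cspan (triR b α γ δ h).isClosed_carrier f hS hQ
    (by rintro _ ⟨ξ, d, hd, rfl⟩; exact hf ξ ⟨d, hd⟩) hT
  exact h2

theorem triR_clm_ext {δ : CModule D K} {h : Acts b.B γ δ.carrier}
    {f g : (triR b α γ δ h).carrier →L[ℂ] X}
    (hf : ∀ (ξ : α.carrier) (d : δ.carrier),
      f ⟨ket1 b α γ ξ.1 ∘L d.1, ket1_comp_mem δ h ξ d.2⟩ =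
        g ⟨ket1 b α γ ξ.1 ∘L d.1, ket1_comp_mem δ h ξ d.2⟩) : f = g := by
  ext1 T
  have := triR_clm_mem (f - g) (Q := ⊥) (by simp) (fun ξ d => by simp [hf ξ d]) T
  simpa [sub_eq_zero] using this

/-- A bounded linear map on `δ ◁ γ` takes values in a closed subspace as soon as it does so on the
generators `|η⟩₂ d`. -/
theorem triL_clm_mem {δ : CModule D H} {h : Acts b.Bd α δ.carrier}
    (f : (triL b α γ δ h).carrier →L[ℂ] X) {Q : Submodule ℂ X} (hQ : IsClosed (Q : Set X))
    (hf : ∀ (η : γ.carrier) (d : δ.carrier),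
      f ⟨ket2 b α γ η ∘L d.1, ket2_comp_mem δ h η d.2⟩ ∈ Q) (T) : f T ∈ Q := by
  have hS : {T | ∃ η : γ.carrier, ∃ d ∈ δ.carrier, ket2 b α γ η ∘L d = T} ⊆
      ((triL b α γ δ h).carrier : Set (𝔎 →L[ℂ] RTP b α γ)) := by
    rintro _ ⟨ξ, d, hd, rfl⟩
    exact ket2_comp_mem δ h ξ hd
  obtain ⟨T, hT₀⟩ := T
  have hT := hT₀
  rw [triL_carrier] at hT
  obtain ⟨_, h2⟩ := apply_mem_of_mem_cspan (triL b α γ δ h).isClosed_carrier f hS hQ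
    (by rintro _ ⟨ξ, d, hd, rfl⟩; exact hf ξ ⟨d, hd⟩) hT
  exact h2

end

end Continuity

namespace PMU
variable {b : CBase 𝔎} (V : PMU b H)

/-! ### The algebra `Â_V` -/

theorem bra2_comp_ampR_of_mem {x : H →L[ℂ] H} (hx : x ∈ V.hatA) (ξ : V.β.carrier) :
    adjoint (ket2 b V.α V.β ξ) ∘L ampR b V.α V.β V.β x =
      adjoint (ket2 b V.α V.β ⟨adjoint x ∘L ξ.1, (V.mor_of_mem_hatA hx).2 _ ξ.2⟩) := by
  have h1 := V.hatA_le_rhoIntertwiners hx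
  have h2 := adjoint_mem_rhoIntertwiners (fun _ hc => commB b.op hc) h1
  rw [← ampR_comp_ket2 h2 ξ ((V.mor_of_mem_hatA hx).2 _ ξ.2), ContinuousLinearMap.adjoint_comp,
    adjoint_ampR h2, ContinuousLinearMap.adjoint_adjoint]

theorem ampR_comp_ket2_of_mem {x : H →L[ℂ] H} (hx : x ∈ V.hatA) (ξ : V.β.carrier) :
    ampR b V.α V.β V.β x ∘L ket2 b V.α V.β ξ =
      ket2 b V.α V.β ⟨x ∘L ξ.1, (V.mor_of_mem_hatA hx).1 _ ξ.2⟩ :=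
  ampR_comp_ket2 (V.hatA_le_rhoIntertwiners hx) ξ _

/-- The map `Y ↦ ⟨ξ|₃ V₁₃ |Y⟩` on `α ▷ α`, which sends `|θ⟩₁ κ` to `|θ⟩₂ ⟨ξ|₂ V |κ⟩₂`. -/
def braV13L (ξ : V.β.carrier) : V.rngαα.carrier →L[ℂ] (H →L[ℂ] V.Src) :=
  (ContinuousLinearMap.compL ℂ H _ V.Src (V.braV13 ξ)) ∘L ket2L b.op V.βhat V.rngαα

theorem braV13L_apply (ξ : V.β.carrier) (θ κ : V.α.carrier) :
    V.braV13L ξ ⟨ket1 b V.α V.β θ.1 ∘L κ.1, ket1_comp_mem V.α V.β_α θ κ.2⟩ =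
      ket2 b.op V.βhat V.α θ ∘L V.slice ξ κ := V.braV13_comp_ket2 ξ θ κ

/-- `Δ̂_V(⟨ξ|₂ V |φ⟩₂) |η⟩₂` as a continuous function of `V |φ⟩₂ η ∈ α ▷ α`. -/
theorem delta_slice_comp_ket2 (ξ : V.β.carrier) (φ η : V.α.carrier) :
    V.delta (V.slice ξ φ) ∘L ket2 b.op V.βhat V.α η =
      V.braV13L ξ (semiMorL V.V_mem_αα.1
        ⟨ket2 b.op V.βhat V.α φ ∘L η.1, ket2_comp_mem (b := b.op) V.α V.βhat_α φ η.2⟩) := by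
  have h : (toOp V.V ∘L ket2 b.op V.βhat V.α φ) ∘L η.1 ∈ V.rngαα.carrier :=
    V.V_mem_αα.1 _ (ket2_comp_mem (b := b.op) V.α V.βhat_α φ η.2)
  rw [V.delta_slice, ContinuousLinearMap.comp_assoc,
    ampR_comp_ket2 (b := b.op) (V.Vket2_intertwines φ) η h]
  rfl

/-- `⟨ξ|₂ V Δ̂_V(x) |η⟩₂ = ⟨ξ|₂ (Id ⊗ x) V |η⟩₂ = ⟨x* ξ|₂ V |η⟩₂`. -/
theorem bra2_comp_V_comp_delta {x : H →L[ℂ] H} (hx : x ∈ V.hatA) (ξ : V.β.carrier)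
    (η : V.α.carrier) :
    adjoint (ket2 b V.α V.β ξ) ∘L toOp V.V ∘L V.delta x ∘L ket2 b.op V.βhat V.α η =
      V.slice ⟨adjoint x ∘L ξ.1, (V.mor_of_mem_hatA hx).2 _ ξ.2⟩ η := by
  rw [comp_reassoc (V.V_comp_delta x), ContinuousLinearMap.comp_assoc,
    comp_reassoc (V.bra2_comp_ampR_of_mem hx ξ)]
  rfl

/-- `Â_V` is closed under multiplication: `⟨ξ|₂ V ⟨ξ'|₃ V₁₃ |Y⟩` lies in `Â_V` for
`Y ∈ V (α ◁ α)` by the pentagon equation, and `V (α ◁ α)` contains `|θ⟩₁ κ`. -/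
theorem slice_comp_slice_mem (ξ ξ' : V.β.carrier) (θ κ : V.α.carrier) :
    V.slice ξ θ ∘L V.slice ξ' κ ∈ V.hatA := by
  have key := triL_clm_mem (b := b.op) (α := V.βhat) (γ := V.α) (δ := V.α) (h := V.βhat_α)
    ((ContinuousLinearMap.compL ℂ H V.Src H (adjoint (ket2 b V.α V.β ξ) ∘L toOp V.V)) ∘L
      V.braV13L ξ' ∘L semiMorL V.V_mem_αα.1) V.isClosed_hatA (fun φ η => by
        change (adjoint (ket2 b V.α V.β ξ) ∘L toOp V.V) ∘L V.braV13L ξ' (semiMorL V.V_mem_αα.1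
          ⟨ket2 b.op V.βhat V.α φ ∘L η.1, ket2_comp_mem (b := b.op) V.α V.βhat_α φ η.2⟩) ∈ _
        rw [← V.delta_slice_comp_ket2, ContinuousLinearMap.comp_assoc,
          V.bra2_comp_V_comp_delta (V.slice_mem ξ' φ)]
        exact V.slice_mem _ _)
  have hY := ket1_comp_mem V.α V.β_α θ κ.2
  have hZ := V.V_mem_αα.2 _ hY
  have h1 := key ⟨_, hZ⟩
  have h2 : semiMorL V.V_mem_αα.1 ⟨_, hZ⟩ = ⟨_, hY⟩ := by
    refine Subtype.ext ?_
    change toOp V.V ∘L (adjoint (toOp V.V) ∘L _) = _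
    rw [adjoint_toOp, comp_reassoc (toOp_comp_symm V.V), ContinuousLinearMap.id_comp]
  change (adjoint (ket2 b V.α V.β ξ) ∘L toOp V.V) ∘L
    V.braV13L ξ' (semiMorL V.V_mem_αα.1 ⟨_, hZ⟩) ∈ _ at h1
  rw [h2, V.braV13L_apply] at h1
  exact h1

theorem hatA_mul_mem {x y : H →L[ℂ] H} (hx : x ∈ V.hatA) (hy : y ∈ V.hatA) : x ∘L y ∈ V.hatA := by
  refine comp_right_mem V.isClosed_hatA y ?_ hx
  rintro _ ⟨ξ, θ, rfl⟩
  refine comp_left_mem V.isClosed_hatA _ ?_ hy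
  rintro _ ⟨ξ', κ, rfl⟩
  exact V.slice_comp_slice_mem ξ ξ' θ κ

/-- `[Â_V β] = β`. -/
theorem cspan_slice_comp_β :
    cspan {T | ∃ ξ φ, ∃ ξ' ∈ V.β.carrier, V.slice ξ φ ∘L ξ' = T} = V.β.carrier := by
  refine le_antisymm (cspan_le V.β.isClosed_carrier ?_) ?_
  · rintro _ ⟨ξ, φ, ξ', hξ', rfl⟩
    exact (V.slice_mem_mor ξ φ).1 _ hξ'
  · conv_lhs => rw [← V.α_β.cspan_gram (α := V.β) (fun _ hc => commB b hc)]
    refine cspan_le (isClosed_cspan _) ?_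
    rintro _ ⟨ξ, hξ, ξ', hξ', d, hd, rfl⟩
    have hY := ket2_comp_mem (b := b) V.β V.α_β ⟨ξ', hξ'⟩ hd
    have hZ := V.V_mem_βα.2 _ hY
    have h1 := comp_left_mem (k := adjoint (ket2 b V.α V.β ⟨ξ, hξ⟩) ∘L toOp V.V)
      (W := cspan {T | ∃ ξ φ, ∃ ξ' ∈ V.β.carrier, V.slice ξ φ ∘L ξ' = T}) (isClosed_cspan _)
      (S := {T | ∃ φ : V.α.carrier, ∃ d ∈ V.β.carrier, ket2 b.op V.βhat V.α φ ∘L d = T})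
      (by
        rintro _ ⟨φ, d, hd, rfl⟩
        exact subset_cspan ⟨⟨ξ, hξ⟩, φ, d, hd, rfl⟩)
      (by rw [← triL_carrier (b := b.op) V.β V.βhat_β]; exact hZ)
    rw [adjoint_toOp, ContinuousLinearMap.comp_assoc, comp_reassoc (toOp_comp_symm V.V),
      ContinuousLinearMap.id_comp, ← ContinuousLinearMap.comp_assoc, ket2_adjoint_comp] at h1
    exact h1

/-- `Â_V` is nondegenerate. -/
theorem hatA_total : cspan {v : H | ∃ x ∈ V.hatA, ∃ w, x w = v} = ⊤ := by
  rw [eq_top_iff, ← V.β.total]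
  refine cspan_le (isClosed_cspan _) ?_
  rintro _ ⟨ξ, hξ, ζ, rfl⟩
  rw [← V.cspan_slice_comp_β] at hξ
  refine map_mem_of_mem_cspan (isClosed_cspan _)
    (ContinuousLinearMap.apply ℂ H ζ) ?_ hξ
  rintro _ ⟨ξ, φ, ξ', hξ', rfl⟩
  exact subset_cspan ⟨_, V.slice_mem ξ φ, ξ' ζ, rfl⟩

theorem ext_of_comp_hatA {K : Type*} [NormedAddCommGroup K] [InnerProductSpace ℂ K]
    [CompleteSpace K] {S T : H →L[ℂ] K} (h : ∀ x ∈ V.hatA, S ∘L x = T ∘L x) : S = T := by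
  ext v
  have hv : v ∈ cspan {v : H | ∃ x ∈ V.hatA, ∃ w, x w = v} := by rw [V.hatA_total]; trivial
  refine eqOn_cspan S T ?_ hv
  rintro _ ⟨x, hx, w, rfl⟩
  exact DFunLike.congr_fun (h x hx) w

/-! ### Regular unitaries: `Â_V` is self-adjoint -/

theorem crossSlice_mem_mor (θ φ : V.α.carrier) : V.crossSlice θ φ ∈ mor V.α V.α :=
  mor_comp (adjoint_mem_mor (ket1_mem_mor V.α V.β_α θ))
    (mor_comp V.V_mem_αα (ket2_mem_mor (b := b.op) V.α V.βhat_α φ))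

theorem crossSlice_intertwines (θ φ : V.α.carrier) :
    V.crossSlice θ φ ∈ rhoIntertwiners b.op.B V.α V.α :=
  semiMor_le_rhoIntertwiners (fun _ hc => commB b hc) (V.crossSlice_mem_mor θ φ).1

/-- `⟨θ|₂ Δ̂_V(⟨ξ|₂ V |φ⟩₂) = ⟨ξ|₂ V (Id ⊗ ⟨θ|₁ V |φ⟩₂)`. Both sides, applied to `|η⟩₂`, are
continuous functions of `V |φ⟩₂ η ∈ α ▷ α`, which agree on generators `|θ'⟩₁ κ`. -/
theorem bra2_comp_delta_slice (θ φ : V.α.carrier) (ξ : V.β.carrier) :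
    adjoint (ket2 b.op V.βhat V.α θ) ∘L V.delta (V.slice ξ φ) =
      adjoint (ket2 b V.α V.β ξ) ∘L toOp V.V ∘L
        ampR b.op V.βhat V.α V.α (V.crossSlice θ φ) := by
  have key : (ContinuousLinearMap.compL ℂ H V.Src H (adjoint (ket2 b.op V.βhat V.α θ))) ∘L
      V.braV13L ξ = (ContinuousLinearMap.compL ℂ H V.Src H
        (adjoint (ket2 b V.α V.β ξ) ∘L toOp V.V)) ∘L ket2L b.op V.βhat V.α ∘L
          semiMorL (ket1_mem_mor V.α V.β_α θ).2 := by
    refine triR_clm_ext fun θ' κ => ?_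
    change adjoint (ket2 b.op V.βhat V.α θ) ∘L V.braV13L ξ
      ⟨ket1 b V.α V.β θ'.1 ∘L κ.1, ket1_comp_mem V.α V.β_α θ' κ.2⟩ =
      V.slice ξ (semiMorL (ket1_mem_mor V.α V.β_α θ).2
        ⟨ket1 b V.α V.β θ'.1 ∘L κ.1, ket1_comp_mem V.α V.β_α θ' κ.2⟩)
    rw [V.braV13L_apply, ← ContinuousLinearMap.comp_assoc, ket2_adjoint_comp (b := b.op),
      V.rho_βhat_comp_slice ξ κ (V.α.gram_mem θ.2 θ'.2)]
    congr 1
    refine Subtype.ext ?_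
    exact (comp_reassoc (ket1_adjoint_comp b V.α V.β θ θ') κ.1).symm
  refine ext_ket2 (b := b.op) fun η => ?_
  rw [ContinuousLinearMap.comp_assoc, V.delta_slice_comp_ket2]
  have h := DFunLike.congr_fun key (semiMorL V.V_mem_αα.1
        ⟨ket2 b.op V.βhat V.α φ ∘L η.1, ket2_comp_mem (b := b.op) V.α V.βhat_α φ η.2⟩)
  refine h.trans ?_
  rw [ContinuousLinearMap.comp_assoc, ContinuousLinearMap.comp_assoc,
    ampR_comp_ket2 (b := b.op) (V.crossSlice_intertwines θ φ) η
      ((V.crossSlice_mem_mor θ φ).1 _ η.2)]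
  rfl

theorem comp_adjoint_intertwines (κ κ' : V.α.carrier) :
    κ.1 ∘L adjoint κ'.1 ∈ rhoIntertwiners b.op.B V.α V.α := by
  intro d hd
  have hd' := commB b hd
  have h1 := congrArg adjoint (V.α.rho_comp (CModule.adjoint_mem_commutant hd') κ'.2)
  rw [ContinuousLinearMap.adjoint_comp, ContinuousLinearMap.adjoint_comp,
    V.α.adjoint_rho (CModule.adjoint_mem_commutant hd'),
    ContinuousLinearMap.adjoint_adjoint] at h1
  rw [← ContinuousLinearMap.comp_assoc, V.α.rho_comp hd' κ.2, ContinuousLinearMap.comp_assoc,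
    ContinuousLinearMap.comp_assoc, h1]

/-- `Id ⊗ κ κ'* = |κ⟩₂ ⟨κ'|₂`. -/
theorem ampR_comp_adjoint (κ κ' : V.α.carrier) :
    ampR b.op V.βhat V.α V.α (κ.1 ∘L adjoint κ'.1) =
      ket2 b.op V.βhat V.α κ ∘L adjoint (ket2 b.op V.βhat V.α κ') := by
  refine ext_ket1 (b := b.op) fun x => ?_
  rw [ampR_comp_ket1 (b := b.op) (V.comp_adjoint_intertwines κ κ'), ContinuousLinearMap.comp_assoc,
    bra2_comp_ket1 (b := b.op), comp_reassoc (ket2_comp_ket1 (b := b.op) κ x),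
    ContinuousLinearMap.comp_assoc]

/-- The map `T ↦ ⟨ξ|₂ V (Id ⊗ T) V* |ξ'⟩₂`, which links `C_V` and `[α α*]` to `Â_V*` and
`[Â_V Â_V*]`, respectively. -/
def conjSliceL (ξ ξ' : V.β.carrier) : rhoIntertwiners b.op.B V.α V.α →L[ℂ] (H →L[ℂ] H) :=
  (ContinuousLinearMap.compL ℂ H V.Src H (adjoint (ket2 b V.α V.β ξ) ∘L toOp V.V)) ∘L
    ((ContinuousLinearMap.compL ℂ H V.Src V.Src).flip (toOp V.V.symm ∘L ket2 b V.α V.β ξ')) ∘L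
      ampRL b.op V.βhat V.α V.α

theorem adjoint_slice (ξ : V.β.carrier) (φ : V.α.carrier) : adjoint (V.slice ξ φ) =
    adjoint (ket2 b.op V.βhat V.α φ) ∘L toOp V.V.symm ∘L ket2 b V.α V.β ξ := by
  unfold slice
  rw [ContinuousLinearMap.adjoint_comp, ContinuousLinearMap.adjoint_comp,
    ContinuousLinearMap.adjoint_adjoint, adjoint_toOp, ContinuousLinearMap.comp_assoc]

theorem delta_comp_V_symm (x : H →L[ℂ] H) :
    V.delta x ∘L toOp V.V.symm = toOp V.V.symm ∘L ampR b V.α V.β V.β x := by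
  unfold delta
  rw [ContinuousLinearMap.comp_assoc, ContinuousLinearMap.comp_assoc, toOp_comp_symm,
    ContinuousLinearMap.comp_id]

/-- `⟨ξ|₂ V (Id ⊗ ⟨θ|₁ V |φ⟩₂) V* |ξ'⟩₂ = ⟨θ|₂ Δ̂_V(x) V* |ξ'⟩₂ = ⟨θ|₂ V* |x ξ'⟩₂` for
`x = ⟨ξ|₂ V |φ⟩₂`. -/
theorem conjSliceL_crossSlice (ξ ξ' : V.β.carrier) (θ φ : V.α.carrier) :
    V.conjSliceL ξ ξ' ⟨_, V.crossSlice_intertwines θ φ⟩ =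
      adjoint (V.slice ⟨V.slice ξ φ ∘L ξ'.1, (V.slice_mem_mor ξ φ).1 _ ξ'.2⟩ θ) := by
  have h1 : V.conjSliceL ξ ξ' ⟨_, V.crossSlice_intertwines θ φ⟩ =
      (adjoint (ket2 b V.α V.β ξ) ∘L toOp V.V ∘L
        ampR b.op V.βhat V.α V.α (V.crossSlice θ φ)) ∘L toOp V.V.symm ∘L ket2 b V.α V.β ξ' := rfl
  rw [h1, ← V.bra2_comp_delta_slice, ContinuousLinearMap.comp_assoc,
    comp_reassoc (V.delta_comp_V_symm _), ContinuousLinearMap.comp_assoc,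
    V.ampR_comp_ket2_of_mem (V.slice_mem ξ φ)]
  exact (V.adjoint_slice _ _).symm

theorem conjSliceL_comp_adjoint (ξ ξ' : V.β.carrier) (κ κ' : V.α.carrier) :
    V.conjSliceL ξ ξ' ⟨_, V.comp_adjoint_intertwines κ κ'⟩ =
      V.slice ξ κ ∘L adjoint (V.slice ξ' κ') := by
  have h1 : V.conjSliceL ξ ξ' ⟨_, V.comp_adjoint_intertwines κ κ'⟩ =
      (adjoint (ket2 b V.α V.β ξ) ∘L toOp V.V) ∘L
        ampR b.op V.βhat V.α V.α (κ.1 ∘L adjoint κ'.1) ∘L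
          toOp V.V.symm ∘L ket2 b V.α V.β ξ' := rfl
  rw [h1, V.ampR_comp_adjoint, V.adjoint_slice]
  rfl

variable {V}

/-- For regular `V`, `[Â_V Â_V*] ⊆ Â_V*`. -/
theorem IsRegular.slice_comp_adjoint_mem (hr : V.IsRegular) (ξ ξ' : V.β.carrier)
    (κ κ' : V.α.carrier) : V.slice ξ κ ∘L adjoint (V.slice ξ' κ') ∈ adjointSub V.hatA := by
  have hmem : κ.1 ∘L adjoint κ'.1 ∈ V.CV := by
    rw [show V.CV = _ from hr]
    exact subset_cspan ⟨_, κ.2, _, κ'.2, rfl⟩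
  obtain ⟨_, h⟩ := apply_mem_of_mem_cspan (isClosed_rhoIntertwiners V.α V.α) (V.conjSliceL ξ ξ')
    (S := {T | ∃ θ φ, V.crossSlice θ φ = T})
    (by rintro _ ⟨θ, φ, rfl⟩; exact V.crossSlice_intertwines θ φ)
    (isClosed_adjointSub V.isClosed_hatA)
    (by
      rintro _ ⟨θ, φ, rfl⟩
      rw [V.conjSliceL_crossSlice, mem_adjointSub, ContinuousLinearMap.adjoint_adjoint]
      exact V.slice_mem _ _) hmem
  rwa [V.conjSliceL_comp_adjoint] at h

/-- For regular `V`, `Â_V* ⊆ [Â_V Â_V*]`. -/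
theorem IsRegular.adjoint_slice_mem (hr : V.IsRegular) (ξ : V.β.carrier) (θ : V.α.carrier) :
    adjoint (V.slice ξ θ) ∈
      cspan {T | ∃ ξ κ ξ' κ', V.slice ξ κ ∘L adjoint (V.slice ξ' κ') = T} := by
  have key : ∀ (ξ ξ' : V.β.carrier) (φ : V.α.carrier),
      adjoint (V.slice ⟨V.slice ξ φ ∘L ξ'.1, (V.slice_mem_mor ξ φ).1 _ ξ'.2⟩ θ) ∈
        cspan {T | ∃ ξ κ ξ' κ', V.slice ξ κ ∘L adjoint (V.slice ξ' κ') = T} := by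
    intro ξ ξ' φ
    have hmem : V.crossSlice θ φ ∈ V.CV := subset_cspan ⟨θ, φ, rfl⟩
    rw [show V.CV = _ from hr] at hmem
    obtain ⟨_, h⟩ := apply_mem_of_mem_cspan (isClosed_rhoIntertwiners V.α V.α) (V.conjSliceL ξ ξ')
      (S := {T | ∃ κ ∈ V.α.carrier, ∃ κ' ∈ V.α.carrier, κ ∘L adjoint κ' = T})
      (Q := cspan {T | ∃ ξ κ ξ' κ', V.slice ξ κ ∘L adjoint (V.slice ξ' κ') = T})
      (by rintro _ ⟨κ, hκ, κ', hκ', rfl⟩; exact V.comp_adjoint_intertwines ⟨κ, hκ⟩ ⟨κ', hκ'⟩)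
      (isClosed_cspan _)
      (by
        rintro _ ⟨κ, hκ, κ', hκ', rfl⟩
        rw [V.conjSliceL_comp_adjoint ξ ξ' ⟨κ, hκ⟩ ⟨κ', hκ'⟩]
        exact subset_cspan ⟨_, _, _, _, rfl⟩) hmem
    rwa [V.conjSliceL_crossSlice] at h
  -- `[Â_V β] = β` reduces the claim for `ξ ∈ β` to elements of the form `⟨ξ|₂ V |φ⟩₂ ξ'`.
  let F : V.β.carrier →L[ℂ] (H →L[ℂ] H) :=
    (ContinuousLinearMap.compL ℂ H V.Rng H
      (adjoint (ket2 b.op V.βhat V.α θ) ∘L toOp V.V.symm)) ∘L ket2L b V.α V.β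
  have hF : ∀ ξ, F ξ = adjoint (V.slice ξ θ) := fun ξ => by
    rw [V.adjoint_slice]
    rfl
  obtain ⟨ξ, hξ₀⟩ := ξ
  have hξ := hξ₀
  rw [← V.cspan_slice_comp_β] at hξ
  obtain ⟨_, h⟩ := apply_mem_of_mem_cspan V.β.isClosed_carrier F
    (S := {T | ∃ ξ φ, ∃ ξ' ∈ V.β.carrier, V.slice ξ φ ∘L ξ' = T})
    (Q := cspan {T | ∃ ξ κ ξ' κ', V.slice ξ κ ∘L adjoint (V.slice ξ' κ') = T})
    (by rintro _ ⟨ξ, φ, ξ', hξ', rfl⟩; exact (V.slice_mem_mor ξ φ).1 _ hξ')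
    (isClosed_cspan _)
    (by
      rintro _ ⟨ξ, φ, ξ', hξ', rfl⟩
      rw [hF]
      exact key ξ ⟨ξ', hξ'⟩ φ) hξ
  rwa [hF] at h

/-- For regular `V`, the algebra `Â_V` is self-adjoint, since `Â_V* = [Â_V Â_V*]`. -/
theorem IsRegular.adjoint_mem (hr : V.IsRegular) {x : H →L[ℂ] H} (hx : x ∈ V.hatA) :
    adjoint x ∈ V.hatA := by
  have h1 : cspan {T | ∃ ξ κ ξ' κ', V.slice ξ κ ∘L adjoint (V.slice ξ' κ') = T} ≤
      adjointSub V.hatA := by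
    refine cspan_le (isClosed_adjointSub V.isClosed_hatA) ?_
    rintro _ ⟨ξ, κ, ξ', κ', rfl⟩
    exact hr.slice_comp_adjoint_mem ξ ξ' κ κ'
  have h2 : cspan {T | ∃ ξ κ ξ' κ', V.slice ξ κ ∘L adjoint (V.slice ξ' κ') = T} ≤
      adjointSub (cspan {T | ∃ ξ κ ξ' κ', V.slice ξ κ ∘L adjoint (V.slice ξ' κ') = T}) := by
    refine cspan_le (isClosed_adjointSub (isClosed_cspan _)) ?_
    rintro _ ⟨ξ, κ, ξ', κ', rfl⟩
    rw [mem_adjointSub, ContinuousLinearMap.adjoint_comp, ContinuousLinearMap.adjoint_adjoint]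
    exact subset_cspan ⟨_, _, _, _, rfl⟩
  suffices V.hatA ≤ adjointSub V.hatA from this hx
  refine cspan_le (isClosed_adjointSub V.isClosed_hatA) ?_
  rintro _ ⟨ξ, θ, rfl⟩
  have h3 := h2 (hr.adjoint_slice_mem ξ θ)
  rw [mem_adjointSub, ContinuousLinearMap.adjoint_adjoint] at h3
  exact h1 h3

variable (V)

/-! ### The comultiplication takes values in the fiber product -/

/-- `Δ̂_V(Â_V) |α⟩₂ ⊆ [|α⟩₂ Â_V]`; for generators of `Â_V`, this follows from
`delta_slice_comp_ket2`. -/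
theorem delta_comp_ket2_mem {x : H →L[ℂ] H} (hx : x ∈ V.hatA) (η : V.α.carrier) :
    V.delta x ∘L ket2 b.op V.βhat V.α η ∈ ket2Span b.op V.βhat V.α V.hatA := by
  obtain ⟨_, h⟩ := apply_mem_of_mem_cspan (isClosed_rhoIntertwiners V.β V.β)
    (((ContinuousLinearMap.compL ℂ H V.Src V.Src).flip (ket2 b.op V.βhat V.α η)) ∘L V.deltaL)
    (S := {T | ∃ ξ φ, V.slice ξ φ = T})
    (Q := ket2Span b.op V.βhat V.α V.hatA)
    (by rintro _ ⟨ξ, φ, rfl⟩; exact V.hatA_le_rhoIntertwiners (V.slice_mem ξ φ))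
    (isClosed_cspan _)
    (by
      rintro _ ⟨ξ, φ, rfl⟩
      change V.delta (V.slice ξ φ) ∘L ket2 b.op V.βhat V.α η ∈ _
      rw [V.delta_slice_comp_ket2]
      refine triR_clm_mem (V.braV13L ξ) (Q := ket2Span b.op V.βhat V.α V.hatA)
        (isClosed_cspan _) (fun θ κ => ?_) _
      rw [V.braV13L_apply]
      exact subset_cspan ⟨θ, _, V.slice_mem _ _, rfl⟩) hx
  exact h

theorem bra2Vsymm_mem (φ : V.α.carrier) :
    adjoint (ket2 b.op V.βhat V.α φ) ∘L toOp V.V.symm ∈ mor V.rngαα V.α := by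
  rw [← adjoint_toOp]
  exact mor_comp (adjoint_mem_mor (ket2_mem_mor (b := b.op) V.α V.βhat_α φ))
    (adjoint_mem_mor V.V_mem_αα)

/-- The map `W ↦ ⟨φ|₃ V₂₃* |W⟩` on `β̂ ▷ β`, which sends `|κ⟩₁ ξ` to `|κ⟩₁ ⟨φ|₂ V* |ξ⟩₂`. -/
def braVsymmL (φ : V.α.carrier) : V.srcββ.carrier →L[ℂ] (H →L[ℂ] V.Src) :=
  (ContinuousLinearMap.compL ℂ H _ V.Src (ampR b.op V.βhat V.rngαα V.α
    (adjoint (ket2 b.op V.βhat V.α φ) ∘L toOp V.V.symm) ∘L V.lastToMiddle)) ∘L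
      ket1L b.op V.srcββ V.α

theorem braVsymmL_apply (φ : V.α.carrier) (κ : V.βhat.carrier) (ξ : V.β.carrier) :
    V.braVsymmL φ ⟨ket1 b.op V.βhat V.α κ.1 ∘L ξ.1, ket1_comp_mem (b := b.op) V.β V.α_β κ ξ.2⟩ =
      ket1 b.op V.βhat V.α κ.1 ∘L adjoint (V.slice ξ φ) := by
  change (ampR b.op V.βhat V.rngαα V.α
    (adjoint (ket2 b.op V.βhat V.α φ) ∘L toOp V.V.symm) ∘L V.lastToMiddle) ∘L
      ket1 b.op V.srcββ V.α (ket1 b.op V.βhat V.α κ.1 ∘L ξ.1) = _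
  rw [ContinuousLinearMap.comp_assoc, V.lastToMiddle_comp_ket1, ← ContinuousLinearMap.comp_assoc,
    ampR_comp_ket1 (b := b.op)
      (semiMor_le_rhoIntertwiners (fun _ hc => commB b hc) (V.bra2Vsymm_mem φ).1),
    V.adjoint_slice, ContinuousLinearMap.comp_assoc, ContinuousLinearMap.comp_assoc]

theorem Vsymm_ket2_comp_mem (ξ : V.β.carrier) (κ : V.βhat.carrier) :
    toOp V.V.symm ∘L ket2 b V.α V.β ξ ∘L κ.1 ∈ V.srcββ.carrier := by
  rw [← adjoint_toOp]
  exact V.V_mem_βhβ.2 _ (ket2_comp_mem V.βhat V.α_βhat ξ κ.2)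

theorem adjoint_delta {x : H →L[ℂ] H} (hx : x ∈ rhoIntertwiners b.B V.β V.β) :
    adjoint (V.delta x) = V.delta (adjoint x) := by
  unfold delta
  rw [ContinuousLinearMap.adjoint_comp, ContinuousLinearMap.adjoint_comp, adjoint_ampR hx,
    adjoint_toOp, adjoint_toOp_symm, ContinuousLinearMap.comp_assoc]

/-- `Δ̂_V((⟨ξ|₂ V |φ⟩₂)*) |κ⟩₁` as a continuous function of `V* |ξ⟩₂ κ ∈ β̂ ▷ β`; this is the
adjoint of `delta_slice`. -/
theorem delta_adjoint_slice_comp_ket1 (ξ : V.β.carrier) (φ : V.α.carrier) (κ : V.βhat.carrier) :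
    V.delta (adjoint (V.slice ξ φ)) ∘L ket1 b.op V.βhat V.α κ.1 =
      V.braVsymmL φ ⟨_, V.Vsymm_ket2_comp_mem ξ κ⟩ := by
  have h1 : adjoint (toOp V.V ∘L ket2 b.op V.βhat V.α φ) =
      adjoint (ket2 b.op V.βhat V.α φ) ∘L toOp V.V.symm := by
    rw [ContinuousLinearMap.adjoint_comp, adjoint_toOp]
  rw [← V.adjoint_delta (V.hatA_le_rhoIntertwiners (V.slice_mem ξ φ)), V.delta_slice,
    ContinuousLinearMap.adjoint_comp, adjoint_ampR (b := b.op) (V.Vket2_intertwines φ),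
    ContinuousLinearMap.comp_assoc, V.adjoint_braV13_comp_ket1, h1]
  rfl

variable {V}

/-- For regular `V`, the adjoints of slices also generate `Â_V`. -/
theorem IsRegular.hatA_eq_cspan_adjoint (hr : V.IsRegular) :
    V.hatA = cspan {T | ∃ ξ φ, adjoint (V.slice ξ φ) = T} := by
  refine le_antisymm ?_ (cspan_le V.isClosed_hatA ?_)
  · suffices V.hatA ≤ adjointSub (cspan {T | ∃ ξ φ, adjoint (V.slice ξ φ) = T}) from fun x hx => by
      have := this (hr.adjoint_mem hx)
      rwa [mem_adjointSub, ContinuousLinearMap.adjoint_adjoint] at this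
    refine cspan_le (isClosed_adjointSub (isClosed_cspan _)) ?_
    rintro _ ⟨ξ, φ, rfl⟩
    exact subset_cspan ⟨ξ, φ, rfl⟩
  · rintro _ ⟨ξ, φ, rfl⟩
    exact hr.adjoint_mem (V.slice_mem ξ φ)

/-- `Δ̂_V(Â_V) |β̂⟩₁ ⊆ [|β̂⟩₁ Â_V]`; for adjoints of slices, this follows from
`delta_adjoint_slice_comp_ket1`. -/
theorem IsRegular.delta_comp_ket1_mem (hr : V.IsRegular) {x : H →L[ℂ] H} (hx : x ∈ V.hatA)
    (κ : V.βhat.carrier) :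
    V.delta x ∘L ket1 b.op V.βhat V.α κ.1 ∈ ket1Span b.op V.βhat V.α V.hatA := by
  rw [hr.hatA_eq_cspan_adjoint] at hx
  obtain ⟨_, h⟩ := apply_mem_of_mem_cspan (isClosed_rhoIntertwiners V.β V.β)
    (((ContinuousLinearMap.compL ℂ H V.Src V.Src).flip (ket1 b.op V.βhat V.α κ.1)) ∘L V.deltaL)
    (S := {T | ∃ ξ φ, adjoint (V.slice ξ φ) = T})
    (Q := ket1Span b.op V.βhat V.α V.hatA)
    (by
      rintro _ ⟨ξ, φ, rfl⟩
      exact V.hatA_le_rhoIntertwiners (hr.adjoint_mem (V.slice_mem ξ φ)))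
    (isClosed_cspan _)
    (by
      rintro _ ⟨ξ, φ, rfl⟩
      change V.delta (adjoint (V.slice ξ φ)) ∘L ket1 b.op V.βhat V.α κ.1 ∈ _
      rw [V.delta_adjoint_slice_comp_ket1]
      refine triR_clm_mem (V.braVsymmL φ) (Q := ket1Span b.op V.βhat V.α V.hatA)
        (isClosed_cspan _) (fun κ ξ => ?_) _
      rw [V.braVsymmL_apply]
      exact subset_cspan ⟨κ.1, κ.2, _, hr.adjoint_mem (V.slice_mem ξ φ), rfl⟩) hx
  exact h

theorem IsRegular.delta_mem_fiber (hr : V.IsRegular) {x : H →L[ℂ] H} (hx : x ∈ V.hatA) :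
    V.delta x ∈ fiber b.op V.βhat V.α V.hatA V.hatA := by
  have hx' := hr.adjoint_mem hx
  have h := V.adjoint_delta (V.hatA_le_rhoIntertwiners hx)
  refine ⟨fun ξ hξ => ⟨hr.delta_comp_ket1_mem hx ⟨ξ, hξ⟩, ?_⟩,
    fun η => ⟨V.delta_comp_ket2_mem hx η, ?_⟩⟩
  · rw [h]
    exact hr.delta_comp_ket1_mem hx' ⟨ξ, hξ⟩
  · rw [h]
    exact V.delta_comp_ket2_mem hx' η

end PMU
end PMU

section PMU
variable {𝔎 H : Type*}
  [NormedAddCommGroup 𝔎] [InnerProductSpace ℂ 𝔎] [CompleteSpace 𝔎]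
  [NormedAddCommGroup H] [InnerProductSpace ℂ H] [CompleteSpace H]

/-! ### Fiber products -/

section Fiber
variable {c : CBase 𝔎} {β : CModule c.Bd H} {α : CModule c.B H}

theorem adjoint_rho_comp {C : NonUnitalStarSubalgebra ℂ (𝔎 →L[ℂ] 𝔎)} (γ : CModule C H)
    {d : 𝔎 →L[ℂ] 𝔎} (hd : ∀ x ∈ C, x * d = d * x) (x : H →L[ℂ] H) :
    adjoint (γ.rho d ∘L x) = adjoint x ∘L γ.rho (adjoint d) := by
  rw [ContinuousLinearMap.adjoint_comp, γ.adjoint_rho hd]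

section Span
variable {K : Type*} [NormedAddCommGroup K] [InnerProductSpace ℂ K] [CompleteSpace K]
  {γ : CModule c.Bd K} {A : Submodule ℂ (H →L[ℂ] H)} {B : Submodule ℂ (K →L[ℂ] K)}

theorem ket1Span_comp_mem {T : K →L[ℂ] RTP c α γ} (hT : T ∈ ket1Span c α γ B) {y : K →L[ℂ] K}
    (hy : ∀ x ∈ B, x ∘L y ∈ B) : T ∘L y ∈ ket1Span c α γ B := by
  refine comp_right_mem (W := ket1Span c α γ B) (isClosed_cspan _) y ?_ hT
  rintro _ ⟨ξ, hξ, x, hx, rfl⟩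
  rw [ContinuousLinearMap.comp_assoc]
  exact subset_cspan ⟨ξ, hξ, _, hy x hx, rfl⟩

theorem ket2Span_comp_mem {T : H →L[ℂ] RTP c α γ} (hT : T ∈ ket2Span c α γ A) {y : H →L[ℂ] H}
    (hy : ∀ x ∈ A, x ∘L y ∈ A) : T ∘L y ∈ ket2Span c α γ A := by
  refine comp_right_mem (W := ket2Span c α γ A) (isClosed_cspan _) y ?_ hT
  rintro _ ⟨η, x, hx, rfl⟩
  rw [ContinuousLinearMap.comp_assoc]
  exact subset_cspan ⟨η, _, hy x hx, rfl⟩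

theorem isClosed_comp_adjoint_comp_mem {X Z : Type*} [NormedAddCommGroup X]
    [InnerProductSpace ℂ X] [CompleteSpace X] [NormedAddCommGroup Z] [InnerProductSpace ℂ Z]
    (k : Z →L[ℂ] X) {P : Submodule ℂ (Z →L[ℂ] X)} (hP : IsClosed (P : Set (Z →L[ℂ] X))) :
    IsClosed {x : X →L[ℂ] X | x ∘L k ∈ P ∧ adjoint x ∘L k ∈ P} := by
  have h1 : Continuous fun x : X →L[ℂ] X => x ∘L k :=
    ((ContinuousLinearMap.compL ℂ Z X X).flip k).continuous
  exact (hP.preimage h1).inter (hP.preimage (h1.comp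
    (adjoint (𝕜 := ℂ) (E := X) (F := X)).continuous))

theorem isClosed_fiber : IsClosed (fiber c α γ A B : Set (RTP c α γ →L[ℂ] RTP c α γ)) := by
  have h : (fiber c α γ A B : Set (RTP c α γ →L[ℂ] RTP c α γ)) =
      (⋂ ξ : α.carrier, {x | x ∘L ket1 c α γ ξ.1 ∈ ket1Span c α γ B ∧
        adjoint x ∘L ket1 c α γ ξ.1 ∈ ket1Span c α γ B}) ∩
      ⋂ η : γ.carrier, {x | x ∘L ket2 c α γ η ∈ ket2Span c α γ A ∧
        adjoint x ∘L ket2 c α γ η ∈ ket2Span c α γ A} := by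
    ext x
    simp only [Set.mem_inter_iff, Set.mem_iInter]
    exact ⟨fun hx => ⟨fun ξ => hx.1 ξ.1 ξ.2, fun η => hx.2 η⟩,
      fun hx => ⟨fun ξ hξ => hx.1 ⟨ξ, hξ⟩, fun η => hx.2 η⟩⟩
  rw [h]
  exact (isClosed_iInter fun ξ => isClosed_comp_adjoint_comp_mem _ (isClosed_cspan _)).inter
    (isClosed_iInter fun η => isClosed_comp_adjoint_comp_mem _ (isClosed_cspan _))

theorem adjoint_mem_fiber {x : RTP c α γ →L[ℂ] RTP c α γ} (hx : x ∈ fiber c α γ A B) :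
    adjoint x ∈ fiber c α γ A B := by
  refine ⟨fun ξ hξ => ?_, fun η => ?_⟩
  · rw [ContinuousLinearMap.adjoint_adjoint]
    exact (hx.1 ξ hξ).symm
  · rw [ContinuousLinearMap.adjoint_adjoint]
    exact (hx.2 η).symm

theorem fiber_comp_ket1Span (hB : ∀ x ∈ B, ∀ y ∈ B, x ∘L y ∈ B)
    {x : RTP c α γ →L[ℂ] RTP c α γ} (hx : x ∈ fiber c α γ A B) {T : K →L[ℂ] RTP c α γ}
    (hT : T ∈ ket1Span c α γ B) : x ∘L T ∈ ket1Span c α γ B := by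
  refine comp_left_mem (W := ket1Span c α γ B) (isClosed_cspan _) x ?_ hT
  rintro _ ⟨ξ, hξ, y, hy, rfl⟩
  rw [← ContinuousLinearMap.comp_assoc]
  exact ket1Span_comp_mem (hx.1 ξ hξ).1 fun z hz => hB z hz y hy

theorem fiber_comp_ket2Span (hA : ∀ x ∈ A, ∀ y ∈ A, x ∘L y ∈ A)
    {x : RTP c α γ →L[ℂ] RTP c α γ} (hx : x ∈ fiber c α γ A B) {T : H →L[ℂ] RTP c α γ}
    (hT : T ∈ ket2Span c α γ A) : x ∘L T ∈ ket2Span c α γ A := by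
  refine comp_left_mem (W := ket2Span c α γ A) (isClosed_cspan _) x ?_ hT
  rintro _ ⟨η, y, hy, rfl⟩
  rw [← ContinuousLinearMap.comp_assoc]
  exact ket2Span_comp_mem (hx.2 η).1 fun z hz => hA z hz y hy

theorem fiber_comp_mem (hA : ∀ x ∈ A, ∀ y ∈ A, x ∘L y ∈ A) (hB : ∀ x ∈ B, ∀ y ∈ B, x ∘L y ∈ B)
    {x y : RTP c α γ →L[ℂ] RTP c α γ} (hx : x ∈ fiber c α γ A B) (hy : y ∈ fiber c α γ A B) :
    x ∘L y ∈ fiber c α γ A B := by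
  refine ⟨fun ξ hξ => ⟨?_, ?_⟩, fun η => ⟨?_, ?_⟩⟩
  · rw [ContinuousLinearMap.comp_assoc]
    exact fiber_comp_ket1Span hB hx (hy.1 ξ hξ).1
  · rw [ContinuousLinearMap.adjoint_comp, ContinuousLinearMap.comp_assoc]
    exact fiber_comp_ket1Span hB (adjoint_mem_fiber hy) (hx.1 ξ hξ).2
  · rw [ContinuousLinearMap.comp_assoc]
    exact fiber_comp_ket2Span hA hx (hy.2 η).1
  · rw [ContinuousLinearMap.adjoint_comp, ContinuousLinearMap.comp_assoc]
    exact fiber_comp_ket2Span hA (adjoint_mem_fiber hy) (hx.2 η).2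

/-- Elements of the fiber product commute with `S ⊗ Id` for `S` in the commutant of `A`. -/
theorem fiber_comm_ampL {x : RTP c α γ →L[ℂ] RTP c α γ} (hx : x ∈ fiber c α γ A B)
    {S : H →L[ℂ] H} (hS : S ∈ rhoIntertwiners c.Bd α α) (hSA : ∀ a ∈ A, S ∘L a = a ∘L S) :
    x ∘L ampL c α α γ S = ampL c α α γ S ∘L x := by
  refine ext_ket2 fun η => ?_
  rw [ContinuousLinearMap.comp_assoc, ampL_comp_ket2 hS, ← ContinuousLinearMap.comp_assoc,
    ContinuousLinearMap.comp_assoc]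
  refine eqOn_cspan ((ContinuousLinearMap.compL ℂ H H (RTP c α γ)).flip S)
    (ContinuousLinearMap.compL ℂ H (RTP c α γ) (RTP c α γ) (ampL c α α γ S)) ?_ (hx.2 η).1
  rintro _ ⟨η', a, ha, rfl⟩
  change (ket2 c α γ η' ∘L a) ∘L S = ampL c α α γ S ∘L (ket2 c α γ η' ∘L a)
  rw [comp_reassoc (ampL_comp_ket2 hS η'), ContinuousLinearMap.comp_assoc, ← hSA a ha,
    ContinuousLinearMap.comp_assoc]

/-- Elements of the fiber product commute with `Id ⊗ T` for `T` in the commutant of `B`. -/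
theorem fiber_comm_ampR {x : RTP c α γ →L[ℂ] RTP c α γ} (hx : x ∈ fiber c α γ A B)
    {T : K →L[ℂ] K} (hT : T ∈ rhoIntertwiners c.B γ γ) (hTB : ∀ a ∈ B, T ∘L a = a ∘L T) :
    x ∘L ampR c α γ γ T = ampR c α γ γ T ∘L x := by
  refine ext_ket1 fun ξ => ?_
  rw [ContinuousLinearMap.comp_assoc, ampR_comp_ket1 hT, ← ContinuousLinearMap.comp_assoc,
    ContinuousLinearMap.comp_assoc]
  refine eqOn_cspan ((ContinuousLinearMap.compL ℂ K K (RTP c α γ)).flip T)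
    (ContinuousLinearMap.compL ℂ K (RTP c α γ) (RTP c α γ) (ampR c α γ γ T)) ?_ (hx.1 ξ.1 ξ.2).1
  rintro _ ⟨ξ', hξ', a, ha, rfl⟩
  change (ket1 c α γ ξ' ∘L a) ∘L T = ampR c α γ γ T ∘L (ket1 c α γ ξ' ∘L a)
  rw [comp_reassoc (ampR_comp_ket1 hT ⟨ξ', hξ'⟩), ContinuousLinearMap.comp_assoc, ← hTB a ha,
    ContinuousLinearMap.comp_assoc]

end Span

/-- `[ρ_{β ◁ β}(ℭ) (α ▷ α)] = α ▷ α`, since `ρ_{β ◁ β}(e) = ρ_β(e) ⊗ Id`. -/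
theorem acts_triL_triR {hβ : Acts c.Bd α β.carrier} {hα : Acts c.B β α.carrier} :
    Acts c.B (triL c α β β hβ) (triR c α β α hα).carrier := by
  have hgen : ∀ e ∈ c.B, ∀ ξ ∈ α.carrier, ∀ a : 𝔎 →L[ℂ] H, (triL c α β β hβ).rho e ∘L
      (ket1 c α β ξ ∘L a) = ket1 c α β (β.rho e ∘L ξ) ∘L a := fun e he ξ hξ a =>
    comp_reassoc (rho_triL_comp_ket1 β hβ ⟨ξ, hξ⟩ (commB c.op he) (hα.comp_mem he hξ)) a
  refine le_antisymm (cspan_le (triR c α β α hα).isClosed_carrier ?_) ?_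
  · rintro _ ⟨e, he, T, hT, rfl⟩
    rw [triR_carrier] at hT
    refine comp_left_mem (triR c α β α hα).isClosed_carrier _ ?_ hT
    rintro _ ⟨ξ, a, ha, rfl⟩
    rw [hgen e he ξ.1 ξ.2]
    exact ket1_comp_mem α hα ⟨_, hα.comp_mem he ξ.2⟩ ha
  · conv_lhs => rw [triR_carrier]
    refine cspan_le (isClosed_cspan _) ?_
    rintro _ ⟨⟨ξ, hξ₀⟩, a, ha, rfl⟩
    have hξ := hξ₀
    rw [← show cspan _ = α.carrier from hα] at hξ
    obtain ⟨_, h⟩ := apply_mem_of_mem_cspan α.isClosed_carrier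
      (((ContinuousLinearMap.compL ℂ 𝔎 H (RTP c α β)).flip a) ∘L ket1L c α β)
      (S := {T | ∃ e ∈ c.B, ∃ d ∈ α.carrier, β.rho e ∘L d = T})
      (Q := cspan {T | ∃ e ∈ c.B, ∃ d ∈ (triR c α β α hα).carrier,
        (triL c α β β hβ).rho e ∘L d = T})
      (by rintro _ ⟨e, he, d, hd, rfl⟩; exact hα.comp_mem he hd) (isClosed_cspan _)
      (by
        rintro _ ⟨e, he, d, hd, rfl⟩
        exact subset_cspan ⟨e, he, _, ket1_comp_mem α hα ⟨d, hd⟩ ha, hgen e he d hd a⟩) hξ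
    exact h

/-- `[ρ_{α ▷ α}(ℭ†) (β ◁ β)] = β ◁ β`, since `ρ_{α ▷ α}(e) = Id ⊗ ρ_α(e)`. -/
theorem acts_triR_triL {hβ : Acts c.Bd α β.carrier} {hα : Acts c.B β α.carrier} :
    Acts c.Bd (triR c α β α hα) (triL c α β β hβ).carrier := by
  have hgen : ∀ e (he : e ∈ c.Bd), ∀ η (hη : η ∈ β.carrier), ∀ a : 𝔎 →L[ℂ] H,
      (triR c α β α hα).rho e ∘L (ket2 c α β ⟨η, hη⟩ ∘L a) =
        ket2 c α β ⟨α.rho e ∘L η, hβ.comp_mem he hη⟩ ∘L a := fun e he η hη a =>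
    comp_reassoc (rho_triR_comp_ket2 α hα ⟨η, hη⟩ (commB c he) (hβ.comp_mem he hη)) a
  refine le_antisymm (cspan_le (triL c α β β hβ).isClosed_carrier ?_) ?_
  · rintro _ ⟨e, he, T, hT, rfl⟩
    rw [triL_carrier] at hT
    refine comp_left_mem (triL c α β β hβ).isClosed_carrier _ ?_ hT
    rintro _ ⟨η, a, ha, rfl⟩
    rw [hgen e he η.1 η.2]
    exact ket2_comp_mem β hβ _ ha
  · conv_lhs => rw [triL_carrier]
    refine cspan_le (isClosed_cspan _) ?_
    rintro _ ⟨⟨η, hη₀⟩, a, ha, rfl⟩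
    have hη := hη₀
    rw [← show cspan _ = β.carrier from hβ] at hη
    obtain ⟨_, h⟩ := apply_mem_of_mem_cspan β.isClosed_carrier
      (((ContinuousLinearMap.compL ℂ 𝔎 H (RTP c α β)).flip a) ∘L ket2L c α β)
      (S := {T | ∃ e ∈ c.Bd, ∃ d ∈ β.carrier, α.rho e ∘L d = T})
      (Q := cspan {T | ∃ e ∈ c.Bd, ∃ d ∈ (triL c α β β hβ).carrier,
        (triR c α β α hα).rho e ∘L d = T})
      (by rintro _ ⟨e, he, d, hd, rfl⟩; exact hβ.comp_mem he hd) (isClosed_cspan _)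
      (by
        rintro _ ⟨e, he, d, hd, rfl⟩
        exact subset_cspan ⟨e, he, _, ket2_comp_mem β hβ ⟨d, hd⟩ ha, hgen e he d hd a⟩) hη
    exact h

theorem IsBiAlgebra.comp_rho_β_mem {A : Submodule ℂ (H →L[ℂ] H)} (hA : IsBiAlgebra c β α A)
    {d : 𝔎 →L[ℂ] 𝔎} (hd : d ∈ c.B) {x : H →L[ℂ] H} (hx : x ∈ A) : x ∘L β.rho d ∈ A := by
  have h := hA.star_mem _
    (hA.rho_β_mem (adjoint d) (StarMemClass.star_mem (s := c.B) hd) _ (hA.star_mem x hx))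
  rwa [adjoint_rho_comp β (CModule.adjoint_mem_commutant (commB c.op hd)),
    ContinuousLinearMap.adjoint_adjoint, ContinuousLinearMap.adjoint_adjoint] at h

theorem IsBiAlgebra.comp_rho_α_mem {A : Submodule ℂ (H →L[ℂ] H)} (hA : IsBiAlgebra c β α A)
    {d : 𝔎 →L[ℂ] 𝔎} (hd : d ∈ c.Bd) {x : H →L[ℂ] H} (hx : x ∈ A) : x ∘L α.rho d ∈ A := by
  have h := hA.star_mem _
    (hA.rho_α_mem (adjoint d) (StarMemClass.star_mem (s := c.Bd) hd) _ (hA.star_mem x hx))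
  rwa [adjoint_rho_comp α (CModule.adjoint_mem_commutant (commB c hd)),
    ContinuousLinearMap.adjoint_adjoint, ContinuousLinearMap.adjoint_adjoint] at h

/-- The fiber product of a `C*`-`(𝔠†, 𝔠)`-algebra with itself is a `C*`-`(𝔠†, 𝔠)`-algebra. -/
theorem IsBiAlgebra.fiber {A : Submodule ℂ (H →L[ℂ] H)} (hA : IsBiAlgebra c β α A)
    (hβ : Acts c.Bd α β.carrier) (hα : Acts c.B β α.carrier) :
    IsBiAlgebra c (triL c α β β hβ) (triR c α β α hα) (fiber c α β A A) where
  acts_α := acts_triL_triR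
  acts_β := acts_triR_triL
  closed := isClosed_fiber
  mul_mem _ hx _ hy := fiber_comp_mem hA.mul_mem hA.mul_mem hx hy
  star_mem _ hx := adjoint_mem_fiber hx
  rho_β_mem d hd x hx := by
    have hd' := commB c.op hd
    have hds : adjoint d ∈ c.B := StarMemClass.star_mem (s := c.B) hd
    have hds' := commB c.op hds
    refine ⟨fun ξ hξ => ⟨?_, ?_⟩, fun η => ⟨?_, ?_⟩⟩
    · rw [ContinuousLinearMap.comp_assoc]
      refine comp_left_mem (W := ket1Span c α β A) (isClosed_cspan _) _ ?_ (hx.1 ξ hξ).1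
      rintro _ ⟨ξ', hξ', y, hy, rfl⟩
      rw [comp_reassoc (rho_triL_comp_ket1 β hβ ⟨ξ', hξ'⟩ hd' (hα.comp_mem hd hξ'))]
      exact subset_cspan ⟨_, hα.comp_mem hd hξ', y, hy, rfl⟩
    · rw [adjoint_rho_comp _ hd', ContinuousLinearMap.comp_assoc,
        rho_triL_comp_ket1 β hβ ⟨ξ, hξ⟩ hds' (hα.comp_mem hds hξ)]
      exact (hx.1 _ (hα.comp_mem hds hξ)).2
    · rw [ContinuousLinearMap.comp_assoc]
      refine comp_left_mem (W := ket2Span c α β A) (isClosed_cspan _) _ ?_ (hx.2 η).1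
      rintro _ ⟨η', y, hy, rfl⟩
      rw [comp_reassoc (rho_triL_comp_ket2 β hβ η' hd'), ContinuousLinearMap.comp_assoc]
      exact subset_cspan ⟨η', _, hA.rho_β_mem d hd y hy, rfl⟩
    · rw [adjoint_rho_comp _ hd', ContinuousLinearMap.comp_assoc,
        rho_triL_comp_ket2 β hβ η hds', ← ContinuousLinearMap.comp_assoc]
      exact ket2Span_comp_mem (hx.2 η).2 fun y hy => hA.comp_rho_β_mem hds hy
  rho_α_mem d hd x hx := by
    have hd' := commB c hd
    have hds : adjoint d ∈ c.Bd := StarMemClass.star_mem (s := c.Bd) hd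
    have hds' := commB c hds
    refine ⟨fun ξ hξ => ⟨?_, ?_⟩, fun η => ⟨?_, ?_⟩⟩
    · rw [ContinuousLinearMap.comp_assoc]
      refine comp_left_mem (W := ket1Span c α β A) (isClosed_cspan _) _ ?_ (hx.1 ξ hξ).1
      rintro _ ⟨ξ', hξ', y, hy, rfl⟩
      rw [comp_reassoc (rho_triR_comp_ket1 α hα ⟨ξ', hξ'⟩ hd'), ContinuousLinearMap.comp_assoc]
      exact subset_cspan ⟨ξ', hξ', _, hA.rho_α_mem d hd y hy, rfl⟩
    · rw [adjoint_rho_comp _ hd', ContinuousLinearMap.comp_assoc,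
        rho_triR_comp_ket1 α hα ⟨ξ, hξ⟩ hds', ← ContinuousLinearMap.comp_assoc]
      exact ket1Span_comp_mem (hx.1 ξ hξ).2 fun y hy => hA.comp_rho_α_mem hds hy
    · rw [ContinuousLinearMap.comp_assoc]
      refine comp_left_mem (W := ket2Span c α β A) (isClosed_cspan _) _ ?_ (hx.2 η).1
      rintro _ ⟨η', y, hy, rfl⟩
      rw [comp_reassoc (rho_triR_comp_ket2 α hα η' hd' (hβ.comp_mem hd η'.2))]
      exact subset_cspan ⟨_, y, hy, rfl⟩
    · rw [adjoint_rho_comp _ hd', ContinuousLinearMap.comp_assoc,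
        rho_triR_comp_ket2 α hα η hds' (hβ.comp_mem hds η.2)]
      exact (hx.2 _).2

end Fiber

namespace PMU
variable {b : CBase 𝔎} {V : PMU b H}

/-! ### Normality of the comultiplication -/

theorem IsRegular.isBiAlgebra_hatA (hr : V.IsRegular) : IsBiAlgebra b.op V.α V.βhat V.hatA where
  acts_α := V.α_βhat
  acts_β := V.βhat_α
  closed := V.isClosed_hatA
  mul_mem _ hx _ hy := V.hatA_mul_mem hx hy
  star_mem _ hx := hr.adjoint_mem hx
  rho_β_mem _ hd _ hx := V.rho_α_comp_mem hd hx
  rho_α_mem _ hd _ hx := V.rho_βhat_comp_mem hd hx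

theorem delta_comp {x y : H →L[ℂ] H} (hx : x ∈ V.hatA) (hy : y ∈ V.hatA) :
    V.delta (x ∘L y) = V.delta x ∘L V.delta y := by
  unfold delta
  rw [ampR_comp (V.hatA_le_rhoIntertwiners hx) (V.hatA_le_rhoIntertwiners hy)]
  simp only [ContinuousLinearMap.comp_assoc]
  rw [comp_reassoc (toOp_comp_symm V.V), ContinuousLinearMap.id_comp]

theorem delta_add {x y : H →L[ℂ] H} (hx : x ∈ V.hatA) (hy : y ∈ V.hatA) :
    V.delta (x + y) = V.delta x + V.delta y := by
  have h := V.deltaL.map_add ⟨x, V.hatA_le_rhoIntertwiners hx⟩ ⟨y, V.hatA_le_rhoIntertwiners hy⟩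
  rw [deltaL_apply, deltaL_apply, deltaL_apply] at h
  exact h

theorem delta_smul (a : ℂ) {x : H →L[ℂ] H} (hx : x ∈ V.hatA) :
    V.delta (a • x) = a • V.delta x := by
  have h := V.deltaL.map_smul a ⟨x, V.hatA_le_rhoIntertwiners hx⟩
  rw [deltaL_apply, deltaL_apply] at h
  exact h

theorem hatDelta_apply (x : V.hatA) : V.hatDelta x = V.delta x.1 := rfl

theorem IsRegular.isStarHom_hatDelta (hr : V.IsRegular) :
    IsStarHom V.hatA (CPMU.fiber b.op V.βhat V.α V.hatA V.hatA) V.hatDelta where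
  mem x := hr.delta_mem_fiber x.2
  add x y := by
    rw [hatDelta_apply, hatDelta_apply, hatDelta_apply]
    exact delta_add x.2 y.2
  smul a x := by
    rw [hatDelta_apply, hatDelta_apply]
    exact delta_smul a x.2
  mul x y z h := by
    rw [hatDelta_apply, hatDelta_apply, hatDelta_apply, h]
    exact delta_comp x.2 y.2
  star x y h := by
    rw [hatDelta_apply, hatDelta_apply, h, V.adjoint_delta (V.hatA_le_rhoIntertwiners x.2)]

/-- The operators `V* |ξ⟩₁`, `ξ ∈ α`, intertwine the identity and the comultiplication. -/
theorem Vsymm_ket1_mem_intertwiners (ξ : V.α.carrier) :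
    toOp V.V.symm ∘L ket1 b V.α V.β ξ.1 ∈ intertwiners V.hatDelta := by
  intro x
  change _ = V.delta x.1 ∘L _
  rw [comp_reassoc (V.delta_comp_V_symm x.1), ContinuousLinearMap.comp_assoc,
    ContinuousLinearMap.comp_assoc, ampR_comp_ket1 (V.hatA_le_rhoIntertwiners x.2)]

theorem V_symm_mem_αα (V : PMU b H) : toOp V.V.symm ∈ mor V.rngαα V.srcαα := by
  rw [← adjoint_toOp]
  exact adjoint_mem_mor V.V_mem_αα

theorem V_symm_mem_βhβh (V : PMU b H) : toOp V.V.symm ∈ mor V.rngαβh V.srcβhβh := by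
  rw [← adjoint_toOp]
  exact adjoint_mem_mor V.V_mem_βhβh

theorem Vsymm_ket1_mem_αα (ξ : V.α.carrier) :
    toOp V.V.symm ∘L ket1 b V.α V.β ξ.1 ∈ mor V.α V.srcαα :=
  mor_comp V.V_symm_mem_αα (ket1_mem_mor V.α V.β_α ξ)

theorem Vsymm_ket1_mem_βhβh (ξ : V.α.carrier) :
    toOp V.V.symm ∘L ket1 b V.α V.β ξ.1 ∈ mor V.βhat V.srcβhβh :=
  mor_comp V.V_symm_mem_βhβh (ket1_mem_mor V.βhat V.β_βhat ξ)

/-- If `V γ ⊆ α ▷ δ`, then `γ ⊆ [V* |α⟩₁ δ]`. -/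
theorem le_cspan_Vsymm_ket1 {C : NonUnitalStarSubalgebra ℂ (𝔎 →L[ℂ] 𝔎)} (δ : CModule C H)
    (h : Acts b.B V.β δ.carrier) {γ : CModule C V.Src}
    (hγ : toOp V.V ∈ semiMor γ (triR b V.α V.β δ h)) {T : 𝔎 →L[ℂ] V.Src} (hT : T ∈ γ.carrier) :
    T ∈ cspan {T | ∃ ξ : V.α.carrier, ∃ d ∈ δ.carrier,
      (toOp V.V.symm ∘L ket1 b V.α V.β ξ.1) ∘L d = T} := by
  have h1 := hγ T hT
  rw [triR_carrier] at h1
  have h2 := comp_left_mem (k := toOp V.V.symm) (W := cspan {T | ∃ ξ : V.α.carrier,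
    ∃ d ∈ δ.carrier, (toOp V.V.symm ∘L ket1 b V.α V.β ξ.1) ∘L d = T}) (isClosed_cspan _) (by
      rintro _ ⟨ξ, d, hd, rfl⟩
      exact subset_cspan ⟨ξ, d, hd, rfl⟩) h1
  rwa [comp_reassoc (toOp_symm_comp V.V), ContinuousLinearMap.id_comp] at h2

theorem IsRegular.isJointlyNormal_hatDelta (hr : V.IsRegular) :
    IsJointlyNormal b.op V.α V.βhat V.hatA (triL b.op V.βhat V.α V.α V.βhat_α)
      (triR b.op V.βhat V.α V.βhat V.α_βhat) (CPMU.fiber b.op V.βhat V.α V.hatA V.hatA)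
      V.hatDelta where
  source := hr.isBiAlgebra_hatA
  target := hr.isBiAlgebra_hatA.fiber V.βhat_α V.α_βhat
  hom := hr.isStarHom_hatDelta
  span_β := by
    refine le_antisymm (cspan_le V.srcαα.isClosed_carrier ?_) fun T hT => ?_
    · rintro _ ⟨S, ⟨-, hS, -⟩, ξ, hξ, rfl⟩
      exact hS.1 ξ hξ
    · refine cspan_mono ?_ (le_cspan_Vsymm_ket1 V.α V.β_α V.V_mem_αα.1 hT)
      rintro _ ⟨ξ, d, hd, rfl⟩
      exact ⟨_, ⟨Vsymm_ket1_mem_intertwiners ξ, Vsymm_ket1_mem_αα ξ, Vsymm_ket1_mem_βhβh ξ⟩,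
        d, hd, rfl⟩
  span_α := by
    refine le_antisymm (cspan_le V.srcβhβh.isClosed_carrier ?_) fun T hT => ?_
    · rintro _ ⟨S, ⟨-, -, hS⟩, ξ, hξ, rfl⟩
      exact hS.1 ξ hξ
    · refine cspan_mono ?_ (le_cspan_Vsymm_ket1 V.βhat V.β_βhat V.V_mem_βhβh.1 hT)
      rintro _ ⟨ξ, d, hd, rfl⟩
      exact ⟨_, ⟨Vsymm_ket1_mem_intertwiners ξ, Vsymm_ket1_mem_αα ξ, Vsymm_ket1_mem_βhβh ξ⟩,
        d, hd, rfl⟩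

/-! ### Coassociativity -/

variable (V)

/-- `Δ̂_V(ρ_δ(e) x) = ρ_γ(e) Δ̂_V(x)` if `V γ = α ▷ δ`, because `ρ_{α ▷ δ}(e) = Id ⊗ ρ_δ(e)`. -/
theorem delta_rho_comp {C : NonUnitalStarSubalgebra ℂ (𝔎 →L[ℂ] 𝔎)} (δ : CModule C H)
    (h : Acts b.B V.β δ.carrier) {γ : CModule C V.Src}
    (hγ : toOp V.V ∈ mor γ (triR b V.α V.β δ h)) {e : 𝔎 →L[ℂ] 𝔎} (he : ∀ c ∈ C, c * e = e * c)
    {x : H →L[ℂ] H} (hx : x ∈ V.hatA) :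
    V.delta (δ.rho e ∘L x) = γ.rho e ∘L V.delta x := by
  have h1 : δ.rho e ∈ rhoIntertwiners b.B V.β V.β := fun c hc => h.commute hc he
  have h2 : (triR b V.α V.β δ h).rho e = ampR b V.α V.β V.β (δ.rho e) := by
    refine ext_ket1 fun ξ => ?_
    rw [rho_triR_comp_ket1 δ h ξ he, ampR_comp_ket1 h1]
  have h3 := CModule.rho_comm_of_semiMor hγ.2 he
  rw [adjoint_toOp, h2] at h3
  unfold delta
  rw [ampR_comp h1 (V.hatA_le_rhoIntertwiners hx), comp_reassoc h3, ContinuousLinearMap.comp_assoc,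
    ContinuousLinearMap.comp_assoc]

/-- Since `Â_V` is nondegenerate, intertwiners of a representation `π` of `Â_V` also intertwine
any operators that `π` intertwines as multipliers. -/
theorem comp_eq_of_intertwiners {K : Type*} [NormedAddCommGroup K] [InnerProductSpace ℂ K]
    [CompleteSpace K] {π : V.hatA → K →L[ℂ] K} {S : H →L[ℂ] K} (hS : S ∈ intertwiners π)
    {r : H →L[ℂ] H} {r' : K →L[ℂ] K}
    (h : ∀ x : V.hatA, ∃ hr : r ∘L x.1 ∈ V.hatA, π ⟨r ∘L x.1, hr⟩ = r' ∘L π x) :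
    r' ∘L S = S ∘L r := by
  refine V.ext_of_comp_hatA fun x hx => ?_
  obtain ⟨hr, h1⟩ := h ⟨x, hx⟩
  rw [ContinuousLinearMap.comp_assoc, ContinuousLinearMap.comp_assoc, hS ⟨x, hx⟩,
    hS ⟨_, hr⟩, h1, ContinuousLinearMap.comp_assoc]

theorem id_intertwiners_βhat {S : H →L[ℂ] H} (hS : S ∈ intertwiners (fun a : V.hatA => a.1)) :
    S ∈ rhoIntertwiners b.B V.βhat V.βhat := fun _ hc =>
  V.comp_eq_of_intertwiners hS fun x => ⟨V.rho_βhat_comp_mem hc x.2, rfl⟩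

theorem id_intertwiners_α {S : H →L[ℂ] H} (hS : S ∈ intertwiners (fun a : V.hatA => a.1)) :
    S ∈ rhoIntertwiners b.Bd V.α V.α := fun _ hd =>
  V.comp_eq_of_intertwiners hS fun x => ⟨V.rho_α_comp_mem hd x.2, rfl⟩

theorem delta_intertwiners_βhat {S : H →L[ℂ] V.Src} (hS : S ∈ intertwiners V.hatDelta) :
    S ∈ rhoIntertwiners b.B V.βhat V.srcβhβh := fun _ hc =>
  V.comp_eq_of_intertwiners hS fun x => ⟨V.rho_βhat_comp_mem hc x.2,
    V.delta_rho_comp V.βhat V.β_βhat V.V_mem_βhβh (commB b.op hc) x.2⟩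

theorem delta_intertwiners_α {S : H →L[ℂ] V.Src} (hS : S ∈ intertwiners V.hatDelta) :
    S ∈ rhoIntertwiners b.Bd V.α V.srcαα := fun _ hd =>
  V.comp_eq_of_intertwiners hS fun x => ⟨V.rho_α_comp_mem hd x.2,
    V.delta_rho_comp V.α V.β_α V.V_mem_αα (commB b hd) x.2⟩

theorem bra1V_mem_βhat (ξ : V.α.carrier) :
    adjoint (ket1 b V.α V.β ξ.1) ∘L toOp V.V ∈ mor V.srcβhβh V.βhat :=
  mor_comp (adjoint_mem_mor (ket1_mem_mor V.βhat V.β_βhat ξ)) V.V_mem_βhβh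

theorem bra1V_mem_α (ξ : V.α.carrier) :
    adjoint (ket1 b V.α V.β ξ.1) ∘L toOp V.V ∈ mor V.srcαα V.α :=
  mor_comp (adjoint_mem_mor (ket1_mem_mor V.α V.β_α ξ)) V.V_mem_αα

/-- `⟨ξ|₁ V` carries intertwiners of `Δ̂_V` to the commutant of `Â_V`. -/
theorem bra1V_comp_intertwiner {S : H →L[ℂ] V.Src} (hS : S ∈ intertwiners V.hatDelta)
    (ξ : V.α.carrier) : (adjoint (ket1 b V.α V.β ξ.1) ∘L toOp V.V) ∘L S ∈
      intertwiners (fun a : V.hatA => a.1) := by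
  intro x
  have h1 : S ∘L x.1 = V.delta x.1 ∘L S := hS x
  rw [ContinuousLinearMap.comp_assoc, h1, ContinuousLinearMap.comp_assoc,
    comp_reassoc (V.V_comp_delta x.1), ContinuousLinearMap.comp_assoc,
    comp_reassoc (bra1_comp_ampR (V.hatA_le_rhoIntertwiners x.2) ξ)]
  rfl

/-- `V₁₂`, followed by reassociation. -/
def V12 : RTP b.op V.srcβhβh V.α →L[ℂ] RTP b V.α V.srcβα :=
  toOp (assocU b b.op V.α V.β V.βhat V.α V.β_βhat V.βhat_β) ∘L
    ampL b.op V.srcβhβh V.rngαβh V.α (toOp V.V)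

theorem ampL_id {K L : Type*} [NormedAddCommGroup K] [InnerProductSpace ℂ K] [CompleteSpace K]
    [NormedAddCommGroup L] [InnerProductSpace ℂ L] [CompleteSpace L]
    (b : CBase 𝔎) (α : CModule b.B L) (γ : CModule b.Bd K) :
    ampL b α α γ (ContinuousLinearMap.id ℂ L) = ContinuousLinearMap.id ℂ _ := by
  refine ext_ket2 fun η => ?_
  rw [ampL_comp_ket2 (fun _ _ => rfl)]
  rfl

theorem V_intertwines_βhat : toOp V.V ∈ rhoIntertwiners b.op.Bd V.srcβhβh V.rngαβh :=
  semiMor_le_rhoIntertwiners (fun _ hc => commB b.op hc) V.V_mem_βhβh.1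

theorem V_symm_intertwines_βhat : toOp V.V.symm ∈ rhoIntertwiners b.op.Bd V.rngαβh V.srcβhβh :=
  semiMor_le_rhoIntertwiners (fun _ hc => commB b.op hc) V.V_symm_mem_βhβh.1

theorem adjoint_V12 : adjoint V.V12 = ampL b.op V.rngαβh V.srcβhβh V.α (toOp V.V.symm) ∘L
    toOp (assocU b b.op V.α V.β V.βhat V.α V.β_βhat V.βhat_β).symm := by
  unfold V12
  rw [ContinuousLinearMap.adjoint_comp, adjoint_toOp, adjoint_ampL (b := b.op) V.V_intertwines_βhat,
    adjoint_toOp]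

theorem V12_comp_adjoint : V.V12 ∘L adjoint V.V12 = ContinuousLinearMap.id ℂ _ := by
  have h := ampL_comp (b := b.op) (γ := V.α) V.V_intertwines_βhat V.V_symm_intertwines_βhat
  rw [toOp_comp_symm, ampL_id] at h
  rw [adjoint_V12, V12, ContinuousLinearMap.comp_assoc, comp_reassoc h.symm,
    ContinuousLinearMap.id_comp, toOp_comp_symm]

theorem adjoint_V12_comp : adjoint V.V12 ∘L V.V12 = ContinuousLinearMap.id ℂ _ := by
  have h := ampL_comp (b := b.op) (γ := V.α) V.V_symm_intertwines_βhat V.V_intertwines_βhat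
  rw [toOp_symm_comp, ampL_id] at h
  rw [adjoint_V12, V12, ContinuousLinearMap.comp_assoc, comp_reassoc (toOp_symm_comp _),
    ContinuousLinearMap.id_comp, h]

theorem bra1V_intertwines_βhat (ξ : V.α.carrier) :
    adjoint (ket1 b V.α V.β ξ.1) ∘L toOp V.V ∈ rhoIntertwiners b.op.Bd V.srcβhβh V.βhat :=
  semiMor_le_rhoIntertwiners (fun _ hc => commB b.op hc) (V.bra1V_mem_βhat ξ).1

theorem bra1V_intertwines_α (ξ : V.α.carrier) :
    adjoint (ket1 b V.α V.β ξ.1) ∘L toOp V.V ∈ rhoIntertwiners b.op.B V.srcαα V.α :=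
  semiMor_le_rhoIntertwiners (fun _ hc => commB b hc) (V.bra1V_mem_α ξ).1

theorem bra1_comp_V12 (ξ : V.α.carrier) : adjoint (ket1 b V.α V.srcβα ξ.1) ∘L V.V12 =
    ampL b.op V.srcβhβh V.βhat V.α (adjoint (ket1 b V.α V.β ξ.1) ∘L toOp V.V) := by
  have h1 : adjoint (ket1 b V.α V.β ξ.1) ∈ rhoIntertwiners b.op.Bd V.rngαβh V.βhat :=
    semiMor_le_rhoIntertwiners (fun _ hc => commB b.op hc)
      (adjoint_mem_mor (ket1_mem_mor V.βhat V.β_βhat ξ)).1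
  unfold V12
  rw [comp_reassoc (bra1_comp_assocU (b := b) (d := b.op) (φ := V.α) V.β_βhat V.βhat_β ξ),
    ampL_comp (b := b.op) h1 V.V_intertwines_βhat]

/-- An operator into `(H ⊗ H) ⊗ H` is determined by its compositions with `⟨ξ|₁ V₁₂`. -/
theorem ext_bra1V_ampL {X : Type*} [NormedAddCommGroup X] [InnerProductSpace ℂ X]
    [CompleteSpace X] {S T : X →L[ℂ] RTP b.op V.srcβhβh V.α}
    (h : ∀ ξ : V.α.carrier,
      ampL b.op V.srcβhβh V.βhat V.α (adjoint (ket1 b V.α V.β ξ.1) ∘L toOp V.V) ∘L S =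
      ampL b.op V.srcβhβh V.βhat V.α (adjoint (ket1 b V.α V.β ξ.1) ∘L toOp V.V) ∘L T) :
    S = T := by
  have h1 : V.V12 ∘L S = V.V12 ∘L T := ext_bra1 fun ξ => by
    rw [comp_reassoc (V.bra1_comp_V12 ξ), comp_reassoc (V.bra1_comp_V12 ξ), h ξ]
  have h2 := congrArg (fun R => adjoint V.V12 ∘L R) h1
  rwa [comp_reassoc V.adjoint_V12_comp, comp_reassoc V.adjoint_V12_comp,
    ContinuousLinearMap.id_comp, ContinuousLinearMap.id_comp] at h2

/-- An operator into `H ⊗ (H ⊗ H)` is determined by its compositions with `⟨θ|₂ V₂₃`. -/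
theorem ext_bra1V_ampR {X : Type*} [NormedAddCommGroup X] [InnerProductSpace ℂ X]
    [CompleteSpace X] {S T : X →L[ℂ] RTP b.op V.βhat V.srcαα}
    (h : ∀ θ : V.α.carrier,
      ampR b.op V.βhat V.srcαα V.α (adjoint (ket1 b V.α V.β θ.1) ∘L toOp V.V) ∘L S =
      ampR b.op V.βhat V.srcαα V.α (adjoint (ket1 b V.α V.β θ.1) ∘L toOp V.V) ∘L T) :
    S = T := by
  refine ext_bra1 (b := b.op) fun κ => ?_
  have h1 : ∀ R : X →L[ℂ] RTP b.op V.βhat V.srcαα,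
      toOp V.V.symm ∘L toOp V.V ∘L adjoint (ket1 b.op V.βhat V.srcαα κ.1) ∘L R =
        adjoint (ket1 b.op V.βhat V.srcαα κ.1) ∘L R := fun R => by
    rw [comp_reassoc (toOp_symm_comp V.V), ContinuousLinearMap.id_comp]
  rw [← h1 S, ← h1 T]
  congr 1
  refine ext_bra1 fun θ => ?_
  have h2 := bra1_comp_ampR (b := b.op) (V.bra1V_intertwines_α θ) κ
  have h3 := congrArg (fun R => adjoint (ket1 b.op V.βhat V.α κ.1) ∘L R) (h θ)
  rw [comp_reassoc h2, comp_reassoc h2] at h3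
  exact h3

/-- `Δ̂_V(x)` is an endomorphism of the module `β ◁ α = V* (β ◁ β)`, so that `Id ⊗ Δ̂_V(x)` is
defined. -/
theorem delta_mem_srcβα {x : H →L[ℂ] H} (hx : x ∈ V.hatA) :
    V.delta x ∈ mor V.srcβα V.srcβα := by
  have h1 : ∀ y : H →L[ℂ] H, y ∈ rhoIntertwiners b.B V.β V.β → y ∈ semiMor V.β V.β →
      ampR b V.α V.β V.β y ∈ semiMor V.rngββ V.rngββ := by
    intro y hy hy' T hT
    rw [triL_carrier] at hT
    refine comp_left_mem V.rngββ.isClosed_carrier _ ?_ hT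
    rintro _ ⟨η, d, hd, rfl⟩
    rw [comp_reassoc (ampR_comp_ket2 hy η (hy' _ η.2))]
    exact ket2_comp_mem V.β V.α_β _ hd
  have hx' := V.hatA_le_rhoIntertwiners hx
  have h2 : ampR b V.α V.β V.β x ∈ mor V.rngββ V.rngββ := by
    refine ⟨h1 x hx' (V.mor_of_mem_hatA hx).1, ?_⟩
    rw [adjoint_ampR hx']
    exact h1 _ (adjoint_mem_rhoIntertwiners (fun _ hc => commB b.op hc) hx')
      (V.mor_of_mem_hatA hx).2
  have h3 : toOp V.V.symm ∈ mor V.rngββ V.srcβα := by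
    rw [← adjoint_toOp]
    exact adjoint_mem_mor V.V_mem_βα
  exact mor_comp h3 (mor_comp h2 V.V_mem_βα)

theorem delta_intertwines {x : H →L[ℂ] H} (hx : x ∈ V.hatA) :
    V.delta x ∈ rhoIntertwiners b.B V.srcβα V.srcβα :=
  semiMor_le_rhoIntertwiners (fun _ hc => commB b.op hc) (V.delta_mem_srcβα hx).1

/-- The operator `V₁₂* (Id ⊗ Δ̂_V(x)) V₁₂`, the common value of `(Δ̂_V * Id)(Δ̂_V(x))` and
`(Id * Δ̂_V)(Δ̂_V(x))`. -/
def delta₂ (x : H →L[ℂ] H) : RTP b.op V.srcβhβh V.α →L[ℂ] RTP b.op V.srcβhβh V.α :=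
  adjoint V.V12 ∘L ampR b V.α V.srcβα V.srcβα (V.delta x) ∘L V.V12

/-- `⟨ξ|₁ V₁₂` intertwines `V₁₂* (Id ⊗ Δ̂_V(x)) V₁₂` and `Δ̂_V(x)`. -/
theorem bra1V_ampL_comp_delta₂ {x : H →L[ℂ] H} (hx : x ∈ V.hatA) (ξ : V.α.carrier) :
    ampL b.op V.srcβhβh V.βhat V.α (adjoint (ket1 b V.α V.β ξ.1) ∘L toOp V.V) ∘L V.delta₂ x =
      V.delta x ∘L
        ampL b.op V.srcβhβh V.βhat V.α (adjoint (ket1 b V.α V.β ξ.1) ∘L toOp V.V) := by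
  rw [← V.bra1_comp_V12, delta₂, ContinuousLinearMap.comp_assoc,
    comp_reassoc V.V12_comp_adjoint, ContinuousLinearMap.id_comp,
    comp_reassoc (bra1_comp_ampR (V.delta_intertwines hx) ξ), ContinuousLinearMap.comp_assoc]

theorem V12_comp_ket2 (φ : V.α.carrier) : V.V12 ∘L ket2 b.op V.srcβhβh V.α φ =
    ampR b V.α V.β V.srcβα (ket2 b.op V.βhat V.α φ) ∘L toOp V.V := by
  unfold V12
  rw [ContinuousLinearMap.comp_assoc, ampL_comp_ket2 (b := b.op) V.V_intertwines_βhat,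
    comp_reassoc (assocU_comp_ket2 (b := b) (d := b.op) (β := V.α) V.β_βhat V.βhat_β φ)]

theorem adjoint_V12_comp_ampR (φ : V.α.carrier) :
    adjoint V.V12 ∘L ampR b V.α V.β V.srcβα (ket2 b.op V.βhat V.α φ) =
      ket2 b.op V.srcβhβh V.α φ ∘L toOp V.V.symm := by
  have h := congrArg (fun R => adjoint V.V12 ∘L R ∘L toOp V.V.symm) (V.V12_comp_ket2 φ)
  change adjoint V.V12 ∘L (V.V12 ∘L ket2 b.op V.srcβhβh V.α φ) ∘L toOp V.V.symm =
    adjoint V.V12 ∘L (ampR b V.α V.β V.srcβα (ket2 b.op V.βhat V.α φ) ∘L toOp V.V) ∘L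
      toOp V.V.symm at h
  rw [ContinuousLinearMap.comp_assoc, comp_reassoc V.adjoint_V12_comp,
    ContinuousLinearMap.id_comp, ContinuousLinearMap.comp_assoc, toOp_comp_symm,
    ContinuousLinearMap.comp_id] at h
  exact h.symm

/-- `⟨θ|₂ V₂₃`, preceded by reassociation. -/
def bra1V23 (θ : V.α.carrier) : RTP b.op V.srcβhβh V.α →L[ℂ] V.Src :=
  ampR b.op V.βhat V.srcαα V.α (adjoint (ket1 b V.α V.β θ.1) ∘L toOp V.V) ∘L
    toOp (assocU b.op b.op V.βhat V.α V.βhat V.α V.α_βhat V.βhat_α)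

theorem bra1V23_comp_ket2 (θ φ : V.α.carrier) : V.bra1V23 θ ∘L ket2 b.op V.srcβhβh V.α φ =
    ampR b.op V.βhat V.α V.α (V.crossSlice θ φ) := by
  have h1 : ket2 b.op V.βhat V.α φ ∈ rhoIntertwiners b.op.B V.α V.srcαα :=
    ket2_mem_rhoIntertwiners (b := b.op) (d := b.op) V.βhat_α φ
  unfold bra1V23
  rw [ContinuousLinearMap.comp_assoc,
    assocU_comp_ket2 (b := b.op) (d := b.op) (β := V.βhat) V.α_βhat V.βhat_α φ,
    ← ampR_comp (b := b.op) (V.bra1V_intertwines_α θ) h1]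
  rfl

theorem bra2V_intertwines_βα (ξ : V.β.carrier) :
    adjoint (ket2 b V.α V.β ξ) ∘L toOp V.V ∈ rhoIntertwiners b.B V.srcβα V.β :=
  semiMor_le_rhoIntertwiners (fun _ hc => commB b.op hc)
    (mor_comp (adjoint_mem_mor (ket2_mem_mor V.β V.α_β ξ)) V.V_mem_βα).1

theorem ket2_comp_intertwines (φ : V.α.carrier) {a : H →L[ℂ] H} (ha : a ∈ V.hatA) :
    ket2 b.op V.βhat V.α φ ∘L a ∈ rhoIntertwiners b.B V.β V.srcβα :=
  rhoIntertwiners_comp (ket2_mem_rhoIntertwiners (b := b) (d := b.op) V.βhat_β φ)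
    (V.hatA_le_rhoIntertwiners ha)

/-- The map `R ↦ ⟨θ|₂ V₂₃ V₁₂* (Id ⊗ R) V`. -/
def bra1V23L (θ : V.α.carrier) :
    rhoIntertwiners b.B V.β V.srcβα →L[ℂ] (V.Src →L[ℂ] V.Src) :=
  (ContinuousLinearMap.compL ℂ V.Src (RTP b V.α V.srcβα) V.Src (V.bra1V23 θ ∘L adjoint V.V12)) ∘L
    ((ContinuousLinearMap.compL ℂ V.Src V.Rng (RTP b V.α V.srcβα)).flip (toOp V.V)) ∘L
      ampRL b V.α V.β V.srcβα

theorem bra1V23L_apply (θ φ : V.α.carrier) {a : H →L[ℂ] H} (ha : a ∈ V.hatA) :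
    V.bra1V23L θ ⟨_, V.ket2_comp_intertwines φ ha⟩ =
      ampR b.op V.βhat V.α V.α (V.crossSlice θ φ) ∘L V.delta a := by
  have h1 : ket2 b.op V.βhat V.α φ ∈ rhoIntertwiners b.B V.β V.srcβα :=
    ket2_mem_rhoIntertwiners (b := b) (d := b.op) V.βhat_β φ
  have h : V.bra1V23L θ ⟨_, V.ket2_comp_intertwines φ ha⟩ = (V.bra1V23 θ ∘L adjoint V.V12) ∘L
      ampR b V.α V.β V.srcβα (ket2 b.op V.βhat V.α φ ∘L a) ∘L toOp V.V := rfl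
  rw [h, ampR_comp h1 (V.hatA_le_rhoIntertwiners ha), ContinuousLinearMap.comp_assoc,
    ContinuousLinearMap.comp_assoc, comp_reassoc (V.adjoint_V12_comp_ampR φ),
    ContinuousLinearMap.comp_assoc, comp_reassoc (V.bra1V23_comp_ket2 θ φ)]
  rfl

/-- The map `R ↦ ⟨ξ|₂ V R`. -/
def bra2VL (ξ : V.β.carrier) :
    rhoIntertwiners b.B V.β V.srcβα →L[ℂ] rhoIntertwiners b.B V.β V.β :=
  ((ContinuousLinearMap.compL ℂ H V.Src H (adjoint (ket2 b V.α V.β ξ) ∘L toOp V.V)) ∘L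
    (rhoIntertwiners b.B V.β V.srcβα).subtypeL).codRestrict _
      fun R => rhoIntertwiners_comp (V.bra2V_intertwines_βα ξ) R.2

/-- `⟨ξ|₂ V` applied to `⟨θ|₂ V₂₃ V₁₂* (Id ⊗ R) V` for `R ∈ [|α⟩₂ Â_V]`; on generators `R = |φ⟩₂ a`,
this is `bra2_comp_delta_slice`. -/
theorem bra2V_comp_bra1V23L (θ : V.α.carrier) (ξ : V.β.carrier) {R : H →L[ℂ] V.Src}
    (hR : R ∈ ket2Span b.op V.βhat V.α V.hatA) (hR' : R ∈ rhoIntertwiners b.B V.β V.srcβα) :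
    (adjoint (ket2 b V.α V.β ξ) ∘L toOp V.V) ∘L V.bra1V23L θ ⟨R, hR'⟩ =
      adjoint (ket2 b.op V.βhat V.α θ) ∘L
        V.delta ((adjoint (ket2 b V.α V.β ξ) ∘L toOp V.V) ∘L R) := by
  refine eq_of_mem_cspan (isClosed_rhoIntertwiners V.β V.srcβα)
    ((ContinuousLinearMap.compL ℂ V.Src V.Src H (adjoint (ket2 b V.α V.β ξ) ∘L toOp V.V)) ∘L
      V.bra1V23L θ)
    ((ContinuousLinearMap.compL ℂ V.Src V.Src H (adjoint (ket2 b.op V.βhat V.α θ))) ∘L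
      V.deltaL ∘L V.bra2VL ξ)
    (S := {T | ∃ η : V.α.carrier, ∃ x ∈ V.hatA, ket2 b.op V.βhat V.α η ∘L x = T})
    (by rintro _ ⟨φ, a, ha, rfl⟩; exact V.ket2_comp_intertwines φ ha) ?_ hR hR'
  rintro _ ⟨φ, a, ha, rfl⟩
  change (adjoint (ket2 b V.α V.β ξ) ∘L toOp V.V) ∘L
    V.bra1V23L θ ⟨_, V.ket2_comp_intertwines φ ha⟩ =
      adjoint (ket2 b.op V.βhat V.α θ) ∘L V.delta (V.slice ξ φ ∘L a)
  rw [V.bra1V23L_apply θ φ ha, delta_comp (V.slice_mem ξ φ) ha,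
    comp_reassoc (V.bra2_comp_delta_slice θ φ ξ), ContinuousLinearMap.comp_assoc,
    ContinuousLinearMap.comp_assoc, ContinuousLinearMap.comp_assoc]

/-- `⟨θ|₂ V₂₃` intertwines `V₁₂* (Id ⊗ Δ̂_V(x)) V₁₂` and `Δ̂_V(x)`. -/
theorem bra1V23_comp_delta₂ {x : H →L[ℂ] H} (hx : x ∈ V.hatA) (θ : V.α.carrier) :
    V.bra1V23 θ ∘L V.delta₂ x = V.delta x ∘L V.bra1V23 θ := by
  refine ext_ket2 (b := b.op) fun φ => ?_
  have hR := V.delta_comp_ket2_mem hx φ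
  have h1 : ket2 b.op V.βhat V.α φ ∈ rhoIntertwiners b.B V.β V.srcβα :=
    ket2_mem_rhoIntertwiners (b := b) (d := b.op) V.βhat_β φ
  have hR' : V.delta x ∘L ket2 b.op V.βhat V.α φ ∈ rhoIntertwiners b.B V.β V.srcβα :=
    rhoIntertwiners_comp (V.delta_intertwines hx) h1
  have hL : (V.bra1V23 θ ∘L V.delta₂ x) ∘L ket2 b.op V.srcβhβh V.α φ =
      V.bra1V23L θ ⟨_, hR'⟩ := by
    have h : V.bra1V23L θ ⟨_, hR'⟩ = (V.bra1V23 θ ∘L adjoint V.V12) ∘L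
      ampR b V.α V.β V.srcβα (V.delta x ∘L ket2 b.op V.βhat V.α φ) ∘L toOp V.V := rfl
    rw [h, ampR_comp (V.delta_intertwines hx) h1, delta₂]
    simp only [ContinuousLinearMap.comp_assoc]
    rw [V.V12_comp_ket2]
  rw [hL, ContinuousLinearMap.comp_assoc, V.bra1V23_comp_ket2]
  -- It suffices to compare both sides after applying `V` and then `⟨ξ|₂`.
  have h2 : ∀ S : V.Src →L[ℂ] V.Src, toOp V.V.symm ∘L toOp V.V ∘L S = S := fun S => by
    rw [comp_reassoc (toOp_symm_comp V.V), ContinuousLinearMap.id_comp]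
  rw [← h2 (V.bra1V23L θ _), ← h2 (V.delta x ∘L _)]
  congr 1
  refine ext_bra2 fun ξ => ?_
  have h3 := V.bra2V_comp_bra1V23L θ ξ hR hR'
  rw [ContinuousLinearMap.comp_assoc] at h3
  rw [h3, ContinuousLinearMap.comp_assoc, V.bra2_comp_V_comp_delta hx, V.bra2_comp_delta_slice,
    comp_reassoc (V.V_comp_delta x), ContinuousLinearMap.comp_assoc,
    comp_reassoc (V.bra2_comp_ampR_of_mem hx ξ)]

variable {V}

theorem IsRegular.delta_comm_ampL (hr : V.IsRegular) (x : V.hatA) {U : H →L[ℂ] H}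
    (hU : U ∈ intertwiners (fun a : V.hatA => a.1)) :
    V.delta x.1 ∘L ampL b.op V.βhat V.βhat V.α U =
      ampL b.op V.βhat V.βhat V.α U ∘L V.delta x.1 :=
  fiber_comm_ampL (hr.delta_mem_fiber x.2) (V.id_intertwiners_βhat hU) fun a ha => hU ⟨a, ha⟩

theorem IsRegular.delta_comm_ampR (hr : V.IsRegular) (x : V.hatA) {U : H →L[ℂ] H}
    (hU : U ∈ intertwiners (fun a : V.hatA => a.1)) :
    V.delta x.1 ∘L ampR b.op V.βhat V.α V.α U =
      ampR b.op V.βhat V.α V.α U ∘L V.delta x.1 :=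
  fiber_comm_ampR (hr.delta_mem_fiber x.2) (V.id_intertwiners_α hU) fun a ha => hU ⟨a, ha⟩

/-- `(Δ̂_V * Id)(Δ̂_V(x)) = V₁₂* (Id ⊗ Δ̂_V(x)) V₁₂`. -/
theorem IsRegular.fiberMapsTo_left (hr : V.IsRegular) (x : V.hatA) :
    FiberMapsTo b.op V.βhat V.α V.srcβhβh V.α V.hatDelta (fun a : V.hatA => a.1) (V.delta x.1)
      (V.delta₂ x.1) := by
  intro S hS T hT
  have hS' : S ∈ rhoIntertwiners b.op.Bd V.βhat V.srcβhβh := V.delta_intertwiners_βhat hS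
  have hT' : T ∈ rhoIntertwiners b.op.B V.α V.α := V.id_intertwiners_α hT
  have hES := fun ξ => (ampL_comp (b := b.op) (γ := V.α) (V.bra1V_intertwines_βhat ξ) hS').symm
  have hET := fun ξ => ampL_comm_ampR (b := b.op) (γ := V.α) (V.bra1V_mem_βhat ξ).1 hT'
  have hU := fun ξ => hr.delta_comm_ampL x (V.bra1V_comp_intertwiner hS ξ)
  have hTx := hr.delta_comm_ampR x hT
  constructor
  · refine V.ext_bra1V_ampL fun ξ => ?_
    rw [comp_reassoc (V.bra1V_ampL_comp_delta₂ x.2 ξ), ContinuousLinearMap.comp_assoc,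
      ContinuousLinearMap.comp_assoc, comp_reassoc (hES ξ), comp_reassoc (hU ξ),
      ContinuousLinearMap.comp_assoc, hTx, comp_reassoc (hES ξ)]
  · refine V.ext_bra1V_ampL fun ξ => ?_
    rw [comp_reassoc (V.bra1V_ampL_comp_delta₂ x.2 ξ), ContinuousLinearMap.comp_assoc,
      ContinuousLinearMap.comp_assoc, comp_reassoc (hET ξ), comp_reassoc (hET ξ),
      ContinuousLinearMap.comp_assoc, ContinuousLinearMap.comp_assoc, comp_reassoc (hES ξ), hES ξ,
      comp_reassoc hTx, ContinuousLinearMap.comp_assoc, hU ξ]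

/-- `(Id * Δ̂_V)(Δ̂_V(x)) = V₁₂* (Id ⊗ Δ̂_V(x)) V₁₂` up to reassociation. -/
theorem IsRegular.fiberMapsTo_right (hr : V.IsRegular) (x : V.hatA) :
    FiberMapsTo b.op V.βhat V.α V.βhat V.srcαα (fun a : V.hatA => a.1) V.hatDelta (V.delta x.1)
      (toOp (assocU b.op b.op V.βhat V.α V.βhat V.α V.α_βhat V.βhat_α) ∘L V.delta₂ x.1 ∘L
        toOp (assocU b.op b.op V.βhat V.α V.βhat V.α V.α_βhat V.βhat_α).symm) := by
  intro S hS T hT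
  have hS' : S ∈ rhoIntertwiners b.op.Bd V.βhat V.βhat := V.id_intertwiners_βhat hS
  have hT' : T ∈ rhoIntertwiners b.op.B V.α V.srcαα := V.delta_intertwiners_α hT
  have hF : ∀ θ : V.α.carrier,
      ampR b.op V.βhat V.srcαα V.α (adjoint (ket1 b V.α V.β θ.1) ∘L toOp V.V) ∘L
        (toOp (assocU b.op b.op V.βhat V.α V.βhat V.α V.α_βhat V.βhat_α) ∘L V.delta₂ x.1 ∘L
          toOp (assocU b.op b.op V.βhat V.α V.βhat V.α V.α_βhat V.βhat_α).symm) =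
      V.delta x.1 ∘L
        ampR b.op V.βhat V.srcαα V.α (adjoint (ket1 b V.α V.β θ.1) ∘L toOp V.V) := by
    intro θ
    have h : V.bra1V23 θ ∘L
        toOp (assocU b.op b.op V.βhat V.α V.βhat V.α V.α_βhat V.βhat_α).symm =
        ampR b.op V.βhat V.srcαα V.α (adjoint (ket1 b V.α V.β θ.1) ∘L toOp V.V) := by
      unfold bra1V23
      rw [ContinuousLinearMap.comp_assoc, toOp_comp_symm, ContinuousLinearMap.comp_id]
    rw [← h, ContinuousLinearMap.comp_assoc, comp_reassoc (toOp_symm_comp _),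
      ContinuousLinearMap.id_comp, comp_reassoc (V.bra1V23_comp_delta₂ x.2 θ),
      ContinuousLinearMap.comp_assoc]
  have hFT := fun θ => (ampR_comp (b := b.op) (α := V.βhat) (V.bra1V_intertwines_α θ) hT').symm
  have hFS := fun θ => ampR_comm_ampL (b := b.op) hS' (V.bra1V_mem_α θ).1
  have hU := fun θ => hr.delta_comm_ampR x (V.bra1V_comp_intertwiner hT θ)
  have hSx := hr.delta_comm_ampL x hS
  constructor
  · refine V.ext_bra1V_ampR fun θ => ?_
    rw [comp_reassoc (hF θ), ContinuousLinearMap.comp_assoc,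
      ContinuousLinearMap.comp_assoc, comp_reassoc (hFS θ).symm, comp_reassoc (hFS θ).symm,
      ContinuousLinearMap.comp_assoc, ContinuousLinearMap.comp_assoc, comp_reassoc (hFT θ), hFT θ,
      comp_reassoc hSx, ContinuousLinearMap.comp_assoc, hU θ]
  · refine V.ext_bra1V_ampR fun θ => ?_
    rw [comp_reassoc (hF θ), ContinuousLinearMap.comp_assoc,
      ContinuousLinearMap.comp_assoc, comp_reassoc (hFT θ), comp_reassoc (hU θ),
      ContinuousLinearMap.comp_assoc, hSx, comp_reassoc (hFT θ)]

theorem IsRegular.isNormalHopf (hr : V.IsRegular) :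
    IsNormalHopf b.op V.α V.βhat V.βhat_α V.α_βhat V.hatA V.hatDelta where
  normal := hr.isJointlyNormal_hatDelta
  coassoc x := ⟨V.delta₂ x.1, hr.fiberMapsTo_left x, hr.fiberMapsTo_right x⟩

end PMU
end PMU

/-! ### Norm convergence of sums of slices -/

section Summability
variable {X Y Z W : Type*}
  [NormedAddCommGroup X] [InnerProductSpace ℂ X] [CompleteSpace X]
  [NormedAddCommGroup Y] [InnerProductSpace ℂ Y] [CompleteSpace Y]
  [NormedAddCommGroup Z] [InnerProductSpace ℂ Z] [CompleteSpace Z]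
  [NormedAddCommGroup W] [InnerProductSpace ℂ W] [CompleteSpace W]

theorem sum_norm_sq_le {I : Type*} (s : Finset I) (A : I → X →L[ℂ] Y) (x : X) :
    ∑ i ∈ s, ‖A i x‖ ^ 2 ≤ ‖∑ i ∈ s, adjoint (A i) ∘L A i‖ * ‖x‖ ^ 2 := by
  have h : ((∑ i ∈ s, ‖A i x‖ ^ 2 : ℝ) : ℂ) =
      ⟪x, (∑ i ∈ s, adjoint (A i) ∘L A i) x⟫_ℂ := by
    rw [sum_apply, inner_sum, Complex.ofReal_sum]
    refine Finset.sum_congr rfl fun i _ => ?_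
    rw [ContinuousLinearMap.comp_apply, ContinuousLinearMap.adjoint_inner_right,
      inner_self_eq_norm_sq_to_K]
    simp
  have h1 : ‖((∑ i ∈ s, ‖A i x‖ ^ 2 : ℝ) : ℂ)‖ = ∑ i ∈ s, ‖A i x‖ ^ 2 := by
    rw [Complex.norm_real, Real.norm_of_nonneg (by positivity)]
  rw [← h1, h]
  calc _ ≤ ‖x‖ * ‖(∑ i ∈ s, adjoint (A i) ∘L A i) x‖ := norm_inner_le_norm _ _
    _ ≤ ‖x‖ * (‖∑ i ∈ s, adjoint (A i) ∘L A i‖ * ‖x‖) := by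
      gcongr
      exact ContinuousLinearMap.le_opNorm _ _
    _ = _ := by ring

/-- The Cauchy–Schwarz inequality for sums of the form `∑ Aᵢ* T Bᵢ`. -/
theorem norm_sum_adjoint_comp_le {I : Type*} (s : Finset I) (A : I → X →L[ℂ] Y)
    (B : I → Z →L[ℂ] W) (T : W →L[ℂ] Y) :
    ‖∑ i ∈ s, adjoint (A i) ∘L T ∘L B i‖ ≤
      ‖T‖ * (√‖∑ i ∈ s, adjoint (A i) ∘L A i‖ * √‖∑ i ∈ s, adjoint (B i) ∘L B i‖) := by
  refine ContinuousLinearMap.opNorm_le_bound _ (by positivity) fun z => ?_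
  set v := (∑ i ∈ s, adjoint (A i) ∘L T ∘L B i) z with hv
  have h1 : ‖v‖ ^ 2 ≤ ∑ i ∈ s, ‖A i v‖ * (‖T‖ * ‖B i z‖) := by
    have h2 : ∀ u, ⟪u, v⟫_ℂ = ∑ i ∈ s, ⟪A i u, T (B i z)⟫_ℂ := by
      intro u
      rw [hv, sum_apply, inner_sum]
      refine Finset.sum_congr rfl fun i _ => ?_
      rw [ContinuousLinearMap.comp_apply, ContinuousLinearMap.adjoint_inner_right,
        ContinuousLinearMap.comp_apply]
    have h3 : ‖v‖ ^ 2 = ‖⟪v, v⟫_ℂ‖ := by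
      rw [inner_self_eq_norm_sq_to_K]
      simp
    rw [h3, h2]
    refine (norm_sum_le _ _).trans (Finset.sum_le_sum fun i _ => ?_)
    refine (norm_inner_le_norm _ _).trans ?_
    gcongr
    exact T.le_opNorm _
  have h4 : ∑ i ∈ s, ‖A i v‖ * (‖T‖ * ‖B i z‖) ≤
      ‖T‖ * ((√‖∑ i ∈ s, adjoint (A i) ∘L A i‖ * ‖v‖) *
        (√‖∑ i ∈ s, adjoint (B i) ∘L B i‖ * ‖z‖)) := by
    have h5 : ∑ i ∈ s, ‖A i v‖ * (‖T‖ * ‖B i z‖) = ‖T‖ * ∑ i ∈ s, ‖A i v‖ * ‖B i z‖ := by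
      rw [Finset.mul_sum]
      exact Finset.sum_congr rfl fun i _ => by ring
    have h6 : ∀ {r t : ℝ}, 0 ≤ t → √r * t = √(r * t ^ 2) := fun ht => by
      rw [Real.sqrt_mul' _ (by positivity), Real.sqrt_sq ht]
    rw [h5, h6 (norm_nonneg v), h6 (norm_nonneg z)]
    gcongr
    refine (Real.sum_mul_le_sqrt_mul_sqrt _ _ _).trans ?_
    gcongr
    · exact sum_norm_sq_le s A v
    · exact sum_norm_sq_le s B z
  by_cases hv0 : ‖v‖ = 0
  · rw [hv0]
    positivity
  · have hvp : 0 < ‖v‖ := lt_of_le_of_ne (norm_nonneg _) (Ne.symm hv0)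
    refine le_of_mul_le_mul_right ?_ hvp
    calc ‖v‖ * ‖v‖ = ‖v‖ ^ 2 := by ring
      _ ≤ _ := h1.trans h4
      _ = _ := by ring

theorem summable_adjoint_comp {I : Type*} {A : I → X →L[ℂ] Y} {B : I → Z →L[ℂ] W}
    (T : W →L[ℂ] Y) (hA : Summable fun i => adjoint (A i) ∘L A i)
    (hB : Summable fun i => adjoint (B i) ∘L B i) :
    Summable fun i => adjoint (A i) ∘L T ∘L B i := by
  classical
  rw [summable_iff_vanishing_norm] at hA hB ⊢
  intro ε hε
  have hδ : 0 < ε / (‖T‖ + 1) := by positivity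
  obtain ⟨s, hs⟩ := hA _ hδ
  obtain ⟨t, ht⟩ := hB _ hδ
  refine ⟨s ∪ t, fun u hu => ?_⟩
  rw [Finset.disjoint_union_right] at hu
  refine (norm_sum_adjoint_comp_le u A B T).trans_lt ?_
  calc _ ≤ ‖T‖ * (√(ε / (‖T‖ + 1)) * √(ε / (‖T‖ + 1))) := by
        gcongr
        · exact (hs u hu.1).le
        · exact (ht u hu.2).le
    _ = ‖T‖ * (ε / (‖T‖ + 1)) := by rw [Real.mul_self_sqrt hδ.le]
    _ < (‖T‖ + 1) * (ε / (‖T‖ + 1)) := by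
        gcongr
        linarith
    _ = ε := by field_simp

end Summability

section Slices
variable {𝔎 H K : Type*}
  [NormedAddCommGroup 𝔎] [InnerProductSpace ℂ 𝔎] [CompleteSpace 𝔎]
  [NormedAddCommGroup H] [InnerProductSpace ℂ H] [CompleteSpace H]
  [NormedAddCommGroup K] [InnerProductSpace ℂ K] [CompleteSpace K]
  {b : CBase 𝔎}

/-- Since `∑ ⟨ξₙ|₂ |ξₙ⟩₂ = ∑ ρ(ξₙ* ξₙ)` and `ρ` is contractive, the summability of `ξₙ* ξₙ`
suffices. -/
theorem summable_ket2 {γ : CModule b.B K} {β : CModule b.Bd H} {ξ : ℕ → β.carrier}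
    (hξ : ξ ∈ seqSpace β) :
    Summable fun n => adjoint (ket2 b γ β (ξ n)) ∘L ket2 b γ β (ξ n) := by
  have hsum : ∀ t : Finset ℕ, ∑ n ∈ t, adjoint (ket2 b γ β (ξ n)) ∘L ket2 b γ β (ξ n) =
      γ.rhoL (∑ n ∈ t, ⟨_, commB b (β.gram_mem (ξ n).2 (ξ n).2)⟩) := fun t => by
    rw [map_sum]
    exact Finset.sum_congr rfl fun n _ => ket2_adjoint_comp b γ β (ξ n) (ξ n)
  have hξ' : Summable fun k => adjoint (ξ k).1 ∘L (ξ k).1 := hξ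
  rw [summable_iff_vanishing_norm] at hξ' ⊢
  intro ε hε
  obtain ⟨s, hs⟩ := hξ' ε hε
  refine ⟨s, fun t ht => ?_⟩
  rw [hsum]
  refine lt_of_le_of_lt ?_ (hs t ht)
  refine (γ.norm_rho_le (Subtype.prop (∑ n ∈ t,
    (⟨_, commB b (β.gram_mem (ξ n).2 (ξ n).2)⟩ : CModule.commutant b.B)))).trans_eq ?_
  rw [Submodule.coe_sum]

theorem summable_slice {δ : CModule b.Bd K} {γ : CModule b.B K} {α : CModule b.B H}
    {β : CModule b.Bd H} (X : RTP b.op δ α →L[ℂ] RTP b γ β) {ξ : ℕ → β.carrier}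
    {η : ℕ → α.carrier} (hξ : ξ ∈ seqSpace β) (hη : η ∈ seqSpace α) :
    Summable fun n => adjoint (ket2 b γ β (ξ n)) ∘L X ∘L ket2 b.op δ α (η n) :=
  summable_adjoint_comp X (summable_ket2 hξ) (summable_ket2 (b := b.op) hη)

end Slices

section PMU
variable {𝔎 H : Type*}
  [NormedAddCommGroup 𝔎] [InnerProductSpace ℂ 𝔎] [CompleteSpace 𝔎]
  [NormedAddCommGroup H] [InnerProductSpace ℂ H] [CompleteSpace H]

namespace PMU
variable {b : CBase 𝔎} (V : PMU b H)

/-! ### The maps `π̂_V` and `π̂_1` -/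

/-- The operators `⟨κ|₁ V |κ'⟩₁` belong to `ρ_β̂(𝔅)'`. -/
def commSlice (κ : V.α.carrier) (κ' : V.βhat.carrier) : V.comm :=
  ⟨adjoint (ket1 b V.α V.β κ.1) ∘L toOp V.V ∘L ket1 b.op V.βhat V.α κ'.1, fun _ hc =>
    (CModule.rho_comm_of_semiMor (mor_comp (V.bra1V_mem_βhat κ)
      (ket1_mem_mor (b := b.op) V.βhat V.α_βhat κ')).1 (commB b.op hc)).symm⟩

theorem adjoint_comp_slice_comp (ξ : V.β.carrier) (φ κ : V.α.carrier) (κ' : V.βhat.carrier) :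
    adjoint κ.1 ∘L V.slice ξ φ ∘L κ'.1 = adjoint ξ.1 ∘L (V.commSlice κ κ').1 ∘L φ.1 := by
  have h1 := congrArg adjoint (ket2_comp_ket1 (b := b) ξ κ)
  rw [ContinuousLinearMap.adjoint_comp, ContinuousLinearMap.adjoint_comp] at h1
  have h2 := ket2_comp_ket1 (b := b.op) φ κ'
  unfold slice commSlice
  rw [ContinuousLinearMap.comp_assoc, ContinuousLinearMap.comp_assoc, h2, comp_reassoc h1,
    ContinuousLinearMap.comp_assoc, ContinuousLinearMap.comp_assoc, ContinuousLinearMap.comp_assoc]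

/-- The matrix coefficients of `∑ₙ ⟨ξₙ|₂ V |ηₙ⟩₂` are values of `ω_{ξ,η}`. -/
theorem adjoint_comp_tsum_comp {ξ : ℕ → V.β.carrier} {η : ℕ → V.α.carrier}
    (hξ : ξ ∈ seqSpace V.β) (hη : η ∈ seqSpace V.α) (κ : V.α.carrier) (κ' : V.βhat.carrier) :
    adjoint κ.1 ∘L (∑' n, V.slice (ξ n) (η n)) ∘L κ'.1 = V.omega ξ η (V.commSlice κ κ') := by
  let F : (H →L[ℂ] H) →L[ℂ] (𝔎 →L[ℂ] 𝔎) := (ContinuousLinearMap.compL ℂ 𝔎 H 𝔎 (adjoint κ.1)) ∘L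
    (ContinuousLinearMap.compL ℂ 𝔎 H H).flip κ'.1
  have h : HasSum (fun n => F (V.slice (ξ n) (η n))) (F (∑' n, V.slice (ξ n) (η n))) :=
    F.hasSum (summable_slice (toOp V.V) hξ hη).hasSum
  refine h.tsum_eq.symm.trans ?_
  exact tsum_congr fun n => V.adjoint_comp_slice_comp (ξ n) (η n) κ κ'

/-- The sum `∑ ⟨ξₙ|₂ V |ηₙ⟩₂` converges to the value of `π̂_V`, which is defined by some choice of
sequences: by `adjoint_comp_tsum_comp`, the sum does not depend on this choice. -/
theorem hasSum_piV {ξ : ℕ → V.β.carrier} {η : ℕ → V.α.carrier} (hξ : ξ ∈ seqSpace V.β)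
    (hη : η ∈ seqSpace V.α) :
    HasSum (fun n => V.slice (ξ n) (η n)) (V.piV (V.omega ξ η)) := by
  have h : ∃ p : (ℕ → V.β.carrier) × (ℕ → V.α.carrier),
      p.1 ∈ seqSpace V.β ∧ p.2 ∈ seqSpace V.α ∧ V.omega p.1 p.2 = V.omega ξ η :=
    ⟨(ξ, η), hξ, hη, rfl⟩
  have h1 : V.piV (V.omega ξ η) = ∑' n, V.slice (h.choose.1 n) (h.choose.2 n) := by
    unfold piV piHat
    rw [dif_pos h]
    rfl
  obtain ⟨h2, h3, h4⟩ := h.choose_spec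
  have h5 : ∑' n, V.slice (h.choose.1 n) (h.choose.2 n) = ∑' n, V.slice (ξ n) (η n) := by
    refine V.βhat.ext_comp fun κ' hκ' => V.α.ext_adjoint_comp fun κ hκ => ?_
    rw [V.adjoint_comp_tsum_comp h2 h3 ⟨κ, hκ⟩ ⟨κ', hκ'⟩,
      V.adjoint_comp_tsum_comp hξ hη ⟨κ, hκ⟩ ⟨κ', hκ'⟩, h4]
  rw [h1, h5]
  exact (summable_slice (toOp V.V) hξ hη).hasSum

/-- The slices of the trivial representation are `⟨ξ|₂ 1 |η⟩₂ = ξ* η`. -/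
theorem bra2_comp_triv_comp_ket2 (ξ : V.β.carrier) (η : V.α.carrier) :
    adjoint (ket2 b b.base V.β ξ) ∘L toOp V.triv ∘L ket2 b.op b.op.base V.α η =
      adjoint ξ.1 ∘L η.1 := by
  have h1 : toOp V.triv = toOp (unitR b V.β).symm ∘L toOp (unitR b.op V.α) := rfl
  have h2 := congrArg adjoint (unitR_comp_ket2 (b := b) ξ)
  rw [ContinuousLinearMap.adjoint_comp, adjoint_toOp] at h2
  rw [h1, ContinuousLinearMap.comp_assoc, unitR_comp_ket2 (b := b.op) η, comp_reassoc h2]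

theorem hatOne_eq : V.hatOne =
    cspan {T | ∃ (ξ : V.β.carrier) (η : V.α.carrier), adjoint ξ.1 ∘L η.1 = T} := by
  unfold hatOne legSpace
  congr 1
  ext T
  simp only [V.bra2_comp_triv_comp_ket2]

/-- `π̂_1(ω) = ω(Id)`. -/
theorem hasSum_piOne {ξ : ℕ → V.β.carrier} {η : ℕ → V.α.carrier} (hξ : ξ ∈ seqSpace V.β)
    (hη : η ∈ seqSpace V.α) :
    HasSum (fun n => adjoint (ξ n).1 ∘L (η n).1) (V.piOne (V.omega ξ η)) := by
  have h : ∃ p : (ℕ → V.β.carrier) × (ℕ → V.α.carrier),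
      p.1 ∈ seqSpace V.β ∧ p.2 ∈ seqSpace V.α ∧ V.omega p.1 p.2 = V.omega ξ η :=
    ⟨(ξ, η), hξ, hη, rfl⟩
  have h1 : V.piOne (V.omega ξ η) = ∑' n, adjoint (h.choose.1 n).1 ∘L (h.choose.2 n).1 := by
    unfold piOne piHat
    rw [dif_pos h]
    exact tsum_congr fun n => V.bra2_comp_triv_comp_ket2 _ _
  obtain ⟨-, -, h4⟩ := h.choose_spec
  have h5 : ∑' n, adjoint (h.choose.1 n).1 ∘L (h.choose.2 n).1 =
      ∑' n, adjoint (ξ n).1 ∘L (η n).1 :=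
    -- evaluation of both functionals at the identity, which belongs to `ρ_β̂(𝔅)'`
    congrFun h4 ⟨ContinuousLinearMap.id ℂ H, fun _ _ => rfl⟩
  rw [h1, h5]
  have h6 := summable_slice (toOp V.triv) hξ hη
  simp only [V.bra2_comp_triv_comp_ket2] at h6
  exact h6.hasSum

end PMU
end PMU

section PMU
variable {𝔎 H : Type*}
  [NormedAddCommGroup 𝔎] [InnerProductSpace ℂ 𝔎] [CompleteSpace 𝔎]
  [NormedAddCommGroup H] [InnerProductSpace ℂ H] [CompleteSpace H]

/-! ### Fixed elements and the counit -/

theorem rho_comp_of_mem_multipliers {b : CBase 𝔎} {γ : CModule b.B H} {T : 𝔎 →L[ℂ] H}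
    (hT : T ∈ γ.multipliers) {c : 𝔎 →L[ℂ] 𝔎} (hc : c ∈ b.Bd) : γ.rho c ∘L T = T ∘L c := by
  refine b.base.ext_comp fun a ha => ?_
  have h1 : a ∘L c = c ∘L a := commB b hc a ha
  rw [ContinuousLinearMap.comp_assoc, γ.rho_comp (commB b hc) (hT.1 a ha),
    ContinuousLinearMap.comp_assoc, h1, ContinuousLinearMap.comp_assoc]

namespace PMU
variable {b : CBase 𝔎} {V : PMU b H} {η₀ : 𝔎 →L[ℂ] H}

theorem rho_α_comp_fix (h : η₀ ∈ V.Fix) {c : 𝔎 →L[ℂ] 𝔎} (hc : c ∈ b.Bd) :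
    V.α.rho c ∘L η₀ = η₀ ∘L c := rho_comp_of_mem_multipliers h.2.1 hc

theorem rho_βhat_comp_fix (h : η₀ ∈ V.Fix) {c : 𝔎 →L[ℂ] 𝔎} (hc : c ∈ b.B) :
    V.βhat.rho c ∘L η₀ = η₀ ∘L c := rho_comp_of_mem_multipliers (b := b.op) h.1 hc

theorem ket1_fix_comp (h : η₀ ∈ V.Fix) (ξ : V.β.carrier) :
    ket1 b V.α V.β η₀ ∘L ξ.1 = ket2 b V.α V.β ξ ∘L η₀ := by
  ext ζ
  exact ket1_apply' b V.α V.β (fun _ hc => rho_α_comp_fix h hc) ξ ζ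

theorem ket1_fix_comp' (h : η₀ ∈ V.Fix) (φ : V.α.carrier) :
    ket1 b.op V.βhat V.α η₀ ∘L φ.1 = ket2 b.op V.βhat V.α φ ∘L η₀ := by
  ext ζ
  exact ket1_apply' b.op V.βhat V.α (fun _ hc => rho_βhat_comp_fix h hc) φ ζ

theorem bra2_comp_ket1_fix (h : η₀ ∈ V.Fix) (ξ : V.β.carrier) :
    adjoint (ket2 b V.α V.β ξ) ∘L ket1 b V.α V.β η₀ = η₀ ∘L adjoint ξ.1 := by
  refine V.β.ext_comp fun ξ' hξ' => ?_
  rw [ContinuousLinearMap.comp_assoc, ket1_fix_comp h ⟨ξ', hξ'⟩,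
    comp_reassoc (ket2_adjoint_comp b V.α V.β ξ ⟨ξ', hξ'⟩),
    rho_α_comp_fix h (V.β.gram_mem ξ.2 hξ'), ContinuousLinearMap.comp_assoc]

/-- `⟨ξ|₂ V |φ⟩₂ η₀ = ⟨ξ|₂ V |η₀⟩₁ φ = ⟨ξ|₂ |η₀⟩₁ φ = η₀ ξ* φ` for a fixed element `η₀`. -/
theorem slice_comp_fix (h : η₀ ∈ V.Fix) (ξ : V.β.carrier) (φ : V.α.carrier) :
    V.slice ξ φ ∘L η₀ = η₀ ∘L adjoint ξ.1 ∘L φ.1 := by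
  unfold slice
  rw [ContinuousLinearMap.comp_assoc, ContinuousLinearMap.comp_assoc, ← ket1_fix_comp' h,
    comp_reassoc h.2.2, comp_reassoc (bra2_comp_ket1_fix h ξ), ContinuousLinearMap.comp_assoc]

theorem adjoint_fix_comp_slice_comp_fix (h : η₀ ∈ V.Fix)
    (h₁ : adjoint η₀ ∘L η₀ = ContinuousLinearMap.id ℂ 𝔎) (ξ : V.β.carrier) (φ : V.α.carrier) :
    adjoint η₀ ∘L V.slice ξ φ ∘L η₀ = adjoint ξ.1 ∘L φ.1 := by
  rw [slice_comp_fix h, comp_reassoc h₁, ContinuousLinearMap.id_comp]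

/-- `x η₀ = η₀ (η₀* x η₀)`; this is the reason why `x ↦ η₀* x η₀` is multiplicative. -/
theorem comp_fix_of_mem (h : η₀ ∈ V.Fix)
    (h₁ : adjoint η₀ ∘L η₀ = ContinuousLinearMap.id ℂ 𝔎) {x : H →L[ℂ] H} (hx : x ∈ V.hatA) :
    x ∘L η₀ = η₀ ∘L (adjoint η₀ ∘L x ∘L η₀) := by
  refine eqOn_cspan ((ContinuousLinearMap.compL ℂ 𝔎 H H).flip η₀)
    ((ContinuousLinearMap.compL ℂ 𝔎 𝔎 H η₀) ∘L (ContinuousLinearMap.compL ℂ 𝔎 H 𝔎 (adjoint η₀)) ∘L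
      (ContinuousLinearMap.compL ℂ 𝔎 H H).flip η₀) ?_ hx
  rintro _ ⟨ξ, φ, rfl⟩
  change V.slice ξ φ ∘L η₀ = η₀ ∘L (adjoint η₀ ∘L V.slice ξ φ ∘L η₀)
  rw [adjoint_fix_comp_slice_comp_fix h h₁, slice_comp_fix h]

theorem adjoint_fix_comp_comp_fix_mem (h : η₀ ∈ V.Fix)
    (h₁ : adjoint η₀ ∘L η₀ = ContinuousLinearMap.id ℂ 𝔎) {x : H →L[ℂ] H} (hx : x ∈ V.hatA) :
    adjoint η₀ ∘L x ∘L η₀ ∈ V.hatOne := by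
  have h2 : IsClosed (V.hatOne : Set (𝔎 →L[ℂ] 𝔎)) := isClosed_cspan _
  refine map_mem_of_mem_cspan h2 ((ContinuousLinearMap.compL ℂ 𝔎 H 𝔎 (adjoint η₀)) ∘L
      (ContinuousLinearMap.compL ℂ 𝔎 H H).flip η₀) ?_ hx
  rintro _ ⟨ξ, φ, rfl⟩
  change adjoint η₀ ∘L V.slice ξ φ ∘L η₀ ∈ _
  rw [adjoint_fix_comp_slice_comp_fix h h₁, hatOne_eq]
  exact subset_cspan ⟨ξ, φ, rfl⟩

theorem adjoint_fix_comp_comp_comp_fix (h : η₀ ∈ V.Fix)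
    (h₁ : adjoint η₀ ∘L η₀ = ContinuousLinearMap.id ℂ 𝔎) {y : H →L[ℂ] H} (x : H →L[ℂ] H)
    (hy : y ∈ V.hatA) :
    adjoint η₀ ∘L (x ∘L y) ∘L η₀ = (adjoint η₀ ∘L x ∘L η₀) ∘L (adjoint η₀ ∘L y ∘L η₀) := by
  rw [ContinuousLinearMap.comp_assoc x]
  conv_lhs => rw [comp_fix_of_mem h h₁ hy]
  simp only [ContinuousLinearMap.comp_assoc]

/-- `Â_1` is closed under multiplication: a product of generators `ξ* φ` is the image of a product
of slices of `V` under `x ↦ η₀* x η₀`. -/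
theorem hatOne_mul_mem (h : η₀ ∈ V.Fix)
    (h₁ : adjoint η₀ ∘L η₀ = ContinuousLinearMap.id ℂ 𝔎) {x y : 𝔎 →L[ℂ] 𝔎}
    (hx : x ∈ V.hatOne) (hy : y ∈ V.hatOne) : x ∘L y ∈ V.hatOne := by
  have hcl : IsClosed (V.hatOne : Set (𝔎 →L[ℂ] 𝔎)) := isClosed_cspan _
  rw [hatOne_eq] at hx hy
  refine comp_right_mem hcl y ?_ hx
  rintro _ ⟨ξ, φ, rfl⟩
  refine comp_left_mem hcl _ ?_ hy
  rintro _ ⟨ξ', φ', rfl⟩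
  rw [← adjoint_fix_comp_slice_comp_fix h h₁ ξ φ, ← adjoint_fix_comp_slice_comp_fix h h₁ ξ' φ',
    ← adjoint_fix_comp_comp_comp_fix h h₁ _ (V.slice_mem ξ' φ')]
  exact adjoint_fix_comp_comp_fix_mem h h₁ (V.hatA_mul_mem (V.slice_mem ξ φ) (V.slice_mem ξ' φ'))

/-- The counit `x ↦ η₀* x η₀` that is defined by a fixed isometry `η₀`. -/
def counit (h : η₀ ∈ V.Fix)
    (h₁ : adjoint η₀ ∘L η₀ = ContinuousLinearMap.id ℂ 𝔎) : V.hatA →ₗ[ℂ] V.hatOne where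
  toFun x := ⟨adjoint η₀ ∘L x.1 ∘L η₀, adjoint_fix_comp_comp_fix_mem h h₁ x.2⟩
  map_add' x y := Subtype.ext (by
    change adjoint η₀ ∘L (x.1 + y.1) ∘L η₀ = adjoint η₀ ∘L x.1 ∘L η₀ + adjoint η₀ ∘L y.1 ∘L η₀
    rw [ContinuousLinearMap.add_comp, ContinuousLinearMap.comp_add])
  map_smul' a x := Subtype.ext (by
    change adjoint η₀ ∘L (a • x.1) ∘L η₀ = a • (adjoint η₀ ∘L x.1 ∘L η₀)
    rw [ContinuousLinearMap.smul_comp, ContinuousLinearMap.comp_smul])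

theorem counit_apply (h : η₀ ∈ V.Fix)
    (h₁ : adjoint η₀ ∘L η₀ = ContinuousLinearMap.id ℂ 𝔎) (x : V.hatA) :
    (counit h h₁ x : 𝔎 →L[ℂ] 𝔎) = adjoint η₀ ∘L x.1 ∘L η₀ := rfl

theorem norm_adjoint_fix_comp_comp_fix_le (h₁ : adjoint η₀ ∘L η₀ = ContinuousLinearMap.id ℂ 𝔎)
    (x : H →L[ℂ] H) : ‖adjoint η₀ ∘L x ∘L η₀‖ ≤ ‖x‖ := by
  have h2 : ‖η₀‖ ≤ 1 := by
    refine norm_le_of_adjoint_comp_self zero_le_one ?_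
    rw [h₁, one_pow]
    exact ContinuousLinearMap.norm_id_le
  have h3 : ‖adjoint η₀‖ ≤ 1 := by rwa [LinearIsometryEquiv.norm_map]
  calc ‖adjoint η₀ ∘L x ∘L η₀‖ ≤ ‖adjoint η₀‖ * ‖x ∘L η₀‖ :=
        ContinuousLinearMap.opNorm_comp_le _ _
    _ ≤ ‖adjoint η₀‖ * (‖x‖ * ‖η₀‖) := by
      gcongr
      exact ContinuousLinearMap.opNorm_comp_le _ _
    _ ≤ 1 * (‖x‖ * 1) := by gcongr
    _ = ‖x‖ := by rw [one_mul, mul_one]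

theorem piV_mem {ξ : ℕ → V.β.carrier} {η : ℕ → V.α.carrier} (hξ : ξ ∈ seqSpace V.β)
    (hη : η ∈ seqSpace V.α) : V.piV (V.omega ξ η) ∈ V.hatA :=
  V.isClosed_hatA.mem_of_tendsto (V.hasSum_piV hξ hη) (Filter.Eventually.of_forall fun _ =>
    V.hatA.sum_mem fun _ _ => V.slice_mem _ _)

theorem adjoint_fix_comp_piV_comp_fix (h : η₀ ∈ V.Fix)
    (h₁ : adjoint η₀ ∘L η₀ = ContinuousLinearMap.id ℂ 𝔎) {ξ : ℕ → V.β.carrier}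
    {η : ℕ → V.α.carrier} (hξ : ξ ∈ seqSpace V.β) (hη : η ∈ seqSpace V.α) :
    adjoint η₀ ∘L V.piV (V.omega ξ η) ∘L η₀ = V.piOne (V.omega ξ η) := by
  have h3 := ((ContinuousLinearMap.compL ℂ 𝔎 H 𝔎 (adjoint η₀)) ∘L
    (ContinuousLinearMap.compL ℂ 𝔎 H H).flip η₀).hasSum (V.hasSum_piV hξ hη)
  have h4 : (fun n => adjoint (ξ n).1 ∘L (η n).1) =
      fun n => adjoint η₀ ∘L V.slice (ξ n) (η n) ∘L η₀ :=
    funext fun n => (adjoint_fix_comp_slice_comp_fix h h₁ _ _).symm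
  have h5 := V.hasSum_piOne hξ hη
  rw [h4] at h5
  exact h3.unique h5

theorem isCompatibleHom_counit (h : η₀ ∈ V.Fix)
    (h₁ : adjoint η₀ ∘L η₀ = ContinuousLinearMap.id ℂ 𝔎) :
    V.IsCompatibleHom (counit h h₁) where
  map_mul x y z hz := by
    rw [counit_apply, counit_apply, counit_apply, hz]
    exact adjoint_fix_comp_comp_comp_fix h h₁ x.1 y.2
  norm_le x := norm_adjoint_fix_comp_comp_fix_le h₁ x.1
  comp_piV := by
    rintro _ ⟨ξ, hξ, η, hη, rfl⟩
    exact ⟨piV_mem hξ hη, adjoint_fix_comp_piV_comp_fix h h₁ hξ hη⟩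

theorem single_mem_seqSpace {B : NonUnitalStarSubalgebra ℂ (𝔎 →L[ℂ] 𝔎)} (γ : CModule B H)
    (ξ : γ.carrier) : (Pi.single 0 ξ : ℕ → γ.carrier) ∈ seqSpace γ := by
  refine summable_of_ne_finset_zero (s := {0}) fun n hn => ?_
  rw [Pi.single_eq_of_ne (by simpa using hn)]
  exact ContinuousLinearMap.comp_zero _

/-- A compatible homomorphism is determined on slices, by the functionals `ω` of sequences with one
non-zero entry. -/
theorem IsCompatibleHom.apply_slice {ε : V.hatA →ₗ[ℂ] V.hatOne} (hε : V.IsCompatibleHom ε)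
    (ξ : V.β.carrier) (φ : V.α.carrier) :
    (ε ⟨V.slice ξ φ, V.slice_mem ξ φ⟩ : 𝔎 →L[ℂ] 𝔎) = adjoint ξ.1 ∘L φ.1 := by
  have h1 := single_mem_seqSpace V.β ξ
  have h2 := single_mem_seqSpace V.α φ
  have h3 : V.piV (V.omega (Pi.single 0 ξ) (Pi.single 0 φ)) = V.slice ξ φ := by
    refine (V.hasSum_piV h1 h2).unique ?_
    convert hasSum_single 0 fun n hn => ?_ using 1
    · rw [Pi.single_eq_same, Pi.single_eq_same]
    · rw [Pi.single_eq_of_ne hn, Pi.single_eq_of_ne hn]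
      have h4 : ket2 b.op V.βhat V.α 0 = 0 := (ket2L b.op V.βhat V.α).map_zero
      unfold slice
      rw [h4, ContinuousLinearMap.comp_zero, ContinuousLinearMap.comp_zero]
  have h5 : V.piOne (V.omega (Pi.single 0 ξ) (Pi.single 0 φ)) = adjoint ξ.1 ∘L φ.1 := by
    refine (V.hasSum_piOne h1 h2).unique ?_
    convert hasSum_single 0 fun n hn => ?_ using 1
    · rw [Pi.single_eq_same, Pi.single_eq_same]
    · rw [Pi.single_eq_of_ne hn, Pi.single_eq_of_ne hn]
      exact ContinuousLinearMap.comp_zero _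
  obtain ⟨h6, h7⟩ := hε.comp_piV _ ⟨_, h1, _, h2, rfl⟩
  rw [h5] at h7
  rw [← h7]
  congr 2
  exact Subtype.ext h3.symm

theorem IsCompatibleHom.ext {ε ε' : V.hatA →ₗ[ℂ] V.hatOne} (hε : V.IsCompatibleHom ε)
    (hε' : V.IsCompatibleHom ε') : ε = ε' := by
  let F : V.hatA →L[ℂ] V.hatOne := ε.mkContinuous 1 fun x => by rw [one_mul]; exact hε.norm_le x
  let F' : V.hatA →L[ℂ] V.hatOne :=
    ε'.mkContinuous 1 fun x => by rw [one_mul]; exact hε'.norm_le x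
  ext1 x
  exact eq_of_mem_cspan V.isClosed_hatA F F' (S := {T | ∃ ξ φ, V.slice ξ φ = T})
    (by rintro _ ⟨ξ, φ, rfl⟩; exact V.slice_mem ξ φ)
    (by
      rintro _ ⟨ξ, φ, rfl⟩
      exact Subtype.ext ((hε.apply_slice ξ φ).trans (hε'.apply_slice ξ φ).symm)) x.2 x.2

end PMU
end PMU

section PMU
variable {𝔎 H : Type*}
  [NormedAddCommGroup 𝔎] [InnerProductSpace ℂ 𝔎] [CompleteSpace 𝔎]
  [NormedAddCommGroup H] [InnerProductSpace ℂ H] [CompleteSpace H]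

/-! ### The algebras of a `C*`-base as modules -/

theorem base_rho (b : CBase 𝔎) {c : 𝔎 →L[ℂ] 𝔎} (hc : ∀ a ∈ b.B, a * c = c * a) :
    b.base.rho c = c := by
  refine b.base.ext_comp fun a ha => ?_
  rw [b.base.rho_comp hc ha]
  exact hc a ha

theorem acts_base (b : CBase 𝔎) : Acts b.Bd b.base b.op.base.carrier := by
  refine Eq.trans ?_ b.op.base.mul_base
  congr 1
  ext T
  constructor
  · rintro ⟨c, hc, d, hd, rfl⟩
    rw [base_rho b (commB b hc)]
    exact ⟨c, hc, d, hd, rfl⟩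
  · rintro ⟨c, hc, d, hd, rfl⟩
    refine ⟨c, hc, d, hd, ?_⟩
    rw [base_rho b (commB b hc)]

theorem IsJointlyNormal.isJointlySemiNormal {K : Type*} [NormedAddCommGroup K]
    [InnerProductSpace ℂ K] [CompleteSpace K] {c : CBase 𝔎} {β : CModule c.Bd H}
    {α : CModule c.B H} {A : Submodule ℂ (H →L[ℂ] H)} {δ : CModule c.Bd K} {γ : CModule c.B K}
    {C : Submodule ℂ (K →L[ℂ] K)} {π : A → K →L[ℂ] K}
    (h : IsJointlyNormal c β α A δ γ C π) : IsJointlySemiNormal c β α A δ γ C π where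
  source := h.source
  target := h.target
  hom := h.hom
  span_β := by
    refine le_antisymm (cspan_le δ.isClosed_carrier ?_) ?_
    · rintro _ ⟨S, ⟨-, hS, -⟩, ξ, hξ, rfl⟩
      exact hS ξ hξ
    · conv_lhs => rw [← h.span_β]
      refine cspan_mono ?_
      rintro _ ⟨S, ⟨hS, hS₁, hS₂⟩, ξ, hξ, rfl⟩
      exact ⟨S, ⟨hS, hS₁.1, hS₂.1⟩, ξ, hξ, rfl⟩
  span_α := by
    refine le_antisymm (cspan_le γ.isClosed_carrier ?_) ?_
    · rintro _ ⟨S, ⟨-, -, hS⟩, ξ, hξ, rfl⟩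
      exact hS ξ hξ
    · conv_lhs => rw [← h.span_α]
      refine cspan_mono ?_
      rintro _ ⟨S, ⟨hS, hS₁, hS₂⟩, ξ, hξ, rfl⟩
      exact ⟨S, ⟨hS, hS₁.1, hS₂.1⟩, ξ, hξ, rfl⟩

namespace PMU
variable {b : CBase 𝔎} {V : PMU b H} {η₀ : 𝔎 →L[ℂ] H}

/-! ### Normality of the counit -/

theorem comp_hatOne_mem {d : 𝔎 →L[ℂ] 𝔎} (hd : d ∈ b.Bd) {x : 𝔎 →L[ℂ] 𝔎} (hx : x ∈ V.hatOne) :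
    d ∘L x ∈ V.hatOne := by
  rw [hatOne_eq] at hx ⊢
  refine comp_left_mem (isClosed_cspan _) d ?_ hx
  rintro _ ⟨ξ, φ, rfl⟩
  refine subset_cspan ⟨⟨ξ.1 ∘L adjoint d, V.β.comp_mem ξ.2 (star_mem (s := b.Bd) hd)⟩, φ, ?_⟩
  rw [ContinuousLinearMap.adjoint_comp, ContinuousLinearMap.adjoint_adjoint,
    ContinuousLinearMap.comp_assoc]

theorem base_comp_hatOne_mem {c : 𝔎 →L[ℂ] 𝔎} (hc : c ∈ b.B) {x : 𝔎 →L[ℂ] 𝔎}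
    (hx : x ∈ V.hatOne) : c ∘L x ∈ V.hatOne := by
  have hc' := commB b.op hc
  have hcs := CModule.adjoint_mem_commutant hc'
  rw [hatOne_eq] at hx ⊢
  refine comp_left_mem (isClosed_cspan _) c ?_ hx
  rintro _ ⟨ξ, φ, rfl⟩
  refine subset_cspan ⟨ξ, ⟨V.β.rho c ∘L φ.1, V.β_α.comp_mem hc φ.2⟩, ?_⟩
  have h1 := congrArg adjoint (V.β.rho_comp hcs ξ.2)
  rw [ContinuousLinearMap.adjoint_comp, ContinuousLinearMap.adjoint_comp, V.β.adjoint_rho hcs,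
    ContinuousLinearMap.adjoint_adjoint] at h1
  rw [comp_reassoc h1, ContinuousLinearMap.comp_assoc]

theorem adjoint_counit (h : η₀ ∈ V.Fix) (h₁ : adjoint η₀ ∘L η₀ = ContinuousLinearMap.id ℂ 𝔎)
    (x y : V.hatA) (hy : y.1 = adjoint x.1) :
    (counit h h₁ y : 𝔎 →L[ℂ] 𝔎) = adjoint (counit h h₁ x : 𝔎 →L[ℂ] 𝔎) := by
  rw [counit_apply, counit_apply, ContinuousLinearMap.adjoint_comp,
    ContinuousLinearMap.adjoint_comp, ContinuousLinearMap.adjoint_adjoint, hy,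
    ContinuousLinearMap.comp_assoc]

theorem IsRegular.adjoint_mem_hatOne (hr : V.IsRegular) (h : η₀ ∈ V.Fix)
    (h₁ : adjoint η₀ ∘L η₀ = ContinuousLinearMap.id ℂ 𝔎) {x : 𝔎 →L[ℂ] 𝔎} (hx : x ∈ V.hatOne) :
    adjoint x ∈ V.hatOne := by
  suffices V.hatOne ≤ adjointSub V.hatOne from this hx
  conv_lhs => rw [hatOne_eq]
  refine cspan_le (isClosed_adjointSub (isClosed_cspan _)) ?_
  rintro _ ⟨ξ, φ, rfl⟩
  rw [mem_adjointSub, ← adjoint_fix_comp_slice_comp_fix h h₁ ξ φ]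
  have h2 := adjoint_counit h h₁ ⟨_, V.slice_mem ξ φ⟩ ⟨_, hr.adjoint_mem (V.slice_mem ξ φ)⟩ rfl
  rw [counit_apply h h₁ ⟨_, V.slice_mem ξ φ⟩] at h2
  rw [← h2]
  exact Subtype.property _

theorem IsRegular.isBiAlgebra_hatOne (hr : V.IsRegular) (h : η₀ ∈ V.Fix)
    (h₁ : adjoint η₀ ∘L η₀ = ContinuousLinearMap.id ℂ 𝔎) :
    IsBiAlgebra b.op b.base b.op.base V.hatOne where
  acts_α := acts_base b
  acts_β := acts_base b.op
  closed := isClosed_cspan _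
  mul_mem _ hx _ hy := hatOne_mul_mem h h₁ hx hy
  star_mem _ hx := hr.adjoint_mem_hatOne h h₁ hx
  rho_β_mem d hd x hx := by
    rw [base_rho b (commB b hd)]
    exact comp_hatOne_mem hd hx
  rho_α_mem d hd x hx := by
    rw [base_rho b.op (commB b.op hd)]
    exact base_comp_hatOne_mem hd hx

theorem isStarHom_counit (h : η₀ ∈ V.Fix) (h₁ : adjoint η₀ ∘L η₀ = ContinuousLinearMap.id ℂ 𝔎)
    {C : Submodule ℂ (𝔎 →L[ℂ] 𝔎)} (hC : V.hatOne ≤ C) :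
    IsStarHom V.hatA C (fun x => (counit h h₁ x : 𝔎 →L[ℂ] 𝔎)) where
  mem x := hC (counit h h₁ x).2
  add x y := by rw [map_add]; rfl
  smul a x := by rw [map_smul]; rfl
  mul x y z hz := (isCompatibleHom_counit h h₁).map_mul x y z hz
  star x y hy := adjoint_counit h h₁ x y hy

/-- The adjoint of a fixed isometry `η₀` intertwines the identity and the counit. -/
theorem IsRegular.adjoint_fix_mem_intertwiners (hr : V.IsRegular) (h : η₀ ∈ V.Fix)
    (h₁ : adjoint η₀ ∘L η₀ = ContinuousLinearMap.id ℂ 𝔎) :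
    adjoint η₀ ∈ intertwiners (fun x : V.hatA => (counit h h₁ x : 𝔎 →L[ℂ] 𝔎)) := by
  intro x
  have h2 := congrArg adjoint (comp_fix_of_mem h h₁ (hr.adjoint_mem x.2))
  simp only [ContinuousLinearMap.adjoint_comp, ContinuousLinearMap.adjoint_adjoint] at h2
  change adjoint η₀ ∘L x.1 = (adjoint η₀ ∘L x.1 ∘L η₀) ∘L adjoint η₀
  rw [h2]
  simp only [ContinuousLinearMap.comp_assoc]

theorem adjoint_fix_mem_mor_α (h : η₀ ∈ V.Fix) : adjoint η₀ ∈ mor V.α b.base :=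
  ⟨fun ξ hξ => h.2.1.2 ξ hξ, fun x hx => by
    rw [ContinuousLinearMap.adjoint_adjoint]
    exact h.2.1.1 x hx⟩

theorem adjoint_fix_mem_mor_βhat (h : η₀ ∈ V.Fix) : adjoint η₀ ∈ mor V.βhat b.op.base :=
  ⟨fun ξ hξ => h.1.2 ξ hξ, fun x hx => by
    rw [ContinuousLinearMap.adjoint_adjoint]
    exact h.1.1 x hx⟩

theorem IsRegular.isJointlyNormal_counit (hr : V.IsRegular) (h : η₀ ∈ V.Fix)
    (h₁ : adjoint η₀ ∘L η₀ = ContinuousLinearMap.id ℂ 𝔎) {C : Submodule ℂ (𝔎 →L[ℂ] 𝔎)}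
    (hC : V.hatOne ≤ C) (hC' : IsBiAlgebra b.op b.base b.op.base C) :
    IsJointlyNormal b.op V.α V.βhat V.hatA b.base b.op.base C
      (fun x => (counit h h₁ x : 𝔎 →L[ℂ] 𝔎)) where
  source := hr.isBiAlgebra_hatA
  target := hC'
  hom := isStarHom_counit h h₁ hC
  span_β := by
    refine le_antisymm (cspan_le b.base.isClosed_carrier ?_) fun x hx => ?_
    · rintro _ ⟨S, ⟨-, hS, -⟩, ξ, hξ, rfl⟩
      exact hS.1 ξ hξ
    · refine subset_cspan ⟨adjoint η₀, ⟨hr.adjoint_fix_mem_intertwiners h h₁,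
        adjoint_fix_mem_mor_α h, adjoint_fix_mem_mor_βhat h⟩, η₀ ∘L x, h.2.1.1 x hx, ?_⟩
      rw [comp_reassoc h₁, ContinuousLinearMap.id_comp]
  span_α := by
    refine le_antisymm (cspan_le b.op.base.isClosed_carrier ?_) fun x hx => ?_
    · rintro _ ⟨S, ⟨-, -, hS⟩, ξ, hξ, rfl⟩
      exact hS.1 ξ hξ
    · refine subset_cspan ⟨adjoint η₀, ⟨hr.adjoint_fix_mem_intertwiners h h₁,
        adjoint_fix_mem_mor_α h, adjoint_fix_mem_mor_βhat h⟩, η₀ ∘L x, h.1.1 x hx, ?_⟩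
      rw [comp_reassoc h₁, ContinuousLinearMap.id_comp]

/-- `L(𝔎)` is a `C*`-`(𝔟, 𝔟†)`-algebra. -/
theorem isBiAlgebra_top (b : CBase 𝔎) : IsBiAlgebra b.op b.base b.op.base ⊤ where
  acts_α := acts_base b
  acts_β := acts_base b.op
  closed := isClosed_univ
  mul_mem _ _ _ _ := trivial
  star_mem _ _ := trivial
  rho_β_mem _ _ _ _ := trivial
  rho_α_mem _ _ _ _ := trivial

/-! ### The counit property -/

/-- Intertwiners of the counit intertwine the representations of `𝔅`, because
`ε̂(ρ_β̂(c) x) = c ε̂(x)`; hence `S ⊗ Id` is defined for such an intertwiner `S`. -/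
theorem counit_intertwiners_βhat (h : η₀ ∈ V.Fix)
    (h₁ : adjoint η₀ ∘L η₀ = ContinuousLinearMap.id ℂ 𝔎) {S : H →L[ℂ] 𝔎}
    (hS : S ∈ intertwiners (fun x : V.hatA => (counit h h₁ x : 𝔎 →L[ℂ] 𝔎))) :
    S ∈ rhoIntertwiners b.B V.βhat b.op.base := fun c hc =>
  V.comp_eq_of_intertwiners hS fun x => ⟨V.rho_βhat_comp_mem hc x.2, by
    have h2 := congrArg adjoint (rho_βhat_comp_fix h (star_mem (s := b.B) hc))
    have h3 := commB b.op hc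
    rw [ContinuousLinearMap.adjoint_comp, ContinuousLinearMap.adjoint_comp] at h2
    change adjoint η₀ ∘L adjoint (V.βhat.rho (adjoint c)) = adjoint (adjoint c) ∘L _ at h2
    rw [V.βhat.adjoint_rho (CModule.adjoint_mem_commutant h3),
      ContinuousLinearMap.adjoint_adjoint] at h2
    rw [counit_apply, counit_apply, base_rho b.op h3, ContinuousLinearMap.comp_assoc,
      comp_reassoc h2, ContinuousLinearMap.comp_assoc]⟩

/-- Intertwiners of the counit intertwine the representations of `𝔅†`, because
`ε̂(ρ_α(c) x) = c ε̂(x)`; hence `Id ⊗ S` is defined for such an intertwiner `S`. -/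
theorem counit_intertwiners_α (h : η₀ ∈ V.Fix)
    (h₁ : adjoint η₀ ∘L η₀ = ContinuousLinearMap.id ℂ 𝔎) {S : H →L[ℂ] 𝔎}
    (hS : S ∈ intertwiners (fun x : V.hatA => (counit h h₁ x : 𝔎 →L[ℂ] 𝔎))) :
    S ∈ rhoIntertwiners b.Bd V.α b.base := fun c hc =>
  V.comp_eq_of_intertwiners hS fun x => ⟨V.rho_α_comp_mem hc x.2, by
    have h2 := congrArg adjoint (rho_α_comp_fix h (star_mem (s := b.Bd) hc))
    have h3 := commB b hc
    rw [ContinuousLinearMap.adjoint_comp, ContinuousLinearMap.adjoint_comp] at h2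
    change adjoint η₀ ∘L adjoint (V.α.rho (adjoint c)) = adjoint (adjoint c) ∘L _ at h2
    rw [V.α.adjoint_rho (CModule.adjoint_mem_commutant h3),
      ContinuousLinearMap.adjoint_adjoint] at h2
    rw [counit_apply, counit_apply, base_rho b h3, ContinuousLinearMap.comp_assoc,
      comp_reassoc h2, ContinuousLinearMap.comp_assoc]⟩

theorem unitR_comp_ampR (b : CBase 𝔎) {γ : CModule b.Bd H} {T : H →L[ℂ] H}
    (hT : T ∈ rhoIntertwiners b.B γ γ) :
    toOp (unitR b γ) ∘L ampR b b.base γ γ T = T ∘L toOp (unitR b γ) := by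
  refine ext_ket1 fun a => ?_
  rw [ContinuousLinearMap.comp_assoc, ContinuousLinearMap.comp_assoc, ampR_comp_ket1 hT,
    comp_reassoc (unitR_comp_ket1 a), unitR_comp_ket1, hT a.1 a.2]

theorem unitL_comp_ampL (b : CBase 𝔎) {α : CModule b.B H} {S : H →L[ℂ] H}
    (hS : S ∈ rhoIntertwiners b.Bd α α) :
    toOp (unitL b α) ∘L ampL b α α b.op.base S = S ∘L toOp (unitL b α) := by
  refine ext_ket2 fun a => ?_
  rw [ContinuousLinearMap.comp_assoc, ContinuousLinearMap.comp_assoc, ampL_comp_ket2 hS,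
    comp_reassoc (unitL_comp_ket2 a), unitL_comp_ket2, hS a.1 a.2]

/-- Evaluation of an identity between bounded linear maps `x ↦ E (F x)` and `x ↦ A x S`. -/
theorem comp_apply_eq_of_clm_eq {E₁ E₂ E₃ E₄ : Type*}
    [NormedAddCommGroup E₁] [NormedSpace ℂ E₁] [NormedAddCommGroup E₂] [NormedSpace ℂ E₂]
    [NormedAddCommGroup E₃] [NormedSpace ℂ E₃] [NormedAddCommGroup E₄] [NormedSpace ℂ E₄]
    {P : Submodule ℂ (E₄ →L[ℂ] E₂)} {E : E₂ →L[ℂ] E₃} {F : P →L[ℂ] (E₁ →L[ℂ] E₂)}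
    {S : E₁ →L[ℂ] E₄} {A : E₂ →L[ℂ] E₃}
    (h : (ContinuousLinearMap.compL ℂ E₁ E₂ E₃ E) ∘L F =
      ((ContinuousLinearMap.compL ℂ E₁ E₄ E₃).flip S) ∘L
        (ContinuousLinearMap.compL ℂ E₄ E₂ E₃ A) ∘L P.subtypeL) (x : P) :
    E ∘L F x = (A ∘L x.1) ∘L S :=
  DFunLike.congr_fun h x

section
variable {S : H →L[ℂ] 𝔎}

/-- Slices of `Δ̂_V(x)` in the first leg by an intertwiner of the counit. The identity is checked
on `|η⟩₂`, where both sides are continuous functions of `V |φ⟩₂ η ∈ α ▷ α` for `x = ⟨ξ|₂ V |φ⟩₂`;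
on generators `|θ⟩₁ κ` of `α ▷ α`, both equal `θ ξ* κ S`. -/
theorem unitR_comp_ampL_comp_delta (h : η₀ ∈ V.Fix)
    (h₁ : adjoint η₀ ∘L η₀ = ContinuousLinearMap.id ℂ 𝔎)
    (hS : S ∈ intertwiners (fun x : V.hatA => (counit h h₁ x : 𝔎 →L[ℂ] 𝔎)))
    {x : H →L[ℂ] H} (hx : x ∈ V.hatA) :
    x ∘L toOp (unitR b.op V.α) ∘L ampL b.op V.βhat b.op.base V.α S =
      toOp (unitR b.op V.α) ∘L ampL b.op V.βhat b.op.base V.α S ∘L V.delta x := by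
  have hS' : S ∈ rhoIntertwiners b.op.Bd V.βhat b.op.base := counit_intertwiners_βhat h h₁ hS
  obtain ⟨E, hE⟩ : ∃ E : V.Src →L[ℂ] H,
    E = toOp (unitR b.op V.α) ∘L ampL b.op V.βhat b.op.base V.α S := ⟨_, rfl⟩
  have hEk : ∀ η : V.α.carrier, E ∘L ket2 b.op V.βhat V.α η = η.1 ∘L S := fun η => by
    rw [hE, ContinuousLinearMap.comp_assoc, ampL_comp_ket2 (b := b.op) hS',
      comp_reassoc (unitR_comp_ket2 (b := b.op) η)]
  have hY : ∀ ξ : V.β.carrier, (ContinuousLinearMap.compL ℂ H V.Src H E) ∘L V.braV13L ξ =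
      ((ContinuousLinearMap.compL ℂ H 𝔎 H).flip S) ∘L
        (ContinuousLinearMap.compL ℂ 𝔎 V.Rng H (adjoint (ket2 b V.α V.β ξ))) ∘L
          V.rngαα.carrier.subtypeL := by
    intro ξ
    refine triR_clm_ext fun θ κ => ?_
    change E ∘L V.braV13L ξ ⟨ket1 b V.α V.β θ.1 ∘L κ.1, ket1_comp_mem V.α V.β_α θ κ.2⟩ =
      (adjoint (ket2 b V.α V.β ξ) ∘L (ket1 b V.α V.β θ.1 ∘L κ.1)) ∘L S
    have h2 : S ∘L V.slice ξ κ = (adjoint ξ.1 ∘L κ.1) ∘L S := by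
      rw [← adjoint_fix_comp_slice_comp_fix h h₁]
      exact hS ⟨_, V.slice_mem ξ κ⟩
    rw [V.braV13L_apply, comp_reassoc (hEk θ), ContinuousLinearMap.comp_assoc, h2,
      comp_reassoc (bra2_comp_ket1 ξ θ), ContinuousLinearMap.comp_assoc,
      ContinuousLinearMap.comp_assoc, ContinuousLinearMap.comp_assoc]
  have hslice : ∀ ξ φ, V.slice ξ φ ∘L E = E ∘L V.delta (V.slice ξ φ) := by
    intro ξ φ
    refine ext_ket2 (b := b.op) fun η => ?_
    rw [ContinuousLinearMap.comp_assoc, ContinuousLinearMap.comp_assoc, hEk,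
      V.delta_slice_comp_ket2]
    refine Eq.trans ?_ (DFunLike.congr_fun (hY ξ) (semiMorL V.V_mem_αα.1
      ⟨ket2 b.op V.βhat V.α φ ∘L η.1, ket2_comp_mem (b := b.op) V.α V.βhat_α φ η.2⟩)).symm
    rfl
  have h3 := eq_of_mem_cspan (isClosed_rhoIntertwiners V.β V.β)
    (((ContinuousLinearMap.compL ℂ V.Src H H).flip E) ∘L (rhoIntertwiners b.B V.β V.β).subtypeL)
    ((ContinuousLinearMap.compL ℂ V.Src V.Src H E) ∘L V.deltaL)
    (S := {T | ∃ ξ φ, V.slice ξ φ = T})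
    (by rintro _ ⟨ξ, φ, rfl⟩; exact V.hatA_le_rhoIntertwiners (V.slice_mem ξ φ))
    (by rintro _ ⟨ξ, φ, rfl⟩; exact hslice ξ φ) hx (V.hatA_le_rhoIntertwiners hx)
  rw [← ContinuousLinearMap.comp_assoc (toOp (unitR b.op V.α)), ← hE]
  exact h3

/-- Slices of `Δ̂_V(x)` in the second leg by an intertwiner of the counit. The identity is checked
on `|κ⟩₁`, where both sides are continuous functions of `V* |ξ⟩₂ κ ∈ β̂ ▷ β` for the adjoint `x` of
`⟨ξ|₂ V |φ⟩₂`; on generators `|κ'⟩₁ ξ'` of `β̂ ▷ β`, both equal `κ' φ* ξ' S`. -/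
theorem IsRegular.unitL_comp_ampR_comp_delta (hr : V.IsRegular) (h : η₀ ∈ V.Fix)
    (h₁ : adjoint η₀ ∘L η₀ = ContinuousLinearMap.id ℂ 𝔎)
    (hS : S ∈ intertwiners (fun x : V.hatA => (counit h h₁ x : 𝔎 →L[ℂ] 𝔎)))
    {x : H →L[ℂ] H} (hx : x ∈ V.hatA) :
    x ∘L toOp (unitL b.op V.βhat) ∘L ampR b.op V.βhat V.α b.base S =
      toOp (unitL b.op V.βhat) ∘L ampR b.op V.βhat V.α b.base S ∘L V.delta x := by
  have hS' : S ∈ rhoIntertwiners b.op.B V.α b.base := counit_intertwiners_α h h₁ hS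
  obtain ⟨E, hE⟩ : ∃ E : V.Src →L[ℂ] H,
    E = toOp (unitL b.op V.βhat) ∘L ampR b.op V.βhat V.α b.base S := ⟨_, rfl⟩
  have hEk : ∀ κ : V.βhat.carrier, E ∘L ket1 b.op V.βhat V.α κ.1 = κ.1 ∘L S := fun κ => by
    rw [hE, ContinuousLinearMap.comp_assoc, ampR_comp_ket1 (b := b.op) hS']
    exact comp_reassoc (unitL_comp_ket1 (b := b.op) κ) S
  have hW : ∀ φ : V.α.carrier, (ContinuousLinearMap.compL ℂ H V.Src H E) ∘L V.braVsymmL φ =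
      ((ContinuousLinearMap.compL ℂ H 𝔎 H).flip S) ∘L
        (ContinuousLinearMap.compL ℂ 𝔎 V.Src H (adjoint (ket2 b.op V.βhat V.α φ))) ∘L
          V.srcββ.carrier.subtypeL := by
    intro φ
    refine triR_clm_ext (b := b.op) fun κ ξ => ?_
    change E ∘L V.braVsymmL φ ⟨ket1 b.op V.βhat V.α κ.1 ∘L ξ.1,
        ket1_comp_mem (b := b.op) V.β V.α_β κ ξ.2⟩ =
      (adjoint (ket2 b.op V.βhat V.α φ) ∘L (ket1 b.op V.βhat V.α κ.1 ∘L ξ.1)) ∘L S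
    have h2 : S ∘L adjoint (V.slice ξ φ) = (adjoint φ.1 ∘L ξ.1) ∘L S := by
      have h3 := adjoint_counit h h₁ ⟨_, V.slice_mem ξ φ⟩
        ⟨_, hr.adjoint_mem (V.slice_mem ξ φ)⟩ rfl
      rw [counit_apply h h₁ ⟨_, V.slice_mem ξ φ⟩, adjoint_fix_comp_slice_comp_fix h h₁,
        ContinuousLinearMap.adjoint_comp, ContinuousLinearMap.adjoint_adjoint] at h3
      rw [← h3]
      exact hS ⟨_, hr.adjoint_mem (V.slice_mem ξ φ)⟩
    rw [V.braVsymmL_apply, comp_reassoc (hEk κ), ContinuousLinearMap.comp_assoc, h2,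
      comp_reassoc (bra2_comp_ket1 (b := b.op) φ κ), ContinuousLinearMap.comp_assoc,
      ContinuousLinearMap.comp_assoc, ContinuousLinearMap.comp_assoc]
  have hslice : ∀ ξ φ, adjoint (V.slice ξ φ) ∘L E = E ∘L V.delta (adjoint (V.slice ξ φ)) := by
    intro ξ φ
    refine ext_ket1 (b := b.op) fun κ => ?_
    rw [ContinuousLinearMap.comp_assoc, ContinuousLinearMap.comp_assoc, hEk,
      V.delta_adjoint_slice_comp_ket1, V.adjoint_slice]
    have h2 : E ∘L V.braVsymmL φ ⟨_, V.Vsymm_ket2_comp_mem ξ κ⟩ =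
        (adjoint (ket2 b.op V.βhat V.α φ) ∘L
          (toOp V.V.symm ∘L ket2 b V.α V.β ξ ∘L κ.1)) ∘L S :=
      comp_apply_eq_of_clm_eq (hW φ) ⟨_, V.Vsymm_ket2_comp_mem ξ κ⟩
    rw [h2]
    simp only [ContinuousLinearMap.comp_assoc]
  rw [hr.hatA_eq_cspan_adjoint] at hx
  have hle : ∀ ξ φ, adjoint (V.slice ξ φ) ∈ rhoIntertwiners b.B V.β V.β := fun ξ φ =>
    V.hatA_le_rhoIntertwiners (hr.adjoint_mem (V.slice_mem ξ φ))
  have hx' : x ∈ rhoIntertwiners b.B V.β V.β :=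
    cspan_le (isClosed_rhoIntertwiners V.β V.β) (by rintro _ ⟨ξ, φ, rfl⟩; exact hle ξ φ) hx
  have h3 := eq_of_mem_cspan (isClosed_rhoIntertwiners V.β V.β)
    (((ContinuousLinearMap.compL ℂ V.Src H H).flip E) ∘L (rhoIntertwiners b.B V.β V.β).subtypeL)
    ((ContinuousLinearMap.compL ℂ V.Src V.Src H E) ∘L V.deltaL)
    (S := {T | ∃ ξ φ, adjoint (V.slice ξ φ) = T})
    (by rintro _ ⟨ξ, φ, rfl⟩; exact hle ξ φ)
    (by
      rintro _ ⟨ξ, φ, rfl⟩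
      generalize_proofs hp
      exact (hslice ξ φ :)) hx hx'
  rw [← ContinuousLinearMap.comp_assoc (toOp (unitL b.op V.βhat)), ← hE]
  exact h3

end

theorem IsRegular.fiberMapsTo_counit_left (hr : V.IsRegular) (h : η₀ ∈ V.Fix)
    (h₁ : adjoint η₀ ∘L η₀ = ContinuousLinearMap.id ℂ 𝔎) (x : V.hatA) :
    FiberMapsTo b.op V.βhat V.α b.op.base V.α
      (fun x : V.hatA => (counit h h₁ x : 𝔎 →L[ℂ] 𝔎)) (fun a : V.hatA => a.1) (V.hatDelta x)
      (toOp (unitR b.op V.α).symm ∘L x.1 ∘L toOp (unitR b.op V.α)) := by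
  intro S hS T hT
  have hSx := unitR_comp_ampL_comp_delta h h₁ hS x.2
  have hTx := hr.delta_comm_ampR x hT
  have hTU := unitR_comp_ampR b.op (V.id_intertwiners_α hT)
  have hTa : T ∘L x.1 = x.1 ∘L T := hT x
  rw [hatDelta_apply]
  constructor
  · rw [ContinuousLinearMap.comp_assoc]
    refine (eq_symm_comp ?_).symm
    have h2 := congrArg (fun R => R ∘L ampR b.op V.βhat V.α V.α T) hSx
    simp only [ContinuousLinearMap.comp_assoc] at h2
    rw [ContinuousLinearMap.comp_assoc, ContinuousLinearMap.comp_assoc, ← hTx]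
    exact h2.symm
  · rw [ContinuousLinearMap.comp_assoc]
    refine (eq_symm_comp ?_).symm
    rw [ContinuousLinearMap.comp_assoc, ContinuousLinearMap.comp_assoc, comp_reassoc hTU,
      comp_reassoc hTU, ContinuousLinearMap.comp_assoc, ContinuousLinearMap.comp_assoc, ← hSx,
      comp_reassoc hTa, ContinuousLinearMap.comp_assoc]

theorem IsRegular.fiberMapsTo_counit_right (hr : V.IsRegular) (h : η₀ ∈ V.Fix)
    (h₁ : adjoint η₀ ∘L η₀ = ContinuousLinearMap.id ℂ 𝔎) (x : V.hatA) :
    FiberMapsTo b.op V.βhat V.α V.βhat b.base (fun a : V.hatA => a.1)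
      (fun x : V.hatA => (counit h h₁ x : 𝔎 →L[ℂ] 𝔎)) (V.hatDelta x)
      (toOp (unitL b.op V.βhat).symm ∘L x.1 ∘L toOp (unitL b.op V.βhat)) := by
  intro S hS T hT
  have hTx := hr.unitL_comp_ampR_comp_delta h h₁ hT x.2
  have hSx := hr.delta_comm_ampL x hS
  have hSU := unitL_comp_ampL b.op (V.id_intertwiners_βhat hS)
  have hSa : S ∘L x.1 = x.1 ∘L S := hS x
  rw [hatDelta_apply]
  constructor
  · rw [ContinuousLinearMap.comp_assoc]
    refine (eq_symm_comp ?_).symm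
    rw [ContinuousLinearMap.comp_assoc, ContinuousLinearMap.comp_assoc]
    erw [comp_reassoc hSU, comp_reassoc hSU]
    rw [ContinuousLinearMap.comp_assoc, ContinuousLinearMap.comp_assoc, ← hTx,
      comp_reassoc hSa, ContinuousLinearMap.comp_assoc]
  · rw [ContinuousLinearMap.comp_assoc]
    refine (eq_symm_comp ?_).symm
    have h2 := congrArg (fun R => R ∘L ampL b.op V.βhat V.βhat V.α S) hTx
    simp only [ContinuousLinearMap.comp_assoc] at h2
    rw [ContinuousLinearMap.comp_assoc, ContinuousLinearMap.comp_assoc, ← hSx]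
    exact h2.symm

theorem IsRegular.isBoundedCounit (hr : V.IsRegular) (h : η₀ ∈ V.Fix)
    (h₁ : adjoint η₀ ∘L η₀ = ContinuousLinearMap.id ℂ 𝔎) :
    IsBoundedCounit b.op V.α V.βhat V.βhat_α V.α_βhat V.hatA V.hatDelta
      (fun x => (counit h h₁ x : 𝔎 →L[ℂ] 𝔎)) where
  hopf := ⟨hr.isNormalHopf.normal.isJointlySemiNormal, hr.isNormalHopf.coassoc⟩
  semiNormal := (hr.isJointlyNormal_counit h h₁ le_top (isBiAlgebra_top b)).isJointlySemiNormal
  left := hr.fiberMapsTo_counit_left h h₁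
  right := hr.fiberMapsTo_counit_right h h₁

end PMU
end PMU

end CPMU

end

theorem mainTheorem10 {𝔎 H : Type*}
    [NormedAddCommGroup 𝔎] [InnerProductSpace ℂ 𝔎] [CompleteSpace 𝔎]
    [NormedAddCommGroup H] [InnerProductSpace ℂ H] [CompleteSpace H]
    (b : CPMU.CBase 𝔎) (V : CPMU.PMU b H) (hV : V.IsEtale) :
    (∀ x ∈ V.hatA, ∀ y ∈ V.hatA, x ∘L y ∈ V.hatA) ∧
    (∀ x ∈ V.hatOne, ∀ y ∈ V.hatOne, x ∘L y ∈ V.hatOne) ∧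
    (∀ ξ ∈ CPMU.seqSpace V.β, ∀ η ∈ CPMU.seqSpace V.α,
      HasSum (fun n => adjoint (CPMU.ket2 b V.α V.β (ξ n)) ∘L
        CPMU.toOp V.V ∘L CPMU.ket2 b.op V.βhat V.α (η n)) (V.piV (V.omega ξ η)) ∧
      HasSum (fun n => adjoint (CPMU.ket2 b b.base V.β (ξ n)) ∘L
        CPMU.toOp V.triv ∘L CPMU.ket2 b.op b.op.base V.α (η n)) (V.piOne (V.omega ξ η))) ∧
    ∃ ε : V.hatA →ₗ[ℂ] V.hatOne,
      V.IsCompatibleHom ε ∧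
      (∀ ε' : V.hatA →ₗ[ℂ] V.hatOne, V.IsCompatibleHom ε' → ε' = ε) ∧
      (∀ η ∈ V.Fix, adjoint η ∘L η = ContinuousLinearMap.id ℂ 𝔎 →
        ∀ x : V.hatA, (ε x : 𝔎 →L[ℂ] 𝔎) = adjoint η ∘L x.1 ∘L η) ∧
      (V.IsRegular →
        CPMU.IsNormalHopf b.op V.α V.βhat V.βhat_α V.α_βhat V.hatA V.hatDelta ∧
        CPMU.IsJointlyNormal b.op V.α V.βhat V.hatA b.base b.op.base V.hatOne
          (fun x => (ε x : 𝔎 →L[ℂ] 𝔎)) ∧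
        CPMU.IsBoundedCounit b.op V.α V.βhat V.βhat_α V.α_βhat V.hatA V.hatDelta
          (fun x => (ε x : 𝔎 →L[ℂ] 𝔎))) := by
  obtain ⟨η₀, h, h₁⟩ := hV
  have hε := CPMU.PMU.isCompatibleHom_counit h h₁
  refine ⟨fun x hx y hy => V.hatA_mul_mem hx hy,
    fun x hx y hy => CPMU.PMU.hatOne_mul_mem h h₁ hx hy,
    fun ξ hξ η hη => ⟨V.hasSum_piV hξ hη, ?_⟩, CPMU.PMU.counit h h₁, hε, fun ε' hε' => hε'.ext hε,
    fun η hη hη₁ x => ?_, fun hr => ⟨hr.isNormalHopf,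
      hr.isJointlyNormal_counit h h₁ le_rfl (hr.isBiAlgebra_hatOne h h₁),
      hr.isBoundedCounit h h₁⟩⟩
  · simp only [V.bra2_comp_triv_comp_ket2]
    exact V.hasSum_piOne hξ hη
  · rw [hε.ext (CPMU.PMU.isCompatibleHom_counit hη hη₁)]
    rfl
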